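/- **Setting.** Let $N\ge 1$ and let $Z=(Z_0,\dots,Z_{N-1})$ be an $\mathbb R^N$-valued random variable with independent components, each of which is standard normally distributed, or Gamma distributed with density $\Gamma(\alpha+1)^{-1}z^{\alpha}e^{-z}$ on $(0,\infty)$, $\alpha>-1$, or Beta distributed with density proportional to $(1-z)^{\alpha}(1+z)^{\beta}$ on $(-1,1)$, $\alpha,\beta>-1$ (type and parameters may differ from component to component). Let $\mathbb P_Z$ be its law. Put $\rho(z)_j=z_j$ if $Z_j$ is Gamma distributed, $\rho(z)_j=1$ otherwise, and $\rho(z)^{\alpha/2}=\prod_j\rho(z)_j^{\alpha_j/2}$ for $\alpha\in\mathbb N_0^N$. For a Hilbert space $E$ and $m\in\mathbb N_0$ let $H^m_\rho(\mathbb R^N,\mathbb P_Z;E)$ be the space of all $\mathbf f\in L_2(\mathbb R^N,\mathbb P_Z;E)$ whose weak derivatives $\partial^\alpha \mathbf f$, $|\alpha|\le m$, exist on the open box where the density of $Z$ is positive and satisfy $\rho^{\alpha/2}\partial^\alpha \mathbf f\in L_2(\mathbb R^N,\mathbb P_Z;E)$, with norm $\|\mathbf f\|^2=\sum_{|\alpha|\le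 m}\|\rho^{\alpha/2}\partial^\alpha \mathbf f\|_{L_2}^2$. Let $V,H$ be separable complex Hilbert spaces with $V$ continuously and densely embedded in $H$. For $z\in\mathbb R^N$ let $a_z:V\times V\to\mathbb C$ be sesquilinear, with $z\mapsto a_z(u,u)$ measurable for all $u\in V$. Suppose that there are $K,\kappa>0$ such that, for $\mathbb P_Z$-almost every $z$ and all $u,v\in V$, $$|a_z(u,v)|\le K\|u\|_V\|v\|_V,\qquad \operatorname{Re}a_z(u,u)\ge\kappa\|u\|_V^2,\qquad a_z(u,v)=\overline{a_z(v,u)}.$$ Let $A_z$ be the operator in $H$ associated with $a_z$: $u\in\operatorname{dom}(A_z)$ and $A_zu=h$ iff $u\in V$ and $a_z(u,v)=(h\,|\,v)_H$ for all $v\in V$. Assume that for some $\bar s\ge1$ the domain of the fractional power $A_z^{\bar s}$ is the same for $\mathbb P_Z$-almost every $z$, and that the graph norms of $A_z^{\bar s}$ are equivalent, with a constant that does not depend on $z$. Let $D$ be the subspace with $\operatorname{dom}(A_z)=D$ for $\mathbb P_Z$-almost every $z$, with a norm $\|\cdot\|_D$ equivalent to the graph norms of the $A_z$. Let $\mathbf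 H=L_2(\mathbb R^N,\mathbb P_Z;H)$, and let $\mathbf A$ be the operator $(\mathbf A\mathbf f)(z)=A_z\mathbf f(z)$ in $\mathbf H$ with its maximal domain. Let $\mathbf R_n$ be the orthogonal projection of $\mathbf H$ onto the space $\mathcal P_n^N\otimes H$ of $H$-valued polynomials of total degree at most $n$. Let $\mathbf R_n\mathbf A\mathbf R_n$ denote the operator in $\mathcal P_n^N\otimes H$ associated with the form $(\mathbf w,\mathbf v)\mapsto\int a_z(\mathbf w(z),\mathbf v(z))\,d\mathbb P_Z(z)$ on $\mathcal P_n^N\otimes V$, extended by zero to the orthogonal complement. For $r>0$ and $\eta\in(\frac\pi2,\pi)$ let $$\gamma_r=\{se^{-i\eta}:s>r\}\cup\{re^{i\varphi}:-\eta<\varphi<\eta\}\cup\{se^{i\eta}:s>r\}.$$ **Proposition.** Let $\ell\in\mathbb N$, $\ell\ge1$, and suppose in addition that $z\mapsto a_z(u,v)$ belongs to $C^{2\ell}(\mathbb R^N)$ for all $u,v\in V$ and that there is a constant $C_{2\ell}\ge 0$ with $$|\rho(z)^{\alpha/2}\,\partial_z^\alpha a_z(u,v)|\le C_{2\ell}\|u\|_D\|v\|_H$$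 for $\mathbb P_Z$-almost every $z$ and all $u\in D$, $v\in V$, $|\alpha|\le2\ell$. Then for all $r>0$ and $\eta\in(\frac\pi2,\pi)$ there is $C\ge0$ such that, for all $\lambda\in\gamma_r$ and $n\ge1$, the operators $\lambda+\mathbf R_n\mathbf A\mathbf R_n$ and $\lambda+\mathbf A$ have bounded everywhere defined inverses on $\mathbf H$, and $$\big\|[(\lambda+\mathbf R_n\mathbf A\mathbf R_n)^{-1}\mathbf R_n-(\lambda+\mathbf A)^{-1}]\mathbf f\big\|_{\mathbf H}\le C\,n^{-\ell}\,\|\mathbf f\|_{H^{2\ell}_\rho(\mathbb R^N,\mathbb P_Z;H)}$$ for all $\mathbf f\in H^{2\ell}_\rho(\mathbb R^N,\mathbb P_Z;H)$. -/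

import Mathlib

open MeasureTheory ProbabilityTheory Set
open scoped ENNReal ContDiff ComplexConjugate

noncomputable section

namespace RandomEvolution

/-! ### Distributions of the components and the weight -/

/-- The three families of one-dimensional distributions. -/
inductive CompLaw where
  | normal : CompLaw
  | gamma (α : ℝ) : CompLaw
  | beta (α β : ℝ) : CompLaw

namespace CompLaw

/-- The parameters are larger than `-1`. -/
def Admissible : CompLaw → Prop
  | normal => True
  | gamma α => -1 < α
  | beta α β => -1 < α ∧ -1 < β

/-- The distribution: standard normal; Gamma with shape `α + 1` and rate `1`; Beta on `(-1, 1)`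
with density proportional to `(1 - z) ^ α * (1 + z) ^ β`. -/
def measure : CompLaw → Measure ℝ
  | normal => gaussianReal 0 1
  | gamma α => gammaMeasure (α + 1) 1
  | beta α β => volume.withDensity fun z => ENNReal.ofReal <|
      (Ioo (-1 : ℝ) 1).indicator (fun z =>
        Real.Gamma (α + β + 2) /
          (2 ^ (α + β + 1) * Real.Gamma (α + 1) * Real.Gamma (β + 1)) *
          (1 - z) ^ α * (1 + z) ^ β) z

/-- The open interval on which the density is positive. -/
def interval : CompLaw → Set ℝ
  | normal => univ
  | gamma _ => Ioi 0
  | beta _ _ => Ioo (-1) 1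

/-- The one-dimensional weight `ρ`: it is `z` for Gamma distributions and `1` otherwise. -/
def rho : CompLaw → ℝ → ℝ
  | normal, _ => 1
  | gamma _, z => z
  | beta _ _, _ => 1

end CompLaw

/-- The open box on which the product density is positive. -/
def box {N : ℕ} (d : Fin N → CompLaw) : Set (Fin N → ℝ) :=
  {z | ∀ j, z j ∈ (d j).interval}

/-- The weight `ρ(z)^(α/2) = ∏ j, ρ(z)_j ^ (α_j / 2)`. -/
def weight {N : ℕ} (d : Fin N → CompLaw) (α : Fin N → ℕ) (z : Fin N → ℝ) : ℝ :=
  ∏ j, (d j).rho (z j) ^ ((α j : ℝ) / 2)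

/-! ### Multi-indices and derivatives -/

/-- The finite set of multi-indices `α` with `|α| ≤ m`. -/
def multiIdx (N m : ℕ) : Finset (Fin N → ℕ) :=
  (Fintype.piFinset fun _ : Fin N => Finset.range (m + 1)).filter fun α => ∑ j, α j ≤ m

theorem mem_multiIdx {N m : ℕ} {α : Fin N → ℕ} : α ∈ multiIdx N m ↔ ∑ j, α j ≤ m := by
  simp only [multiIdx, Finset.mem_filter, Fintype.mem_piFinset, Finset.mem_range,
    and_iff_right_iff_imp]
  intro h j
  have := Finset.single_le_sum (f := α) (fun i _ => Nat.zero_le _) (Finset.mem_univ j)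
  omega

/-- The classical partial derivative in the `j`-th coordinate. -/
def partialDeriv {N : ℕ} {F : Type*} [NormedAddCommGroup F] [NormedSpace ℝ F] (j : Fin N)
    (g : (Fin N → ℝ) → F) : (Fin N → ℝ) → F :=
  fun z => fderiv ℝ g z (Pi.single j 1)

/-- The classical partial derivative `∂^α g` (used for functions of class `C^|α|` only). -/
def multiDeriv {N : ℕ} {F : Type*} [NormedAddCommGroup F] [NormedSpace ℝ F] (α : Fin N → ℕ)
    (g : (Fin N → ℝ) → F) : (Fin N → ℝ) → F :=
  (List.finRange N).foldr (fun j h => (partialDeriv j)^[α j] h) g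

/-- `g` is the weak derivative `∂^α f` on the open set `U`. -/
def IsWeakDeriv {N : ℕ} {E : Type*} [NormedAddCommGroup E] [NormedSpace ℝ E]
    (U : Set (Fin N → ℝ)) (α : Fin N → ℕ) (f g : (Fin N → ℝ) → E) : Prop :=
  LocallyIntegrableOn f U volume ∧ LocallyIntegrableOn g U volume ∧
    ∀ φ : (Fin N → ℝ) → ℝ, ContDiff ℝ ∞ φ → HasCompactSupport φ → tsupport φ ⊆ U →
      ∫ z, multiDeriv α φ z • f z = (-1 : ℝ) ^ (∑ j, α j) • ∫ z, φ z • g z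

open Classical in
/-- A weak derivative `∂^α f` on `U` (unique up to null sets), `0` if there is none. -/
def weakDeriv {N : ℕ} {E : Type*} [NormedAddCommGroup E] [NormedSpace ℝ E]
    (U : Set (Fin N → ℝ)) (α : Fin N → ℕ) (f : (Fin N → ℝ) → E) : (Fin N → ℝ) → E :=
  if h : ∃ g, IsWeakDeriv U α f g then h.choose else 0

/-! ### The weighted Sobolev space -/

/-- `f ∈ H_ρ^m(ℝ^N, μ; E)`: all weak derivatives up to order `m` exist, and
`ρ^(α/2) ∂^α f ∈ L₂(μ; E)`. -/
def MemSobolev {N : ℕ} {E : Type*} [NormedAddCommGroup E] [NormedSpace ℝ E]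
    (d : Fin N → CompLaw) (μ : Measure (Fin N → ℝ)) (m : ℕ) (f : Lp E 2 μ) : Prop :=
  ∀ α : Fin N → ℕ, ∑ j, α j ≤ m →
    (∃ g, IsWeakDeriv (box d) α f g) ∧
      MemLp (fun z => weight d α z • weakDeriv (box d) α f z) 2 μ

/-- The norm of `H_ρ^m(ℝ^N, μ; E)`. -/
def sobolevNorm {N : ℕ} {E : Type*} [NormedAddCommGroup E] [NormedSpace ℝ E]
    (d : Fin N → CompLaw) (μ : Measure (Fin N → ℝ)) (m : ℕ) (f : Lp E 2 μ) : ℝ :=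
  √(∑ α ∈ multiIdx N m,
      (eLpNorm (fun z => weight d α z • weakDeriv (box d) α f z) 2 μ).toReal ^ 2)

/-! ### Unbounded operators, resolvents, fractional powers -/

section Operators

variable {E : Type*} [NormedAddCommGroup E] [InnerProductSpace ℂ E]

/-- `R` is the bounded, everywhere defined inverse of `lam + T`. -/
def IsShiftInverse (T : E →ₗ.[ℂ] E) (lam : ℂ) (R : E →L[ℂ] E) : Prop :=
  (∀ f : E, ∃ h : R f ∈ T.domain, lam • R f + T ⟨R f, h⟩ = f) ∧
    ∀ u : T.domain, R (lam • (u : E) + T u) = u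

open Classical in
/-- The operator `(lam + T)⁻¹` if `lam + T` has a bounded inverse (`0` otherwise). -/
def shiftInverse (T : E →ₗ.[ℂ] E) (lam : ℂ) : E →L[ℂ] E :=
  if h : ∃ R, IsShiftInverse T lam R then h.choose else 0

/-- The graph norm `(‖T u‖² + ‖u‖²)^(1/2)` on the domain of `T`. -/
def graphNorm (T : E →ₗ.[ℂ] E) (u : T.domain) : ℝ :=
  √(‖T u‖ ^ 2 + ‖(u : E)‖ ^ 2)

/-- The fractional power `T^s`, `s > 0`, of a positive self-adjoint operator `T` with bounded
inverse: it is the inverse of the bounded injective operator `(T⁻¹)^s`, which is formed with the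
continuous functional calculus. -/
def fracPow [CompleteSpace E] (T : E →ₗ.[ℂ] E) (s : ℝ) : E →ₗ.[ℂ] E :=
  ((cfc (fun x : ℝ => x ^ s) (shiftInverse T 0) : E →L[ℂ] E).toLinearMap.toPMap ⊤).inverse

end Operators

/-! ### The operators associated with the forms -/

section Forms

variable {V H : Type*} [NormedAddCommGroup V] [InnerProductSpace ℂ V]
  [NormedAddCommGroup H] [InnerProductSpace ℂ H]

/-- The graph of the operator in `H` associated with a form `b` on `V`, where `V` is embedded into
`H` by `ι`: pairs `(ι u, h)` with `b(u, v) = (h | ι v)` for all `v`. Forms and the scalar product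
`(h | k) = inner ℂ k h` are linear in the first argument. -/
def formGraph (ι : V →L[ℂ] H) (b : V →ₗ[ℂ] V →ₗ⋆[ℂ] ℂ) : Submodule ℂ (H × H) where
  carrier := {p | ∃ u : V, ι u = p.1 ∧ ∀ v : V, b u v = inner ℂ (ι v) p.2}
  zero_mem' := ⟨0, by simp, by simp⟩
  add_mem' := by
    rintro p q ⟨u, hu, hu'⟩ ⟨w, hw, hw'⟩
    exact ⟨u + w, by simp [hu, hw], fun v => by simp [hu', hw']⟩
  smul_mem' := by
    rintro c p ⟨u, hu, hu'⟩
    exact ⟨c • u, by simp [hu], fun v => by simp [hu']⟩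

/-- The operator in `H` associated with the form `b`. -/
def formOperator (ι : V →L[ℂ] H) (b : V →ₗ[ℂ] V →ₗ⋆[ℂ] ℂ) : H →ₗ.[ℂ] H :=
  (formGraph ι b).toLinearPMap

/-- The graph is single-valued, so that `formOperator` has this graph. -/
theorem formGraph_singleValued {ι : V →L[ℂ] H} (hι : Function.Injective ι) (hd : DenseRange ι)
    (b : V →ₗ[ℂ] V →ₗ⋆[ℂ] ℂ) (p : H × H) (hp : p ∈ formGraph ι b) (h0 : p.1 = 0) : p.2 = 0 := by
  obtain ⟨u, hu, hv⟩ := hp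
  have hu0 : u = 0 := hι (by rw [hu, h0, map_zero])
  subst hu0
  refine hd.eq_zero_of_inner_right ℂ ?_
  intro v
  simpa using (hv v).symm

/-- The graph of the multiplication operator in `L₂(μ; H)` given by the family `A`: pairs `(f, g)`
with `f(z) ∈ dom (A z)` and `A z (f z) = g z` for almost every `z`. -/
def multGraph {X : Type*} [MeasurableSpace X] (μ : Measure X) (A : X → H →ₗ.[ℂ] H) :
    Submodule ℂ (Lp H 2 μ × Lp H 2 μ) where
  carrier := {p | ∀ᵐ z ∂μ, (p.1 z, p.2 z) ∈ (A z).graph}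
  zero_mem' := by
    change ∀ᵐ z ∂μ, ((0 : Lp H 2 μ) z, (0 : Lp H 2 μ) z) ∈ (A z).graph
    filter_upwards [Lp.coeFn_zero H 2 μ] with z hz
    rw [hz]
    exact (A z).graph.zero_mem
  add_mem' := by
    intro p q hp hq
    change ∀ᵐ z ∂μ, ((p.1 + q.1 : Lp H 2 μ) z, (p.2 + q.2 : Lp H 2 μ) z) ∈ (A z).graph
    filter_upwards [hp, hq, Lp.coeFn_add p.1 q.1, Lp.coeFn_add p.2 q.2] with z h1 h2 h3 h4
    rw [h3, h4]
    exact (A z).graph.add_mem h1 h2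
  smul_mem' := by
    intro c p hp
    change ∀ᵐ z ∂μ, ((c • p.1 : Lp H 2 μ) z, (c • p.2 : Lp H 2 μ) z) ∈ (A z).graph
    filter_upwards [hp, Lp.coeFn_smul c p.1, Lp.coeFn_smul c p.2] with z h1 h3 h4
    rw [h3, h4]
    exact (A z).graph.smul_mem c h1

/-- The multiplication operator `𝐀` in `L₂(μ; H)`: `(𝐀 f)(z) = A z (f z)`. -/
def multOperator {X : Type*} [MeasurableSpace X] (μ : Measure X) (A : X → H →ₗ.[ℂ] H) :
    Lp H 2 μ →ₗ.[ℂ] Lp H 2 μ :=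
  (multGraph μ A).toLinearPMap

/-! ### Polynomial chaos -/

/-- The polynomial `z ↦ ∑_{|α| ≤ n} z^α c_α` with coefficients in a complex vector space. -/
def polyEval {N : ℕ} {W : Type*} [AddCommGroup W] [Module ℂ W] (n : ℕ) (c : (Fin N → ℕ) → W)
    (z : Fin N → ℝ) : W :=
  ∑ α ∈ multiIdx N n, ((∏ j, z j ^ α j : ℝ) : ℂ) • c α

theorem polyEval_add {N : ℕ} {W : Type*} [AddCommGroup W] [Module ℂ W] (n : ℕ)
    (c e : (Fin N → ℕ) → W) (z : Fin N → ℝ) :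
    polyEval n (c + e) z = polyEval n c z + polyEval n e z := by
  simp [polyEval, smul_add, Finset.sum_add_distrib]

theorem polyEval_smul {N : ℕ} {W : Type*} [AddCommGroup W] [Module ℂ W] (n : ℕ) (t : ℂ)
    (c : (Fin N → ℕ) → W) (z : Fin N → ℝ) :
    polyEval n (t • c) z = t • polyEval n c z := by
  simp only [polyEval, Pi.smul_apply, Finset.smul_sum]
  exact Finset.sum_congr rfl fun α _ => smul_comm _ _ _

/-- The space `𝒫_n^N ⊗ H` of `H`-valued polynomials of degree at most `n`, inside `L₂(μ; H)`. -/
def chaosSpace {N : ℕ} (H : Type*) [NormedAddCommGroup H] [InnerProductSpace ℂ H]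
    (μ : Measure (Fin N → ℝ)) (n : ℕ) : Submodule ℂ (Lp H 2 μ) where
  carrier := {f | ∃ c : (Fin N → ℕ) → H, f =ᵐ[μ] polyEval n c}
  zero_mem' := ⟨0, by
    filter_upwards [Lp.coeFn_zero H 2 μ] with z hz
    rw [hz]
    simp [polyEval]⟩
  add_mem' := by
    rintro f g ⟨c, hc⟩ ⟨e, he⟩
    refine ⟨c + e, ?_⟩
    filter_upwards [hc, he, Lp.coeFn_add f g] with z h1 h2 h3
    rw [h3, Pi.add_apply, h1, h2, polyEval_add]
  smul_mem' := by
    rintro t f ⟨c, hc⟩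
    refine ⟨t • c, ?_⟩
    filter_upwards [hc, Lp.coeFn_smul t f] with z h1 h3
    rw [h3, Pi.smul_apply, h1, polyEval_smul]

/-- The polynomial chaos approximation `𝐑_n`: the orthogonal projection of `L₂(μ; H)` onto
`𝒫_n^N ⊗ H`. (That subspace is closed when `μ` has moments of all orders; its closure is taken
only because Mathlib's projection asks for a closed subspace.) -/
def chaosProj {N : ℕ} [CompleteSpace H] (μ : Measure (Fin N → ℝ)) (n : ℕ) :
    Lp H 2 μ →L[ℂ] Lp H 2 μ :=
  (chaosSpace H μ n).topologicalClosure.starProjection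

/-- The graph of `𝐑_n 𝐀 𝐑_n`. On `𝒫_n^N ⊗ H` this is the operator associated with the form
`(w, v) ↦ ∫ a_z(w(z), v(z)) dμ(z)` on `𝒫_n^N ⊗ V`; it is extended by zero to the orthogonal
complement, i.e. it is applied to `𝐑_n f`. -/
def chaosGraph {N : ℕ} [CompleteSpace H] (μ : Measure (Fin N → ℝ)) (ι : V →L[ℂ] H)
    (a : (Fin N → ℝ) → V →ₗ[ℂ] V →ₗ⋆[ℂ] ℂ) (n : ℕ) :
    Submodule ℂ (Lp H 2 μ × Lp H 2 μ) where
  carrier := {p | p.2 ∈ chaosSpace H μ n ∧ ∃ c : (Fin N → ℕ) → V,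
    (chaosProj μ n p.1 =ᵐ[μ] fun z => ι (polyEval n c z)) ∧
    ∀ (e : (Fin N → ℕ) → V) (v : Lp H 2 μ), (v =ᵐ[μ] fun z => ι (polyEval n e z)) →
      Integrable (fun z => a z (polyEval n c z) (polyEval n e z)) μ ∧
      ∫ z, a z (polyEval n c z) (polyEval n e z) ∂μ = inner ℂ v p.2}
  zero_mem' := by
    refine ⟨Submodule.zero_mem _, 0, ?_, fun e v _ => ?_⟩
    · rw [Prod.fst_zero, map_zero]
      filter_upwards [Lp.coeFn_zero H 2 μ] with z hz
      rw [hz]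
      simp [polyEval]
    · simp [polyEval]
  add_mem' := by
    rintro p q ⟨hp, c, hc, hc'⟩ ⟨hq, c', hq1, hq'⟩
    refine ⟨Submodule.add_mem _ hp hq, c + c', ?_, fun e v hv => ?_⟩
    · rw [Prod.fst_add, map_add]
      filter_upwards [hc, hq1, Lp.coeFn_add (chaosProj μ n p.1) (chaosProj μ n q.1)]
        with z h1 h2 h3
      rw [h3, Pi.add_apply, h1, h2, polyEval_add, map_add]
    · obtain ⟨i1, e1⟩ := hc' e v hv
      obtain ⟨i2, e2⟩ := hq' e v hv
      simp only [polyEval_add, map_add, LinearMap.add_apply]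
      exact ⟨i1.add i2, by rw [integral_add i1 i2, e1, e2, Prod.snd_add, inner_add_right]⟩
  smul_mem' := by
    rintro t p ⟨hp, c, hc, hc'⟩
    refine ⟨Submodule.smul_mem _ t hp, t • c, ?_, fun e v hv => ?_⟩
    · rw [Prod.smul_fst, map_smul]
      filter_upwards [hc, Lp.coeFn_smul t (chaosProj μ n p.1)] with z h1 h3
      rw [h3, Pi.smul_apply, h1, polyEval_smul, map_smul]
    · obtain ⟨i1, e1⟩ := hc' e v hv
      simp only [polyEval_smul, map_smul, LinearMap.smul_apply]
      exact ⟨i1.smul t, by rw [integral_smul, e1, Prod.smul_snd, inner_smul_right, smul_eq_mul]⟩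

/-- The operator `𝐑_n 𝐀 𝐑_n` in `L₂(μ; H)`. -/
def chaosOperator {N : ℕ} [CompleteSpace H] (μ : Measure (Fin N → ℝ)) (ι : V →L[ℂ] H)
    (a : (Fin N → ℝ) → V →ₗ[ℂ] V →ₗ⋆[ℂ] ℂ) (n : ℕ) : Lp H 2 μ →ₗ.[ℂ] Lp H 2 μ :=
  (chaosGraph μ ι a n).toLinearPMap

end Forms

/-! ### The contour -/

/-- The contour `γ_r` with opening angle `η`: two rays and a circular arc. -/
def contour (η r : ℝ) : Set ℂ :=
  (fun s : ℝ => -(s : ℂ) * Complex.exp (-(η : ℂ) * Complex.I)) '' Iio (-r) ∪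
    (fun φ : ℝ => (r : ℂ) * Complex.exp ((φ : ℂ) * Complex.I)) '' Ioo (-η) η ∪
    (fun s : ℝ => (s : ℂ) * Complex.exp ((η : ℂ) * Complex.I)) '' Ioi r

end RandomEvolution

end

open RandomEvolution

set_option linter.unusedSectionVars false
set_option linter.unusedSimpArgs false

noncomputable section

namespace RandomEvolution

/-! ### Elliptic forms and their resolvents -/

/-! The resolvents of `A_z` depend on `z` through unbounded operators, so the first task is to make
this dependence smooth. Fix a parameter `z₀` at which all almost sure hypotheses hold, and put `B₀ =
A_{z₀}⁻¹` and `S_z = A_z B₀`. Because the domains coincide, `S_z` acts on all of `H`; it is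
determined by `(S_z h | v) = a_z(B₀ h, v)`, and the bounds on the derivatives of `a_z` become
weighted operator bounds for the derivatives of `S_z`. Moreover `lam + A_z = (lam B₀ + S_z) B₀⁻¹`,
so the exact solution is `u = B₀ y` with `y = (lam B₀ + S_z)⁻¹ f` (`exists_quotientFamily`).

The factor `lam B₀ + S_z` is invertible with a bound independent of `z` and of `lam` on the contour.
The comparison of fractional powers with exponent at least one descends to `‖A_z⁻¹ k‖ ≤ M ‖B₀ k‖` by
the Löwner–Heinz inequality (`norm_inverse_le_of_graphNorm_le`); by duality this bounds `S_z⁻¹`, and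
the sector estimate for symmetric coercive forms handles the term with `lam`
(`IsEllipticForm.surjective_and_bound`). Differentiating the inverse then shows that `y` has the
Sobolev regularity of `f`, uniformly in `lam` (`WeightedReg.inverse`).

The operator `𝐑_n 𝐀 𝐑_n` is the Galerkin operator on polynomials. If `x` is any `H`-valued
polynomial of degree at most `n`, then `B₀ x` is an admissible competitor, and its distance to the
Galerkin solution solves a discrete equation with right side `(lam B₀ + S)(y - x)`. The discrete
resolvent estimate gains a factor `|lam|⁻¹`, and `|lam|` is at least `r`, so the error is at most a
constant times `‖y - x‖` (`norm_galerkin_sub_le`). The approximation is thus applied to `y` in `H`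
and not to `u` in `V`.

It remains to approximate `y` by polynomials at rate `n^(-l)` (`exists_chaos_approx`). Each
component law is the weight of a Sturm–Liouville operator with polynomial eigenfunctions whose
eigenvalues have gaps bounded below. Integrating by parts `2l` times in one coordinate multiplies
the expansion coefficients by a product of `2l` eigenvalue differences; as the differentiated
eigenpolynomials are again orthogonal, Bessel's inequality bounds the tail (`sum_coeff_sq_le`). The
square root of a product of `2l` factors of size `n` gives `n^l`, which is why `2l` derivatives
yield order `l`. Completeness of the eigenpolynomials follows from the determinacy of laws with
exponential moments (`ext_of_moments`). -/

theorem sector_lower_bound {q : ℝ} (hq0 : 0 ≤ q) (hq1 : q < 1) {lam : ℂ}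
    (hlam : -q * ‖lam‖ ≤ lam.re) {s t : ℝ} (hs : 0 ≤ s) (ht : 0 ≤ t) :
    √((1 - q) / 2) * (‖lam‖ * s + t) ≤ ‖lam * s + t‖ := by
  have h0 : 0 ≤ ‖lam‖ * s + t := by positivity
  refine le_of_sq_le_sq ?_ (norm_nonneg _)
  rw [mul_pow, Real.sq_sqrt (by linarith), ← Complex.normSq_eq_norm_sq, Complex.normSq_apply]
  have e : ‖lam‖ ^ 2 = lam.re * lam.re + lam.im * lam.im := by
    rw [← Complex.normSq_eq_norm_sq, Complex.normSq_apply]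
  simp only [Complex.add_re, Complex.mul_re, Complex.ofReal_re, Complex.ofReal_im, mul_zero,
    sub_zero, Complex.add_im, Complex.mul_im, zero_add, add_zero]
  have h1 : -q * ‖lam‖ * (s * t) ≤ lam.re * (s * t) :=
    mul_le_mul_of_nonneg_right hlam (by positivity)
  -- After `lam.re` is replaced by `-q * ‖lam‖`, this square is exactly the difference between the
  -- two sides of the squared inequality.
  have h2 : 0 ≤ (1 + q) / 2 * (‖lam‖ * s - t) ^ 2 := by positivity
  have h3 : (lam.re * s + t) * (lam.re * s + t) + lam.im * s * (lam.im * s)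
      = ‖lam‖ ^ 2 * s ^ 2 + 2 * (lam.re * (s * t)) + t ^ 2 := by rw [e]; ring
  rw [h3]
  nlinarith

section Abstract

variable {X Y : Type*} [NormedAddCommGroup X] [InnerProductSpace ℂ X]
  [NormedAddCommGroup Y] [InnerProductSpace ℂ Y]

/-- A bounded, coercive and Hermitian sesquilinear form. -/
structure IsEllipticForm (K κ : ℝ) (b : X →ₗ[ℂ] X →ₗ⋆[ℂ] ℂ) : Prop where
  bdd : ∀ u v, ‖b u v‖ ≤ K * ‖u‖ * ‖v‖
  coer : ∀ u, κ * ‖u‖ ^ 2 ≤ (b u u).re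
  symm : ∀ u v, b u v = conj (b v u)

namespace IsEllipticForm

variable {K κ : ℝ} {b : X →ₗ[ℂ] X →ₗ⋆[ℂ] ℂ}

theorem apply_self (hb : IsEllipticForm K κ b) (u : X) : b u u = ((b u u).re : ℂ) :=
  (Complex.conj_eq_iff_re.mp (hb.symm u u).symm).symm

theorem re_nonneg (hb : IsEllipticForm K κ b) (hκ : 0 < κ) (u : X) : 0 ≤ (b u u).re :=
  le_trans (by positivity) (hb.coer u)

/-- The map `j` is kept general because the estimate is used twice: for the embedding of `V` into
`H` at a fixed parameter, and for the embedding of the `V`-valued polynomials into `L₂`. -/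
theorem lower_bound (hb : IsEllipticForm K κ b) (hκ : 0 < κ) (j : X →L[ℂ] Y) {q : ℝ}
    (hq0 : 0 ≤ q) (hq1 : q < 1) {lam : ℂ} (hlam : -q * ‖lam‖ ≤ lam.re) (u : X) :
    √((1 - q) / 2) * (‖lam‖ * ‖j u‖ ^ 2 + (b u u).re)
      ≤ ‖lam * inner ℂ (j u) (j u) + b u u‖ := by
  have := sector_lower_bound hq0 hq1 hlam (sq_nonneg ‖j u‖) (hb.re_nonneg hκ u)
  rw [hb.apply_self u, inner_self_eq_norm_sq_to_K]
  simpa using this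

theorem exists_operator [CompleteSpace X] (hb : IsEllipticForm K κ b) :
    ∃ T : X →L[ℂ] X, ∀ u v, inner ℂ v (T u) = b u v := by
  -- The Riesz representation asks for a form that is conjugate linear in its first argument;
  -- flipping `b` provides this, and Hermitian symmetry undoes the flip.
  let B : X →L⋆[ℂ] X →L[ℂ] ℂ := LinearMap.mkContinuous₂ b.flip K
    (fun u v => (hb.bdd v u).trans_eq (by ring))
  refine ⟨InnerProductSpace.continuousLinearMapOfBilin B, fun u v => ?_⟩
  rw [← inner_conj_symm, InnerProductSpace.continuousLinearMapOfBilin_apply]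
  exact (hb.symm u v).symm

/-- Lax–Milgram: the form is represented by `lam j* j + T₀`, which is coercive in modulus by
`lower_bound` and the coercivity of `b`. The solution operator is the inverse composed with `j*`. -/
theorem exists_solver [CompleteSpace X] [CompleteSpace Y] (hb : IsEllipticForm K κ b)
    (hκ : 0 < κ) (j : X →L[ℂ] Y) {q : ℝ}
    (hq0 : 0 ≤ q) (hq1 : q < 1) {lam : ℂ} (hlam : -q * ‖lam‖ ≤ lam.re) :
    ∃ S : Y →L[ℂ] X, ∀ f v,
      lam * inner ℂ (j v) (j (S f)) + b (S f) v = inner ℂ (j v) f := by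
  obtain ⟨T0, hT0⟩ := hb.exists_operator
  let T : X →L[ℂ] X := lam • (ContinuousLinearMap.adjoint j ∘L j) + T0
  have hT : ∀ u v, inner ℂ v (T u) = lam * inner ℂ (j v) (j u) + b u v := fun u v => by
    simp only [T, add_apply, smul_apply,
      ContinuousLinearMap.comp_apply, inner_add_right, inner_smul_right, hT0,
      ContinuousLinearMap.adjoint_inner_right]
  have hc : 0 < √((1 - q) / 2) * κ := by
    have : 0 < √((1 - q) / 2) := Real.sqrt_pos.2 (by linarith)
    positivity
  have hU : IsUnit T := by
    refine ContinuousLinearMap.isUnit_of_forall_le_norm_inner_map T (c := ⟨_, hc.le⟩) hc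
      fun x => ?_
    rw [← inner_conj_symm, RCLike.norm_conj, hT]
    refine le_trans ?_ (hb.lower_bound hκ j hq0 hq1 hlam x)
    change ‖x‖ ^ 2 * (√((1 - q) / 2) * κ) ≤ _
    have h1 := hb.coer x
    have h2 : 0 ≤ ‖lam‖ * ‖j x‖ ^ 2 := by positivity
    calc ‖x‖ ^ 2 * (√((1 - q) / 2) * κ) = √((1 - q) / 2) * (κ * ‖x‖ ^ 2) := by ring
      _ ≤ _ := mul_le_mul_of_nonneg_left (by linarith) (Real.sqrt_nonneg _)
  obtain ⟨U, hU'⟩ := hU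
  refine ⟨(↑U⁻¹ : X →L[ℂ] X) ∘L ContinuousLinearMap.adjoint j, fun f v => ?_⟩
  rw [← hT, ← hU', ContinuousLinearMap.comp_apply, ← mul_apply_eq_comp, U.mul_inv,
    one_apply_eq_self, ContinuousLinearMap.adjoint_inner_right]

theorem eq_zero_of_solves (hb : IsEllipticForm K κ b) (hκ : 0 < κ) (j : X →L[ℂ] Y) {q : ℝ}
    (hq0 : 0 ≤ q) (hq1 : q < 1) {lam : ℂ} (hlam : -q * ‖lam‖ ≤ lam.re) {u : X}
    (h : ∀ v, lam * inner ℂ (j v) (j u) + b u v = 0) : u = 0 := by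
  have h1 := hb.lower_bound hκ j hq0 hq1 hlam u
  rw [h u, norm_zero] at h1
  have hc : 0 < √((1 - q) / 2) := Real.sqrt_pos.2 (by linarith)
  have h2 := hb.coer u
  have h3 : 0 ≤ ‖lam‖ * ‖j u‖ ^ 2 := by positivity
  have h4 : κ * ‖u‖ ^ 2 ≤ 0 := by
    by_contra h5
    push Not at h5
    have : 0 < √((1 - q) / 2) * (‖lam‖ * ‖j u‖ ^ 2 + (b u u).re) := by
      apply mul_pos hc; linarith
    linarith
  have h5 : ‖u‖ ^ 2 ≤ 0 := by
    by_contra h6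
    push Not at h6
    have : 0 < κ * ‖u‖ ^ 2 := mul_pos hκ h6
    linarith
  simpa using le_antisymm h5 (sq_nonneg _)

theorem eq_of_solves (hb : IsEllipticForm K κ b) (hκ : 0 < κ) (j : X →L[ℂ] Y) {q : ℝ}
    (hq0 : 0 ≤ q) (hq1 : q < 1) {lam : ℂ} (hlam : -q * ‖lam‖ ≤ lam.re) {u w : X}
    (h : ∀ v, lam * inner ℂ (j v) (j u) + b u v = lam * inner ℂ (j v) (j w) + b w v) :
    u = w := by
  rw [← sub_eq_zero]
  refine hb.eq_zero_of_solves hκ j hq0 hq1 hlam fun v => ?_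
  have := h v
  simp only [map_sub, inner_sub_right, LinearMap.sub_apply]
  linear_combination this

/-- Testing with the solution bounds `‖lam‖ ‖j u‖² + b(u, u)` by `‖j u‖ ‖f‖`. Dropping the form
leaves a resolvent bound with decay in `lam` whose constant depends on the sector only. -/
theorem norm_solution_le (hb : IsEllipticForm K κ b) (hκ : 0 < κ) (j : X →L[ℂ] Y) {q : ℝ}
    (hq0 : 0 ≤ q) (hq1 : q < 1) {lam : ℂ} (hlam : -q * ‖lam‖ ≤ lam.re) {u : X} {f : Y}
    (h : lam * inner ℂ (j u) (j u) + b u u = inner ℂ (j u) f) :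
    ‖lam‖ * ‖j u‖ ≤ (√((1 - q) / 2))⁻¹ * ‖f‖ := by
  have h1 := hb.lower_bound hκ j hq0 hq1 hlam u
  rw [h] at h1
  have hc : 0 < √((1 - q) / 2) := Real.sqrt_pos.2 (by linarith)
  have h2 := hb.re_nonneg hκ u
  have h3 := norm_inner_le_norm (𝕜 := ℂ) (j u) f
  rw [inv_mul_eq_div, le_div_iff₀ hc]
  by_cases hj : ‖j u‖ = 0
  · rw [hj]; simp
  · have hj' : 0 < ‖j u‖ := lt_of_le_of_ne (norm_nonneg _) (Ne.symm hj)
    refine le_of_mul_le_mul_left ?_ hj'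
    have : 0 ≤ √((1 - q) / 2) * (b u u).re := by positivity
    nlinarith

theorem norm_solution_zero_le (hb : IsEllipticForm K κ b) (hκ : 0 < κ) (j : X →L[ℂ] Y)
    {u : X} {f : Y} (h : b u u = inner ℂ (j u) f) :
    ‖u‖ ≤ ‖j‖ / κ * ‖f‖ := by
  have h1 := hb.coer u
  rw [h] at h1
  have h2 := (Complex.re_le_norm _).trans (norm_inner_le_norm (𝕜 := ℂ) (j u) f)
  have h3 := j.le_opNorm u
  rw [div_mul_eq_mul_div, le_div_iff₀ hκ]
  by_cases hu : ‖u‖ = 0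
  · rw [hu]; simp; positivity
  · have hu' : 0 < ‖u‖ := lt_of_le_of_ne (norm_nonneg _) (Ne.symm hu)
    refine le_of_mul_le_mul_left ?_ hu'
    have : ‖j u‖ * ‖f‖ ≤ ‖j‖ * ‖u‖ * ‖f‖ := by gcongr
    nlinarith

end IsEllipticForm

/-! ### Shifted inverses -/

theorem IsShiftInverse.unique {T : Y →ₗ.[ℂ] Y} {lam : ℂ} {R R' : Y →L[ℂ] Y}
    (h : IsShiftInverse T lam R) (h' : IsShiftInverse T lam R') : R = R' := by
  ext f
  obtain ⟨hf, e⟩ := h.1 f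
  have := h'.2 ⟨R f, hf⟩
  rw [e] at this
  exact this.symm

theorem IsShiftInverse.shiftInverse_eq {T : Y →ₗ.[ℂ] Y} {lam : ℂ} {R : Y →L[ℂ] Y}
    (h : IsShiftInverse T lam R) : shiftInverse T lam = R := by
  have hex : ∃ R, IsShiftInverse T lam R := ⟨R, h⟩
  rw [shiftInverse, dif_pos hex]
  exact hex.choose_spec.unique h

/-- The operators in question are defined through their graphs, so the two halves of being an
inverse are checked there, without any description of domains. -/
theorem isShiftInverse_of_graph {g : Submodule ℂ (Y × Y)}
    (hg : ∀ x ∈ g, x.1 = 0 → x.2 = 0) {lam : ℂ} {R : Y →L[ℂ] Y}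
    (h1 : ∀ f, (R f, f - lam • R f) ∈ g)
    (h2 : ∀ x ∈ g, R (lam • x.1 + x.2) = x.1) :
    IsShiftInverse g.toLinearPMap lam R := by
  have hgr := g.toLinearPMap_graph_eq hg
  refine ⟨fun f => ?_, fun u => ?_⟩
  · have hm := h1 f
    rw [← hgr, LinearPMap.mem_graph_iff] at hm
    obtain ⟨y, hy1, hy2⟩ := hm
    have hy1' : (y : Y) = R f := hy1
    have hd : R f ∈ g.toLinearPMap.domain := hy1' ▸ y.2
    refine ⟨hd, ?_⟩
    have : (⟨R f, hd⟩ : g.toLinearPMap.domain) = y := Subtype.ext hy1'.symm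
    rw [this, hy2]
    simp
  · refine h2 ((u : Y), g.toLinearPMap u) ?_
    exact hgr.le (g.toLinearPMap.mem_graph u)

end Abstract

/-! ### The operator of an elliptic form and its bounded inverse -/

section FormOp

variable {V H : Type*} [NormedAddCommGroup V] [InnerProductSpace ℂ V] [CompleteSpace V]
  [NormedAddCommGroup H] [InnerProductSpace ℂ H] [CompleteSpace H]
  {ι : V →L[ℂ] H} {K κ : ℝ} {b : V →ₗ[ℂ] V →ₗ⋆[ℂ] ℂ}

theorem formOperator_graph (hι : Function.Injective ι) (hd : DenseRange ι)
    (b : V →ₗ[ℂ] V →ₗ⋆[ℂ] ℂ) : (formOperator ι b).graph = formGraph ι b :=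
  Submodule.toLinearPMap_graph_eq _ (formGraph_singleValued hι hd b)

theorem inner_ext_denseRange (hd : DenseRange ι) {x y : H}
    (h : ∀ v, inner ℂ (ι v) x = inner ℂ (ι v) y) : x = y := by
  rw [← sub_eq_zero]
  refine hd.eq_zero_of_inner_right ℂ fun v => ?_
  rw [inner_sub_right, h, sub_self]

theorem IsEllipticForm.isShiftInverse (hb : IsEllipticForm K κ b) (hκ : 0 < κ)
    (hι : Function.Injective ι) (hd : DenseRange ι) {q : ℝ}
    (hq0 : 0 ≤ q) (hq1 : q < 1) {lam : ℂ} (hlam : -q * ‖lam‖ ≤ lam.re) {S : H →L[ℂ] V}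
    (hS : ∀ f v, lam * inner ℂ (ι v) (ι (S f)) + b (S f) v = inner ℂ (ι v) f) :
    IsShiftInverse (formOperator ι b) lam (ι ∘L S) := by
  refine isShiftInverse_of_graph (formGraph_singleValued hι hd b) (fun f => ?_) ?_
  · refine ⟨S f, rfl, fun v => ?_⟩
    rw [← sub_eq_iff_eq_add'.2 (hS f v).symm]
    dsimp only
    rw [inner_sub_right, inner_smul_right]
    rfl
  · rintro ⟨x, h⟩ ⟨u, hu, hu'⟩
    dsimp only at hu hu' ⊢
    rw [ContinuousLinearMap.comp_apply, ← hu]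
    congr 1
    refine hb.eq_of_solves hκ ι hq0 hq1 hlam fun v => ?_
    rw [hS, hu', inner_add_right, inner_smul_right]

/-- Data of the inverse `B = ι ∘ G` of the operator of an elliptic form. -/
theorem IsEllipticForm.exists_inverse (hb : IsEllipticForm K κ b) (hκ : 0 < κ)
    (hι : Function.Injective ι) (hd : DenseRange ι) :
    ∃ G : H →L[ℂ] V, (∀ h v, b (G h) v = inner ℂ (ι v) h) ∧
      shiftInverse (formOperator ι b) 0 = ι ∘L G ∧
      0 ≤ ι ∘L G ∧ ‖ι ∘L G‖ ≤ ‖ι‖ * (‖ι‖ / κ) ∧ Function.Injective (ι ∘L G) ∧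
      (∀ x, x ∈ (formOperator ι b).domain ↔ ∃ h, ι (G h) = x) ∧
      (∀ h (hx : ι (G h) ∈ (formOperator ι b).domain), formOperator ι b ⟨ι (G h), hx⟩ = h) := by
  -- The inverse is the case `lam = 0`, `q = 0` of the variational solver.
  have h0 : -(0 : ℝ) * ‖(0 : ℂ)‖ ≤ (0 : ℂ).re := by simp
  obtain ⟨G, hG⟩ := hb.exists_solver hκ ι le_rfl zero_lt_one h0
  have hG' : ∀ h v, b (G h) v = inner ℂ (ι v) h := fun h v => by simpa using hG h v
  have hgr : ∀ h, (ι (G h), h) ∈ (formOperator ι b).graph := fun h => by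
    rw [formOperator_graph hι hd]
    exact ⟨G h, rfl, hG' h⟩
  have hinj : Function.Injective (ι ∘L G) := by
    rw [injective_iff_map_eq_zero]
    intro h hh
    exact formGraph_singleValued hι hd b (ι (G h), h) ⟨G h, rfl, hG' h⟩ hh
  refine ⟨G, hG', (hb.isShiftInverse hκ hι hd le_rfl zero_lt_one h0 hG).shiftInverse_eq, ?_, ?_,
    hinj, ?_, ?_⟩
  · rw [ContinuousLinearMap.nonneg_iff_isPositive, ContinuousLinearMap.isPositive_iff_complex]
    intro x
    have e : inner ℂ ((ι ∘L G) x) x = ((b (G x) (G x)).re : ℂ) := by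
      rw [← hb.apply_self, hG']; rfl
    rw [e]
    exact ⟨by simp, by simpa using hb.re_nonneg hκ _⟩
  · refine ContinuousLinearMap.opNorm_le_bound _ (by positivity) fun x => ?_
    have h1 := hb.norm_solution_zero_le hκ ι (u := G x) (f := x) (by rw [hG'])
    calc ‖ι (G x)‖ ≤ ‖ι‖ * ‖G x‖ := ι.le_opNorm _
      _ ≤ ‖ι‖ * (‖ι‖ / κ * ‖x‖) := by gcongr
      _ = _ := by ring
  · intro x
    constructor
    · intro hx
      have := (formOperator ι b).mem_graph ⟨x, hx⟩
      rw [formOperator_graph hι hd] at this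
      obtain ⟨u, hu, hu'⟩ := this
      refine ⟨formOperator ι b ⟨x, hx⟩, ?_⟩
      dsimp only at hu
      refine Eq.trans (congrArg ι ?_) hu
      refine hb.eq_of_solves hκ ι le_rfl zero_lt_one h0 fun v => ?_
      rw [hG', hu']
      simp
    · rintro ⟨h, rfl⟩
      exact LinearPMap.mem_domain_of_mem_graph (hgr h)
  · intro h hx
    have := hgr h
    rw [LinearPMap.mem_graph_iff] at this
    obtain ⟨y, hy1, hy2⟩ := this
    dsimp only at hy1 hy2
    refine Eq.trans (congrArg _ ?_) hy2
    exact Subtype.ext hy1.symm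

end FormOp

/-! ### Comparison of fractional powers -/

section Heinz

variable {H : Type*} [NormedAddCommGroup H] [InnerProductSpace ℂ H] [CompleteSpace H]

/-- Duality in the manner of Douglas: taking `x = A k` gives `‖A k‖² = (A (A k) | k) = (B x' | k) =
(x' | B k)` with `‖x'‖ ≤ c ‖A k‖`. -/
theorem norm_le_of_range_comparison {A B : H →L[ℂ] H} (hA : IsSelfAdjoint A)
    (hB : IsSelfAdjoint B) {c : ℝ} (h : ∀ x, ∃ x', A x = B x' ∧ ‖x'‖ ≤ c * ‖x‖) (k : H) :
    ‖A k‖ ≤ c * ‖B k‖ := by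
  by_cases h0 : ‖A k‖ = 0
  · obtain ⟨x', -, hx'⟩ := h (A k)
    by_cases hc : 0 ≤ c
    · rw [h0]; positivity
    · push Not at hc
      -- No sign is assumed for `c`; the hypothesis at `B k` shows that the right side is
      -- nonnegative all the same.
      obtain ⟨y', -, hy'⟩ := h (B k)
      rw [h0]
      exact (norm_nonneg _).trans hy'
  obtain ⟨x', e, hx'⟩ := h (A k)
  have e1 : inner ℂ (A k) (A k) = inner ℂ x' (B k) := by
    have h1 := ContinuousLinearMap.adjoint_inner_left A k (A k)
    have h2 := ContinuousLinearMap.adjoint_inner_left B k x'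
    rw [hA.adjoint_eq] at h1
    rw [hB.adjoint_eq] at h2
    rw [← h1, e, h2]
  have e2 : ‖A k‖ * ‖A k‖ ≤ ‖x'‖ * ‖B k‖ := by
    have := norm_inner_le_norm (𝕜 := ℂ) x' (B k)
    rw [← e1, inner_self_eq_norm_sq_to_K] at this
    simpa [pow_two] using this
  have hp : 0 < ‖A k‖ := lt_of_le_of_ne (norm_nonneg _) (Ne.symm h0)
  have : ‖A k‖ * ‖A k‖ ≤ ‖A k‖ * (c * ‖B k‖) := by
    calc _ ≤ _ := e2
      _ ≤ c * ‖A k‖ * ‖B k‖ := by gcongr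
      _ = _ := by ring
  exact le_of_mul_le_mul_left this hp

theorem mul_self_le_of_norm_le {A B : H →L[ℂ] H} (hA : IsSelfAdjoint A)
    (hB : IsSelfAdjoint B) {c : ℝ} (h : ∀ k, ‖A k‖ ≤ c * ‖B k‖) :
    A * A ≤ c ^ 2 • (B * B) := by
  rw [ContinuousLinearMap.le_def, ContinuousLinearMap.isPositive_iff_complex]
  intro x
  have key : ∀ {T : H →L[ℂ] H}, IsSelfAdjoint T → inner ℂ ((T * T) x) x = ((‖T x‖ ^ 2 : ℝ) : ℂ) := by
    intro T hT
    have := ContinuousLinearMap.adjoint_inner_left T x (T x)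
    rw [hT.adjoint_eq] at this
    rw [mul_apply_eq_comp, this, inner_self_eq_norm_sq_to_K]
    simp
  have e : inner ℂ ((c ^ 2 • (B * B) - A * A) x) x
      = ((c ^ 2 * ‖B x‖ ^ 2 - ‖A x‖ ^ 2 : ℝ) : ℂ) := by
    rw [sub_apply, smul_apply, inner_sub_left, key hA, inner_smul_left_eq_smul, key hB]
    push_cast
    simp [Complex.real_smul]
  rw [e]
  refine ⟨by rw [RCLike.re_eq_complex_re, Complex.ofReal_re], ?_⟩
  simp only [RCLike.re_eq_complex_re, Complex.ofReal_re]
  have := pow_le_pow_left₀ (norm_nonneg _) (h x) 2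
  rw [mul_pow] at this
  linarith

theorem norm_le_of_mul_self_le {A B : H →L[ℂ] H} (hA : IsSelfAdjoint A)
    (hB : IsSelfAdjoint B) {c : ℝ} (hc : 0 ≤ c) (h : A * A ≤ c ^ 2 • (B * B)) (k : H) :
    ‖A k‖ ≤ c * ‖B k‖ := by
  rw [ContinuousLinearMap.le_def, ContinuousLinearMap.isPositive_iff_complex] at h
  have h := (h k).2
  have key : ∀ {T : H →L[ℂ] H}, IsSelfAdjoint T → inner ℂ ((T * T) k) k = ((‖T k‖ ^ 2 : ℝ) : ℂ) := by
    intro T hT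
    have := ContinuousLinearMap.adjoint_inner_left T k (T k)
    rw [hT.adjoint_eq] at this
    rw [mul_apply_eq_comp, this, inner_self_eq_norm_sq_to_K]
    simp
  have e : inner ℂ ((c ^ 2 • (B * B) - A * A) k) k
      = ((c ^ 2 * ‖B k‖ ^ 2 - ‖A k‖ ^ 2 : ℝ) : ℂ) := by
    rw [sub_apply, smul_apply, inner_sub_left, key hA, inner_smul_left_eq_smul, key hB]
    push_cast
    simp [Complex.real_smul]
  rw [e] at h
  simp only [RCLike.re_eq_complex_re, Complex.ofReal_re] at h
  refine le_of_sq_le_sq ?_ (by positivity)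
  rw [mul_pow]
  linarith

theorem rpow_smul_real {A : H →L[ℂ] H} (hA : 0 ≤ A) {c p : ℝ} (hc : 0 ≤ c) (hp : 0 < p) :
    (c • A) ^ p = c ^ p • A ^ p := by
  have hcA : 0 ≤ c • A := smul_nonneg hc hA
  rw [CFC.rpow_eq_cfc_real, CFC.rpow_eq_cfc_real]
  have hcont : ContinuousOn (fun x : ℝ => x ^ p) (spectrum ℝ (c • A)) :=
    (Real.continuous_rpow_const hp.le).continuousOn
  have hcont' : ContinuousOn (fun x : ℝ => x ^ p) (spectrum ℝ A) :=
    (Real.continuous_rpow_const hp.le).continuousOn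
  rw [← cfc_smul (c ^ p) (fun x : ℝ => x ^ p) A hcont']
  have hc1 : ContinuousOn (fun x : ℝ => x ^ p) ((fun x => c • x) '' spectrum ℝ A) :=
    (Real.continuous_rpow_const hp.le).continuousOn
  rw [← cfc_comp_smul c (fun x : ℝ => x ^ p) A hc1]
  refine cfc_congr fun x hx => ?_
  have : 0 ≤ x := spectrum_nonneg_of_nonneg hA hx
  simp [Real.mul_rpow hc this]

/-- A form of the Heinz inequality. -/
theorem norm_le_of_rpow_norm_le {A B : H →L[ℂ] H} (hA : 0 ≤ A) (hB : 0 ≤ B) {s c : ℝ}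
    (hs : 1 ≤ s) (hc : 0 ≤ c) (h : ∀ k, ‖(A ^ s) k‖ ≤ c * ‖(B ^ s) k‖) (k : H) :
    ‖A k‖ ≤ c ^ (1 / s) * ‖B k‖ := by
  have hs0 : 0 < s := by linarith
  have hmul : ∀ {T : H →L[ℂ] H}, 0 ≤ T → (T ^ s * T ^ s) ^ (1 / s) = T * T := by
    intro T hT
    have hTs : 0 ≤ T ^ s := CFC.rpow_nonneg
    have e1 : T ^ s * T ^ s = (T ^ s) ^ (2 : ℝ) := by
      have := CFC.rpow_natCast (T ^ s) 2 hTs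
      rw [pow_two] at this
      rw [← this]; norm_num
    have e2 : T * T = T ^ (2 : ℝ) := by
      have := CFC.rpow_natCast T 2 hT
      rw [pow_two] at this
      rw [← this]; norm_num
    rw [e1, e2, CFC.rpow_rpow_of_exponent_nonneg T s 2 hs0.le (by norm_num) hT,
      CFC.rpow_rpow_of_exponent_nonneg T (s * 2) (1 / s) (by positivity) (by positivity) hT]
    congr 1
    field_simp
  have hAs : IsSelfAdjoint (A ^ s) := IsSelfAdjoint.of_nonneg CFC.rpow_nonneg
  have hBs : IsSelfAdjoint (B ^ s) := IsSelfAdjoint.of_nonneg CFC.rpow_nonneg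
  have h1 := mul_self_le_of_norm_le hAs hBs h
  -- Löwner–Heinz: the power `1 / s` is operator monotone because `s ≥ 1`. It reduces the inequality
  -- between `A ^ (2s)` and `B ^ (2s)` to one between `A²` and `B²`.
  have h2 := CFC.rpow_le_rpow (p := 1 / s)
    ⟨by positivity, by rw [div_le_one hs0]; exact hs⟩ h1
  have hBB : 0 ≤ B ^ s * B ^ s := by
    have := star_mul_self_nonneg (B ^ s)
    rwa [hBs.star_eq] at this
  rw [rpow_smul_real hBB (by positivity) (by positivity), hmul hA, hmul hB] at h2
  refine norm_le_of_mul_self_le (IsSelfAdjoint.of_nonneg hA) (IsSelfAdjoint.of_nonneg hB)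
    (by positivity) ?_ k
  convert h2 using 2
  rw [← Real.rpow_natCast, ← Real.rpow_natCast, ← Real.rpow_mul hc, ← Real.rpow_mul hc]
  congr 1
  ring

/-- For an integer `n > s` the injective operator `B ^ n` factors as `B ^ (n - s) * B ^ s`, and a
right factor of an injective map is injective. -/
theorem rpow_injective {B : H →L[ℂ] H} (hB : 0 ≤ B) (hinj : Function.Injective B) {s : ℝ}
    (hs : 0 < s) : Function.Injective (B ^ s : H →L[ℂ] H) := by
  obtain ⟨n, hn⟩ := exists_nat_gt s
  have hpow : ∀ m : ℕ, Function.Injective (B ^ m : H →L[ℂ] H) := by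
    intro m
    induction m with
    | zero => simpa using Function.injective_id
    | succ m ih =>
      rw [pow_succ]
      exact ih.comp hinj
  have e : B ^ (n : ℝ) = B ^ (n - s) * B ^ s := by
    have hns : 0 ≤ n - s := by linarith
    rw [CFC.rpow_eq_cfc_real, CFC.rpow_eq_cfc_real, CFC.rpow_eq_cfc_real,
      ← cfc_mul _ _ B (Real.continuous_rpow_const hns).continuousOn
        (Real.continuous_rpow_const hs.le).continuousOn]
    refine cfc_congr fun x hx => ?_
    have hx0 : 0 ≤ x := spectrum_nonneg_of_nonneg hB hx
    change x ^ (n : ℝ) = x ^ (n - s) * x ^ s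
    rw [← Real.rpow_add_of_nonneg hx0 hns hs.le, sub_add_cancel]
  rw [CFC.rpow_natCast B n hB] at e
  have := hpow n
  rw [e] at this
  exact Function.Injective.of_comp this

theorem norm_rpow_le {B : H →L[ℂ] H} (hB : 0 ≤ B) {M s : ℝ} (hM : ‖B‖ ≤ M) (hs : 0 < s) :
    ‖B ^ s‖ ≤ M ^ s := by
  rw [CFC.rpow_eq_cfc_real]
  have hM0 : 0 ≤ M := (norm_nonneg _).trans hM
  refine norm_cfc_le (by positivity) fun x hx => ?_
  have hx0 : 0 ≤ x := spectrum_nonneg_of_nonneg hB hx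
  have hx1 : x ≤ M := by
    have := spectrum.norm_le_norm_mul_of_mem hx
    rw [Real.norm_eq_abs] at this
    have h1 : ‖(1 : H →L[ℂ] H)‖ ≤ 1 := ContinuousLinearMap.norm_id_le
    calc x ≤ |x| := le_abs_self x
      _ ≤ ‖B‖ * ‖(1 : H →L[ℂ] H)‖ := this
      _ ≤ M * 1 := by gcongr
      _ = M := mul_one _
  rw [Real.norm_of_nonneg (by positivity)]
  gcongr

theorem mem_domain_fracPow {T : H →ₗ.[ℂ] H} {B : H →L[ℂ] H} (hT : shiftInverse T 0 = B)
    (hB : 0 ≤ B) {s : ℝ} {u : H} :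
    u ∈ (fracPow T s).domain ↔ ∃ x, (B ^ s) x = u := by
  rw [fracPow, hT, LinearPMap.inverse_domain, CFC.rpow_eq_cfc_real]
  constructor
  · rintro ⟨⟨x, hx⟩, rfl⟩
    exact ⟨x, rfl⟩
  · rintro ⟨x, rfl⟩
    exact ⟨⟨x, trivial⟩, rfl⟩

theorem fracPow_apply {T : H →ₗ.[ℂ] H} {B : H →L[ℂ] H} (hT : shiftInverse T 0 = B)
    (hB : 0 ≤ B) (hinj : Function.Injective B) {s : ℝ} (hs : 0 < s) (x : H)
    (hx : (B ^ s) x ∈ (fracPow T s).domain) : fracPow T s ⟨(B ^ s) x, hx⟩ = x := by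
  have hinj' := rpow_injective hB hinj hs
  have e : (cfc (fun x : ℝ => x ^ s) (shiftInverse T 0) : H →L[ℂ] H) = B ^ s := by
    rw [hT, CFC.rpow_eq_cfc_real]
  have hk : LinearMap.ker
      ((cfc (fun x : ℝ => x ^ s) (shiftInverse T 0) : H →L[ℂ] H).toLinearMap.toPMap ⊤).toFun
        = ⊥ := by
    rw [LinearMap.ker_eq_bot']
    rintro ⟨y, hy⟩ h0
    have h1 : (cfc (fun x : ℝ => x ^ s) (shiftInverse T 0) : H →L[ℂ] H) y = 0 := h0
    rw [e] at h1
    exact Subtype.ext (hinj' (by rw [h1, ZeroMemClass.coe_zero, map_zero]))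
  exact LinearPMap.inverse_apply_eq hk (y := ⟨(B ^ s) x, hx⟩) (x := ⟨x, trivial⟩)
    (congrArg (fun R : H →L[ℂ] H => R x) e)

/-- If fractional powers of two positive operators have the same domain and comparable graph norms,
then the inverses of the operators are comparable. -/
theorem norm_inverse_le_of_graphNorm_le {T T' : H →ₗ.[ℂ] H} {B B' : H →L[ℂ] H}
    (hT : shiftInverse T 0 = B) (hT' : shiftInverse T' 0 = B') (hB : 0 ≤ B) (hB' : 0 ≤ B')
    (hi : Function.Injective B) (hi' : Function.Injective B') {M : ℝ} (hM : ‖B'‖ ≤ M)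
    {s : ℝ} (hs : 1 ≤ s) (hdom : (fracPow T s).domain = (fracPow T' s).domain) {c : ℝ}
    (hc : ∀ (u : H) (hu : u ∈ (fracPow T s).domain) (hu' : u ∈ (fracPow T' s).domain),
        graphNorm _ ⟨u, hu⟩ ≤ c * graphNorm _ ⟨u, hu'⟩) (k : H) :
    ‖B' k‖ ≤ (|c| * √(1 + (M ^ s) ^ 2)) ^ (1 / s) * ‖B k‖ := by
  have hs0 : 0 < s := by linarith
  refine norm_le_of_rpow_norm_le hB' hB hs (by positivity) ?_ k
  refine norm_le_of_range_comparison (IsSelfAdjoint.of_nonneg CFC.rpow_nonneg)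
    (IsSelfAdjoint.of_nonneg CFC.rpow_nonneg) fun x => ?_
  have hu' : (B' ^ s) x ∈ (fracPow T' s).domain := (mem_domain_fracPow hT' hB').2 ⟨x, rfl⟩
  have hu := hu'
  rw [← hdom] at hu
  obtain ⟨x', hx'⟩ := (mem_domain_fracPow hT hB).1 hu
  -- Here `x'` is the value of `T ^ s` at `B' ^ s x`, while `T' ^ s` takes the value `x` there. The
  -- graph norm of `T' ^ s` at this point is therefore at most `√(1 + (M ^ s)²) ‖x‖`.
  refine ⟨x', hx'.symm, ?_⟩
  have h1 := hc _ hu hu'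
  have e1 : fracPow T s ⟨(B' ^ s) x, hu⟩ = x' := by
    have hx2 : (B ^ s) x' ∈ (fracPow T s).domain := hx' ▸ hu
    have := fracPow_apply hT hB hi hs0 x' hx2
    refine Eq.trans (congrArg _ (Subtype.ext hx'.symm)) this
  rw [graphNorm, graphNorm, e1, fracPow_apply hT' hB' hi' hs0 x hu'] at h1
  have h2 : ‖x'‖ ≤ √(‖x'‖ ^ 2 + ‖(B' ^ s) x‖ ^ 2) :=
    Real.le_sqrt_of_sq_le (by nlinarith [sq_nonneg ‖(B' ^ s) x‖])
  have h3 : √(‖x‖ ^ 2 + ‖(B' ^ s) x‖ ^ 2) ≤ √(1 + (M ^ s) ^ 2) * ‖x‖ := by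
    rw [Real.sqrt_le_left (by positivity), mul_pow, Real.sq_sqrt (by positivity)]
    have : ‖(B' ^ s) x‖ ≤ M ^ s * ‖x‖ :=
      ((B' ^ s).le_opNorm x).trans (by gcongr; exact norm_rpow_le hB' hM hs0)
    have := pow_le_pow_left₀ (norm_nonneg _) this 2
    rw [mul_pow] at this
    linarith
  calc ‖x'‖ ≤ _ := h2
    _ ≤ _ := h1
    _ ≤ |c| * √(‖x‖ ^ 2 + ‖(B' ^ s) x‖ ^ 2) := by gcongr; exact le_abs_self c
    _ ≤ |c| * (√(1 + (M ^ s) ^ 2) * ‖x‖) := by gcongr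
    _ = _ := by ring

end Heinz

/-! ### Densities of the component laws -/

namespace CompLaw

open Polynomial

/-- The leading coefficient `σ` of the Sturm–Liouville operator of the law. -/
def sigmaPoly : CompLaw → ℝ[X]
  | normal => 1
  | gamma _ => X
  | beta _ _ => 1 - X ^ 2

/-- The first order coefficient `τ` of the Sturm–Liouville operator of the law. -/
def tauPoly : CompLaw → ℝ[X]
  | normal => -X
  | gamma α => C (α + 1) - X
  | beta α β => C (β - α) - C (α + β + 2) * X

/-- The polynomial `σ` as a function. -/
def sig (c : CompLaw) (x : ℝ) : ℝ := c.sigmaPoly.eval x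

/-- The polynomial `τ` as a function. -/
def tau (c : CompLaw) (x : ℝ) : ℝ := c.tauPoly.eval x

/-- The derivative of `σ`. -/
def sig' (c : CompLaw) (x : ℝ) : ℝ := (derivative c.sigmaPoly).eval x

theorem hasDerivAt_sig (c : CompLaw) (x : ℝ) : HasDerivAt c.sig (c.sig' x) x :=
  c.sigmaPoly.hasDerivAt x

theorem continuous_sig (c : CompLaw) : Continuous c.sig := c.sigmaPoly.continuous

theorem continuous_sig' (c : CompLaw) : Continuous c.sig' := (derivative c.sigmaPoly).continuous

theorem continuous_tau (c : CompLaw) : Continuous c.tau := c.tauPoly.continuous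

/-- The density on the interval where it is positive. -/
def dens : CompLaw → ℝ → ℝ
  | normal, x => gaussianPDFReal 0 1 x
  | gamma α, x => (Real.Gamma (α + 1))⁻¹ * x ^ α * Real.exp (-x)
  | beta α β, z => Real.Gamma (α + β + 2) /
          (2 ^ (α + β + 1) * Real.Gamma (α + 1) * Real.Gamma (β + 1)) *
          (1 - z) ^ α * (1 + z) ^ β

/-- The leading coefficient `σ` vanishes exactly at the finite endpoints, so its positivity
describes all three intervals at once and later arguments need no case distinction. -/
theorem mem_interval (c : CompLaw) (x : ℝ) : x ∈ c.interval ↔ 0 < c.sig x := by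
  cases c with
  | normal => simp [interval, sig, sigmaPoly]
  | gamma α => simp [interval, sig, sigmaPoly]
  | beta α β =>
    simp only [interval, sig, sigmaPoly, mem_Ioo, eval_sub, eval_one, eval_pow, eval_X]
    constructor
    · rintro ⟨h1, h2⟩; nlinarith
    · intro h; constructor <;> nlinarith

theorem isOpen_interval (c : CompLaw) : IsOpen c.interval := by
  have : c.interval = c.sig ⁻¹' Ioi 0 := by ext x; exact c.mem_interval x
  rw [this]
  exact isOpen_Ioi.preimage c.continuous_sig

/-- The two weights differ only for Beta laws, where `σ = 1 - x²` degenerates and `ρ = 1` does not.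
Regularity measured with `ρ` hence controls the `σ`-weighted norms natural for the eigenpolynomials.
-/
theorem sig_le_rho (c : CompLaw) {x : ℝ} (hx : x ∈ c.interval) : c.sig x ≤ c.rho x := by
  cases c with
  | normal => simp [rho, sig, sigmaPoly]
  | gamma α => simp [rho, sig, sigmaPoly]
  | beta α β =>
    simp only [rho, sig, sigmaPoly, eval_sub, eval_one, eval_pow, eval_X]
    nlinarith [sq_nonneg x]

theorem rho_pos (c : CompLaw) {x : ℝ} (hx : x ∈ c.interval) : 0 < c.rho x :=
  ((c.mem_interval x).1 hx).trans_le (c.sig_le_rho hx)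

theorem continuous_rho (c : CompLaw) : Continuous c.rho := by
  cases c with
  | normal => exact continuous_const
  | gamma α => exact continuous_id
  | beta α β => exact continuous_const

theorem dens_pos {c : CompLaw} (hc : c.Admissible) {x : ℝ} (hx : x ∈ c.interval) :
    0 < c.dens x := by
  cases c with
  | normal => exact gaussianPDFReal_pos _ _ _ one_ne_zero
  | gamma α =>
    have hα : -1 < α := hc
    have hx' : 0 < x := hx
    have := Real.Gamma_pos_of_pos (show 0 < α + 1 by linarith)
    simp only [dens]
    positivity
  | beta α β =>
    obtain ⟨hα, hβ⟩ : -1 < α ∧ -1 < β := hc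
    obtain ⟨h1, h2⟩ : -1 < x ∧ x < 1 := hx
    have := Real.Gamma_pos_of_pos (show 0 < α + 1 by linarith)
    have := Real.Gamma_pos_of_pos (show 0 < β + 1 by linarith)
    have := Real.Gamma_pos_of_pos (show 0 < α + β + 2 by linarith)
    have : 0 < 1 - x := by linarith
    have : 0 < 1 + x := by linarith
    simp only [dens]
    positivity

/-- This is Pearson's equation `(σ w)' = τ w`, solved for `w'`. It is the only property of the
density that enters the integration by parts. -/
theorem hasDerivAt_dens (c : CompLaw) {x : ℝ} (hx : x ∈ c.interval) :
    HasDerivAt c.dens ((c.tau x - c.sig' x) / c.sig x * c.dens x) x := by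
  cases c with
  | normal =>
    have e : (normal.tau x - normal.sig' x) / normal.sig x * normal.dens x
        = (√(2 * Real.pi * 1))⁻¹ * (Real.exp (-(x - 0) ^ 2 / (2 * 1)) * (-x)) := by
      simp [tau, sig, sig', tauPoly, sigmaPoly, dens, gaussianPDFReal]; ring
    rw [e]
    have h1 : HasDerivAt (fun x : ℝ => -(x - 0) ^ 2 / (2 * 1)) (-x) x := by
      have := (((hasDerivAt_id x).sub_const (0 : ℝ)).pow 2).neg.div_const (2 * 1)
      exact this.congr_deriv (by simp; ring)
    have := (h1.exp).const_mul (√(2 * Real.pi * 1))⁻¹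
    exact this
  | gamma α =>
    have hx' : 0 < x := hx
    have e : ((gamma α).tau x - (gamma α).sig' x) / (gamma α).sig x * (gamma α).dens x
        = (Real.Gamma (α + 1))⁻¹ * (α * x ^ (α - 1)) * Real.exp (-x)
          + (Real.Gamma (α + 1))⁻¹ * x ^ α * (Real.exp (-x) * -1) := by
      simp only [tau, sig, sig', tauPoly, sigmaPoly, dens, eval_sub, eval_C, eval_X,
        derivative_X, eval_one]
      rw [Real.rpow_sub_one hx'.ne']
      field_simp
      ring
    rw [e]
    exact (((Real.hasDerivAt_rpow_const (Or.inl hx'.ne')).const_mul _).mul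
      ((hasDerivAt_neg x).exp))
  | beta α β =>
    obtain ⟨h1, h2⟩ : -1 < x ∧ x < 1 := hx
    have hm : 0 < 1 - x := by linarith
    have hp : 0 < 1 + x := by linarith
    set k : ℝ := Real.Gamma (α + β + 2) /
          (2 ^ (α + β + 1) * Real.Gamma (α + 1) * Real.Gamma (β + 1)) with hk
    have e : ((beta α β).tau x - (beta α β).sig' x) / (beta α β).sig x * (beta α β).dens x
        = k * ((-1) * α * (1 - x) ^ (α - 1)) * (1 + x) ^ β
          + k * (1 - x) ^ α * (1 * β * (1 + x) ^ (β - 1)) := by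
      have hq : (1 : ℝ) - x ^ 2 = (1 - x) * (1 + x) := by ring
      simp only [tau, sig, sig', tauPoly, sigmaPoly, dens, eval_sub, eval_C, eval_X, eval_mul,
        derivative_sub, derivative_one, derivative_X_pow, eval_one, eval_zero, eval_pow, ← hk, hq]
      rw [Real.rpow_sub_one hm.ne', Real.rpow_sub_one hp.ne']
      field_simp
      ring
    rw [e]
    have d1 : HasDerivAt (fun y : ℝ => (1 - y) ^ α) ((-1) * α * (1 - x) ^ (α - 1)) x :=
      ((hasDerivAt_id x).const_sub 1).rpow_const (Or.inl hm.ne')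
    have d2 : HasDerivAt (fun y : ℝ => (1 + y) ^ β) (1 * β * (1 + x) ^ (β - 1)) x :=
      ((hasDerivAt_id x).const_add 1).rpow_const (Or.inl hp.ne')
    exact (d1.const_mul k).mul d2

/-- The density, extended by zero. -/
def pdf (c : CompLaw) (x : ℝ) : ℝ := c.interval.indicator c.dens x

theorem pdf_nonneg {c : CompLaw} (hc : c.Admissible) (x : ℝ) : 0 ≤ c.pdf x :=
  indicator_nonneg (fun _ hx => (dens_pos hc hx).le) x

theorem measurable_pdf (c : CompLaw) : Measurable c.pdf := by
  refine Measurable.indicator ?_ c.isOpen_interval.measurableSet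
  cases c with
  | normal => exact measurable_gaussianPDFReal _ _
  | gamma α =>
    have : (gamma α).dens = fun x => (Real.Gamma (α + 1))⁻¹ * x ^ α * Real.exp (-x) := rfl
    rw [this]; fun_prop
  | beta α β =>
    have : (beta α β).dens = fun z => Real.Gamma (α + β + 2) /
      (2 ^ (α + β + 1) * Real.Gamma (α + 1) * Real.Gamma (β + 1)) *
        (1 - z) ^ α * (1 + z) ^ β := rfl
    rw [this]; fun_prop

theorem measure_eq (c : CompLaw) :
    c.measure = volume.withDensity fun x => ENNReal.ofReal (c.pdf x) := by
  cases c with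
  | normal =>
    rw [measure, gaussianReal_of_var_ne_zero _ one_ne_zero]
    congr 1
    ext x
    simp [gaussianPDF, pdf, interval, dens]
  | gamma α =>
    refine withDensity_congr_ae ?_
    -- The library density of the Gamma law lives on the closed half-line and `pdf` on the open one;
    -- they may differ at the origin only.
    have : ∀ᵐ x : ℝ, x ≠ 0 := by
      rw [ae_iff]; simp
    filter_upwards [this] with x hx
    simp only [gammaPDF, gammaPDFReal, pdf, interval, indicator_apply, mem_Ioi, dens]
    congr 1
    rcases lt_or_gt_of_ne hx with h | h
    · rw [if_neg (by linarith), if_neg (by linarith)]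
    · rw [if_pos h.le, if_pos h]
      simp
  | beta α β => rfl

theorem integrable_pdf {c : CompLaw} (hc : c.Admissible) [IsFiniteMeasure c.measure] :
    Integrable c.pdf := by
  refine ⟨c.measurable_pdf.aestronglyMeasurable, ?_⟩
  rw [hasFiniteIntegral_iff_ofReal (Filter.Eventually.of_forall (pdf_nonneg hc))]
  have := measure_lt_top c.measure univ
  rwa [measure_eq, withDensity_apply _ MeasurableSet.univ, Measure.restrict_univ] at this

theorem integrable_measure_iff {c : CompLaw} (hc : c.Admissible) {f : ℝ → ℝ} :
    Integrable f c.measure ↔ Integrable fun x => c.pdf x * f x := by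
  rw [measure_eq, integrable_withDensity_iff_integrable_smul' c.measurable_pdf.ennreal_ofReal
    (Filter.Eventually.of_forall fun _ => ENNReal.ofReal_lt_top)]
  simp only [ENNReal.toReal_ofReal (pdf_nonneg hc _), smul_eq_mul]

/-- The exponential moment serves two purposes: functions of polynomial growth become square
integrable, and the law is determined by its moments. For Gamma laws `δ` must stay below the rate
`1`, whence the choice `1 / 2`. -/
theorem exists_integrable_exp {c : CompLaw} (hc : c.Admissible) [IsFiniteMeasure c.measure] :
    ∃ δ : ℝ, 0 < δ ∧ Integrable (fun x => Real.exp (δ * |x|)) c.measure := by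
  cases c with
  | normal =>
    refine ⟨1, one_pos, ?_⟩
    have h1 := integrable_exp_mul_gaussianReal (μ := 0) (v := 1) 1
    have h2 := integrable_exp_mul_gaussianReal (μ := 0) (v := 1) (-1)
    exact integrable_exp_mul_abs h1 h2
  | gamma α =>
    refine ⟨1 / 2, by norm_num, ?_⟩
    rw [integrable_measure_iff hc]
    have hα : -1 < α := hc
    have h1 := integrableOn_rpow_mul_exp_neg_mul_rpow (p := 1) (b := 1 / 2) hα one_pos
      (by norm_num)
    have h2 := (integrable_indicator_iff measurableSet_Ioi).2
      (h1.const_mul (Real.Gamma (α + 1))⁻¹)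
    refine h2.congr (Filter.Eventually.of_forall fun x => ?_)
    simp only [pdf, interval, indicator_apply, mem_Ioi]
    split_ifs with h
    · simp only [dens, abs_of_pos h, Real.rpow_one]
      have : Real.exp (-(1 / 2) * x) = Real.exp (-x) * Real.exp (1 / 2 * x) := by
        rw [← Real.exp_add]; ring_nf
      rw [this]; ring
    · simp
  | beta α β =>
    refine ⟨1, one_pos, ?_⟩
    refine Integrable.of_bound (C := Real.exp 1) (by fun_prop) ?_
    rw [measure_eq, ae_withDensity_iff (beta α β).measurable_pdf.ennreal_ofReal]
    refine Filter.Eventually.of_forall fun x hx => ?_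
    have hx' : x ∈ (beta α β).interval := by
      by_contra h
      exact hx (by simp [pdf, h])
    obtain ⟨h1, h2⟩ : -1 < x ∧ x < 1 := hx'
    rw [Real.norm_of_nonneg (Real.exp_pos _).le, one_mul, Real.exp_le_exp]
    exact (abs_lt.2 ⟨h1, h2⟩).le

end CompLaw

/-! ### The joint law -/

theorem pi_withDensity_ofReal {N : ℕ} {f : Fin N → ℝ → ℝ} (h0 : ∀ j x, 0 ≤ f j x) (hi : ∀ j, Integrable (f j))
    [∀ j, SigmaFinite (volume.withDensity fun x => ENNReal.ofReal (f j x))] :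
    Measure.pi (fun j => volume.withDensity fun x => ENNReal.ofReal (f j x))
      = volume.withDensity fun z : Fin N → ℝ => ENNReal.ofReal (∏ j, f j (z j)) := by
  refine Measure.pi_eq fun s hs => ?_
  rw [withDensity_apply _ (MeasurableSet.univ_pi hs)]
  have e : ∀ z : Fin N → ℝ, (univ.pi s).indicator (fun z => ENNReal.ofReal (∏ j, f j (z j))) z
      = ENNReal.ofReal (∏ j, (s j).indicator (f j) (z j)) := by
    intro z
    by_cases hz : z ∈ univ.pi s
    · rw [indicator_of_mem hz]
      congr 1
      refine Finset.prod_congr rfl fun j _ => ?_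
      rw [indicator_of_mem (hz j trivial)]
    · rw [indicator_of_notMem hz]
      simp only [mem_univ_pi, not_forall] at hz
      obtain ⟨j, hj⟩ := hz
      rw [Finset.prod_eq_zero (Finset.mem_univ j) (indicator_of_notMem hj _),
        ENNReal.ofReal_zero]
  have h0' : ∀ j x, 0 ≤ (s j).indicator (f j) x := fun j x =>
    indicator_nonneg (fun x _ => h0 j x) x
  have hi' : ∀ j, Integrable ((s j).indicator (f j)) := fun j => (hi j).indicator (hs j)
  rw [← lintegral_indicator (MeasurableSet.univ_pi hs)]
  simp_rw [e]
  have hip : Integrable (fun z : Fin N → ℝ => ∏ j, (s j).indicator (f j) (z j)) volume :=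
    Integrable.fintype_prod hi'
  rw [← ofReal_integral_eq_lintegral_ofReal hip
    (Filter.Eventually.of_forall fun z => Finset.prod_nonneg fun j _ => h0' j _)]
  rw [integral_fintype_prod_volume_eq_prod (fun j => (s j).indicator (f j)),
    ENNReal.ofReal_prod_of_nonneg fun j _ => integral_nonneg (h0' j)]
  refine Finset.prod_congr rfl fun j _ => ?_
  rw [withDensity_apply _ (hs j), ← lintegral_indicator (hs j),
    ofReal_integral_eq_lintegral_ofReal (hi' j) (Filter.Eventually.of_forall (h0' j))]
  refine lintegral_congr fun x => ?_
  by_cases hx : x ∈ s j <;> simp [hx]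

section Joint

variable {N : ℕ} (d : Fin N → CompLaw)

/-- The joint density on the box. -/
def boxDens (z : Fin N → ℝ) : ℝ := ∏ j, (d j).dens (z j)

theorem isOpen_box : IsOpen (box d) := by
  have : box d = univ.pi fun j => (d j).interval := by
    ext z; simp [box]
  rw [this]
  exact isOpen_set_pi finite_univ fun j _ => (d j).isOpen_interval

variable {d}

theorem boxDens_pos (hd : ∀ j, (d j).Admissible) {z : Fin N → ℝ} (hz : z ∈ box d) :
    0 < boxDens d z :=
  Finset.prod_pos fun j _ => CompLaw.dens_pos (hd j) (hz j)

theorem continuousOn_boxDens : ContinuousOn (boxDens d) (box d) := by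
  refine continuousOn_finsetProd _ fun j _ => ?_
  intro z hz
  have h1 : ContinuousAt (d j).dens (z j) := ((d j).hasDerivAt_dens (hz j)).continuousAt
  have h2 : ContinuousAt (fun z : Fin N → ℝ => z j) z := (continuous_apply j).continuousAt
  exact (ContinuousAt.comp (f := fun z : Fin N → ℝ => z j) h1 h2).continuousWithinAt

/-- The law of the random vector is given by its density on the box. -/
structure IsJointLaw (d : Fin N → CompLaw) (μ : Measure (Fin N → ℝ)) : Prop where
  adm : ∀ j, (d j).Admissible
  prob : ∀ j, IsProbabilityMeasure (d j).measure
  eq_pi : μ = Measure.pi fun j => (d j).measure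

namespace IsJointLaw

variable {μ : Measure (Fin N → ℝ)} (h : IsJointLaw d μ)
include h

theorem isProbabilityMeasure : IsProbabilityMeasure μ := by
  have := h.prob
  rw [h.eq_pi]
  infer_instance

theorem eq_withDensity :
    μ = (volume.restrict (box d)).withDensity fun z => ENNReal.ofReal (boxDens d z) := by
  have hp := h.prob
  have h1 : μ = Measure.pi fun j =>
      (volume.withDensity fun x => ENNReal.ofReal ((d j).pdf x)) := by
    rw [h.eq_pi]
    congr 1
    ext1 j
    exact (d j).measure_eq
  have : ∀ j, SigmaFinite (volume.withDensity fun x => ENNReal.ofReal ((d j).pdf x)) :=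
    fun j => by rw [← (d j).measure_eq]; infer_instance
  rw [h1, pi_withDensity_ofReal
    (fun j => CompLaw.pdf_nonneg (h.adm j)) (fun j => CompLaw.integrable_pdf (h.adm j)),
    ← withDensity_indicator (isOpen_box d).measurableSet]
  congr 1
  ext z
  by_cases hz : z ∈ box d
  · rw [indicator_of_mem hz, boxDens]
    congr 1
    refine Finset.prod_congr rfl fun j _ => ?_
    rw [CompLaw.pdf, indicator_of_mem (hz j)]
  · rw [indicator_of_notMem hz]
    simp only [box, mem_ofPred_eq, not_forall] at hz
    obtain ⟨j, hj⟩ := hz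
    rw [Finset.prod_eq_zero (Finset.mem_univ j), ENNReal.ofReal_zero]
    rw [CompLaw.pdf, indicator_of_notMem hj]

theorem aemeasurable_dens :
    AEMeasurable (fun z => ENNReal.ofReal (boxDens d z)) (volume.restrict (box d)) :=
  (continuousOn_boxDens.aemeasurable (isOpen_box d).measurableSet).ennreal_ofReal

theorem absolutelyContinuous : μ ≪ volume.restrict (box d) := by
  rw [h.eq_withDensity]
  exact withDensity_absolutelyContinuous _ _

theorem absolutelyContinuous' : volume.restrict (box d) ≪ μ := by
  rw [h.eq_withDensity]
  refine withDensity_absolutelyContinuous' h.aemeasurable_dens ?_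
  filter_upwards [ae_restrict_mem (isOpen_box d).measurableSet] with z hz
  simpa using boxDens_pos h.adm hz

theorem ae_mem_box : ∀ᵐ z ∂μ, z ∈ box d :=
  h.absolutelyContinuous.ae_le (ae_restrict_mem (isOpen_box d).measurableSet)

theorem integral_eq {E : Type*} [NormedAddCommGroup E] [NormedSpace ℝ E]
    (f : (Fin N → ℝ) → E) :
    ∫ z, f z ∂μ = ∫ z in box d, boxDens d z • f z := by
  nth_rw 1 [h.eq_withDensity]
  rw [integral_withDensity_eq_integral_toReal_smul₀ h.aemeasurable_dens
    (Filter.Eventually.of_forall fun _ => ENNReal.ofReal_lt_top)]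
  refine integral_congr_ae ?_
  filter_upwards [ae_restrict_mem (isOpen_box d).measurableSet] with z hz
  rw [ENNReal.toReal_ofReal (boxDens_pos h.adm hz).le]

/-- The density is positive on the open box, so a null set contains no nonempty open part of it.
Together with continuity this upgrades almost sure statements to statements at every point of the
box. -/
theorem dense_of_ae {P : (Fin N → ℝ) → Prop} (hP : ∀ᵐ z ∂μ, P z) {z : Fin N → ℝ}
    (hz : z ∈ box d) : z ∈ closure {y | y ∈ box d ∧ P y} := by
  rw [mem_closure_iff]
  intro U hU hzU
  have h1 : ∀ᵐ y ∂(volume.restrict (box d)), P y := h.absolutelyContinuous'.ae_le hP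
  rw [ae_restrict_iff' (isOpen_box d).measurableSet] at h1
  have h2 : 0 < volume (U ∩ box d) :=
    (hU.inter (isOpen_box d)).measure_pos _ ⟨z, hzU, hz⟩
  by_contra h3
  rw [not_nonempty_iff_eq_empty] at h3
  have h4 : U ∩ box d ⊆ {y | ¬ (y ∈ box d → P y)} := by
    rintro y ⟨hyU, hy⟩ hyP
    have : y ∈ U ∩ {y | y ∈ box d ∧ P y} := ⟨hyU, hy, hyP hy⟩
    rw [h3] at this
    exact this
  exact h2.ne' (measure_mono_null h4 h1)

theorem exists_integrable_exp :
    ∃ δ : ℝ, 0 < δ ∧ Integrable (fun z : Fin N → ℝ => Real.exp (δ * ∑ j, |z j|)) μ := by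
  have hp := h.prob
  choose δ hδ hi using fun j => CompLaw.exists_integrable_exp (h.adm j)
  obtain ⟨ε, hε, hεδ⟩ : ∃ ε : ℝ, 0 < ε ∧ ∀ j, ε ≤ δ j := by
    rcases isEmpty_or_nonempty (Fin N) with hN | hN
    · exact ⟨1, one_pos, fun j => hN.elim j⟩
    · refine ⟨Finset.univ.inf' Finset.univ_nonempty δ, ?_, fun j =>
        Finset.inf'_le _ (Finset.mem_univ j)⟩
      rw [Finset.lt_inf'_iff]
      exact fun j _ => hδ j
  refine ⟨ε, hε, ?_⟩
  rw [h.eq_pi]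
  have h1 : ∀ j, Integrable (fun x => Real.exp (ε * |x|)) (d j).measure := fun j => by
    refine (hi j).mono' (by fun_prop) (Filter.Eventually.of_forall fun x => ?_)
    rw [Real.norm_of_nonneg (Real.exp_pos _).le, Real.exp_le_exp]
    exact mul_le_mul_of_nonneg_right (hεδ j) (abs_nonneg _)
  have h2 := Integrable.fintype_prod h1
  refine h2.congr (Filter.Eventually.of_forall fun z => ?_)
  dsimp only
  rw [Finset.mul_sum, Real.exp_sum]

end IsJointLaw

theorem isJointLaw_map {Ω : Type*} [MeasurableSpace Ω] (P : Measure Ω) [IsProbabilityMeasure P]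
    (Z : Ω → Fin N → ℝ) (hZ : Measurable Z)
    (hindep : iIndepFun (fun (j : Fin N) (x : Ω) => Z x j) P)
    (hd : ∀ j, (d j).Admissible)
    (hlaw : ∀ j, P.map (fun x => Z x j) = (d j).measure) : IsJointLaw d (P.map Z) := by
  have hm : ∀ j, Measurable fun x => Z x j := fun j => (measurable_pi_apply j).comp hZ
  refine ⟨hd, fun j => ?_, ?_⟩
  · rw [← hlaw j]
    exact Measure.isProbabilityMeasure_map (hm j).aemeasurable
  · have := (iIndepFun_iff_map_fun_eq_pi_map fun j => (hm j).aemeasurable).1 hindep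
    simp_rw [hlaw] at this
    exact this

end Joint

/-! ### Functions of polynomial growth and determinacy of the joint law -/

section Growth

variable {N : ℕ}

/-- Continuous functions of polynomial growth. -/
def PolyGrowth (G : (Fin N → ℝ) → ℝ) : Prop :=
  Continuous G ∧ ∃ (C : ℝ) (k : ℕ), 0 ≤ C ∧ ∀ z, |G z| ≤ C * (1 + ∑ j, |z j|) ^ k

theorem one_le_one_add_sum (z : Fin N → ℝ) : 1 ≤ 1 + ∑ j, |z j| := by
  have : 0 ≤ ∑ j, |z j| := Finset.sum_nonneg fun j _ => abs_nonneg _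
  linarith

namespace PolyGrowth

variable {G G' : (Fin N → ℝ) → ℝ}

theorem const (c : ℝ) : PolyGrowth (fun _ : Fin N → ℝ => c) :=
  ⟨continuous_const, |c|, 0, abs_nonneg c, fun z => by simp⟩

theorem coord (j : Fin N) : PolyGrowth (fun z : Fin N → ℝ => z j) :=
  ⟨continuous_apply j, 1, 1, zero_le_one, fun z => by
    have := Finset.single_le_sum (f := fun j => |z j|) (fun i _ => abs_nonneg _)
      (Finset.mem_univ j)
    dsimp only at this ⊢
    linarith⟩

theorem add (h : PolyGrowth G) (h' : PolyGrowth G') : PolyGrowth (fun z => G z + G' z) := by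
  obtain ⟨hc, C, k, hC, hb⟩ := h
  obtain ⟨hc', C', k', hC', hb'⟩ := h'
  refine ⟨hc.add hc', C + C', max k k', by positivity, fun z => ?_⟩
  have h1 := one_le_one_add_sum z
  calc |G z + G' z| ≤ |G z| + |G' z| := abs_add_le _ _
    _ ≤ C * (1 + ∑ j, |z j|) ^ k + C' * (1 + ∑ j, |z j|) ^ k' := add_le_add (hb z) (hb' z)
    _ ≤ C * (1 + ∑ j, |z j|) ^ (max k k') + C' * (1 + ∑ j, |z j|) ^ (max k k') := by
        gcongr
        · exact le_max_left _ _
        · exact le_max_right _ _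
    _ = _ := by ring

theorem mul (h : PolyGrowth G) (h' : PolyGrowth G') : PolyGrowth (fun z => G z * G' z) := by
  obtain ⟨hc, C, k, hC, hb⟩ := h
  obtain ⟨hc', C', k', hC', hb'⟩ := h'
  refine ⟨hc.mul hc', C * C', k + k', by positivity, fun z => ?_⟩
  have h1 := one_le_one_add_sum z
  rw [abs_mul]
  calc |G z| * |G' z| ≤ (C * (1 + ∑ j, |z j|) ^ k) * (C' * (1 + ∑ j, |z j|) ^ k') := by
        gcongr
        · exact hb z
        · exact hb' z
    _ = _ := by ring

theorem finset_sum {ι : Type*} (s : Finset ι) {F : ι → (Fin N → ℝ) → ℝ}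
    (h : ∀ i ∈ s, PolyGrowth (F i)) : PolyGrowth (fun z => ∑ i ∈ s, F i z) := by
  classical
  induction s using Finset.induction_on with
  | empty => simpa using const 0
  | insert i s hi ih =>
    simp only [Finset.sum_insert hi]
    exact (h i (Finset.mem_insert_self i s)).add
      (ih fun k hk => h k (Finset.mem_insert_of_mem hk))

theorem finset_prod {ι : Type*} (s : Finset ι) {F : ι → (Fin N → ℝ) → ℝ}
    (h : ∀ i ∈ s, PolyGrowth (F i)) : PolyGrowth (fun z => ∏ i ∈ s, F i z) := by
  classical
  induction s using Finset.induction_on with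
  | empty => simpa using const 1
  | insert i s hi ih =>
    simp only [Finset.prod_insert hi]
    exact (h i (Finset.mem_insert_self i s)).mul
      (ih fun k hk => h k (Finset.mem_insert_of_mem hk))

theorem pow (h : PolyGrowth G) (n : ℕ) : PolyGrowth (fun z => G z ^ n) := by
  simpa using finset_prod (Finset.range n) (F := fun _ => G) fun _ _ => h

theorem eval_coord (p : Polynomial ℝ) (j : Fin N) :
    PolyGrowth (fun z : Fin N → ℝ => p.eval (z j)) := by
  simp only [Polynomial.eval_eq_sum_range]
  exact finset_sum _ fun i _ => (const _).mul ((coord j).pow i)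

theorem monomial (α : Fin N → ℕ) : PolyGrowth (fun z : Fin N → ℝ => ∏ j, z j ^ α j) :=
  finset_prod _ fun j _ => (coord j).pow _

theorem exists_le_exp (h : PolyGrowth G) {δ : ℝ} (hδ : 0 < δ) :
    ∃ C, 0 ≤ C ∧ ∀ z, |G z| ≤ C * Real.exp (δ * ∑ j, |z j|) := by
  obtain ⟨hc, C, k, hC, hb⟩ := h
  refine ⟨C * (k.factorial * δ⁻¹ ^ k * Real.exp δ), by positivity, fun z => ?_⟩
  have h1 := one_le_one_add_sum z
  have h2 := Real.pow_div_factorial_le_exp (δ * (1 + ∑ j, |z j|)) (by positivity) k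
  rw [div_le_iff₀ (by positivity), mul_pow, mul_add, mul_one, Real.exp_add] at h2
  have h3 : (1 + ∑ j, |z j|) ^ k
      ≤ k.factorial * δ⁻¹ ^ k * Real.exp δ * Real.exp (δ * ∑ j, |z j|) := by
    calc (1 + ∑ j, |z j|) ^ k = δ⁻¹ ^ k * (δ ^ k * (1 + ∑ j, |z j|) ^ k) := by
          rw [← mul_assoc, ← mul_pow, inv_mul_cancel₀ hδ.ne', one_pow, one_mul]
      _ ≤ δ⁻¹ ^ k * (Real.exp δ * Real.exp (δ * ∑ j, |z j|) * k.factorial) := by gcongr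
      _ = _ := by ring
  calc |G z| ≤ C * (1 + ∑ j, |z j|) ^ k := hb z
    _ ≤ C * (k.factorial * δ⁻¹ ^ k * Real.exp δ * Real.exp (δ * ∑ j, |z j|)) := by gcongr
    _ = _ := by ring

theorem integrable {d : Fin N → CompLaw} {μ : Measure (Fin N → ℝ)} (hμ : IsJointLaw d μ)
    (h : PolyGrowth G) : Integrable G μ := by
  obtain ⟨δ, hδ, hi⟩ := hμ.exists_integrable_exp
  obtain ⟨C, hC, hb⟩ := h.exists_le_exp hδ
  exact (hi.const_mul C).mono' h.1.aestronglyMeasurable (Filter.Eventually.of_forall hb)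

theorem memLp_two {d : Fin N → CompLaw} {μ : Measure (Fin N → ℝ)} (hμ : IsJointLaw d μ)
    (h : PolyGrowth G) : MemLp G 2 μ := by
  rw [memLp_two_iff_integrable_sq h.1.aestronglyMeasurable]
  exact (h.pow 2).integrable hμ

end PolyGrowth

theorem integrable_smul_of_memLp_two {X E : Type*} [MeasurableSpace X] [NormedAddCommGroup E]
    [NormedSpace ℝ E] {μ : Measure X} {f : X → ℝ} {g : X → E} (hf : MemLp f 2 μ)
    (hg : MemLp g 2 μ) : Integrable (fun z => f z • g z) μ :=
  memLp_one_iff_integrable.1 (hg.smul hf)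

/-- For a linear functional `L`, the complex moment generating functions of `L` under both measures
are analytic in a strip around the imaginary axis. Their Taylor coefficients at `0` are moments of
`L`, which are combinations of the monomial moments. The identity theorem carries the equality from
`0` to `i`, where the characteristic functions are read off. -/
theorem ext_of_moments {ν ν' : Measure (Fin N → ℝ)} [IsFiniteMeasure ν] [IsFiniteMeasure ν']
    {δ : ℝ} (hδ : 0 < δ) (hi : Integrable (fun z => Real.exp (δ * ∑ j, |z j|)) ν)
    (hi' : Integrable (fun z => Real.exp (δ * ∑ j, |z j|)) ν')
    (hm : ∀ α : Fin N → ℕ, ∫ z, ∏ j, z j ^ α j ∂ν = ∫ z, ∏ j, z j ^ α j ∂ν') : ν = ν' := by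
  refine Measure.ext_of_charFunDual ?_
  ext L
  have hL : ∀ z : Fin N → ℝ, L z = ∑ j, z j * L (Pi.single j 1) := fun z => by
    conv_lhs => rw [← Finset.univ_sum_single z]
    rw [map_sum]
    refine Finset.sum_congr rfl fun j _ => ?_
    rw [← smul_eq_mul, ← map_smul, ← Pi.single_smul', smul_eq_mul, mul_one]
  have hLb : ∀ z, |L z| ≤ ‖L‖ * ∑ j, |z j| := fun z => by
    refine (L.le_opNorm z).trans ?_
    gcongr
    refine (pi_norm_le_iff_of_nonneg (Finset.sum_nonneg fun j _ => abs_nonneg _)).2 fun j => ?_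
    exact Finset.single_le_sum (f := fun j => |z j|) (fun i _ => abs_nonneg _)
      (Finset.mem_univ j)
  -- Half the width of the strip: `|t| ≤ ε` forces `t L(z) ≤ δ ∑ |z j|`. The summand `1` covers `L =
  -- 0`.
  set ε := δ / (‖L‖ + 1) with hε
  have hεp : 0 < ε := by positivity
  have hset : ∀ {m : Measure (Fin N → ℝ)},
      Integrable (fun z => Real.exp (δ * ∑ j, |z j|)) m →
      Ioo (-ε) ε ⊆ interior (integrableExpSet L m) := by
    intro m hm
    refine interior_maximal (fun t ht => ?_) isOpen_Ioo
    refine hm.mono' (by fun_prop) (Filter.Eventually.of_forall fun z => ?_)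
    rw [Real.norm_of_nonneg (Real.exp_pos _).le, Real.exp_le_exp]
    have ht' : |t| ≤ ε := (abs_lt.2 ht).le
    have hs : 0 ≤ ∑ j, |z j| := Finset.sum_nonneg fun j _ => abs_nonneg _
    calc t * L z ≤ |t * L z| := le_abs_self _
      _ = |t| * |L z| := abs_mul _ _
      _ ≤ ε * (‖L‖ * ∑ j, |z j|) := by gcongr; exact hLb z
      _ ≤ ε * ((‖L‖ + 1) * ∑ j, |z j|) := by gcongr; linarith
      _ = δ * ∑ j, |z j| := by rw [hε]; field_simp
  have hdom : ∀ {m : Measure (Fin N → ℝ)} (G : (Fin N → ℝ) → ℝ), PolyGrowth G →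
      Integrable (fun z => Real.exp (δ * ∑ j, |z j|)) m → Integrable G m := by
    intro m G hG hm
    obtain ⟨C, hC, hb⟩ := hG.exists_le_exp hδ
    exact (hm.const_mul C).mono' hG.1.aestronglyMeasurable (Filter.Eventually.of_forall hb)
  have hmom : ∀ n : ℕ, ∫ z, L z ^ n ∂ν = ∫ z, L z ^ n ∂ν' := by
    intro n
    have e : ∀ z : Fin N → ℝ, L z ^ n = ∑ k ∈ Finset.univ.piAntidiag n,
        ((Nat.multinomial Finset.univ k : ℝ) * ∏ j, L (Pi.single j 1) ^ k j) *
          ∏ j, z j ^ k j := fun z => by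
      rw [hL, Finset.sum_pow_eq_sum_piAntidiag]
      refine Finset.sum_congr rfl fun k _ => ?_
      simp only [mul_pow, Finset.prod_mul_distrib]
      ring
    simp only [e]
    rw [integral_finsetSum _ fun k _ => (hdom _ (PolyGrowth.monomial k) hi).const_mul _,
      integral_finsetSum _ fun k _ => (hdom _ (PolyGrowth.monomial k) hi').const_mul _]
    refine Finset.sum_congr rfl fun k _ => ?_
    rw [integral_const_mul, integral_const_mul, hm]
  set U : Set ℂ := {w | w.re ∈ Ioo (-ε) ε} with hU
  have hUc : IsPreconnected U :=
    ((convex_Ioo (-ε) ε).linear_preimage Complex.reLm).isPreconnected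
  have hU0 : (0 : ℂ) ∈ U := by simp [hU, hεp]
  have hA : AnalyticOnNhd ℂ (complexMGF L ν) U :=
    analyticOnNhd_complexMGF.mono fun w hw => hset hi hw
  have hA' : AnalyticOnNhd ℂ (complexMGF L ν') U :=
    analyticOnNhd_complexMGF.mono fun w hw => hset hi' hw
  have hEq : complexMGF L ν =ᶠ[nhds 0] complexMGF L ν' := by
    have h1 := (hA 0 hU0).hasFPowerSeriesAt
    have h2 := (hA' 0 hU0).hasFPowerSeriesAt
    have h3 : (fun n => iteratedDeriv n (complexMGF L ν) 0 / n.factorial)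
        = fun n => iteratedDeriv n (complexMGF L ν') 0 / n.factorial := by
      funext n
      rw [iteratedDeriv_complexMGF (hset hi hU0), iteratedDeriv_complexMGF (hset hi' hU0)]
      congr 1
      simp only [zero_mul, Complex.exp_zero, mul_one]
      have := hmom n
      have h4 : ((∫ z, L z ^ n ∂ν : ℝ) : ℂ) = ((∫ z, L z ^ n ∂ν' : ℝ) : ℂ) := by rw [this]
      rw [← integral_complex_ofReal, ← integral_complex_ofReal] at h4
      simpa using h4
    rw [h3] at h1
    have h5 := h1.sub h2
    rw [sub_self] at h5
    filter_upwards [h5.eventually_eq_zero] with w hw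
    exact sub_eq_zero.1 hw
  have hIU : Complex.I ∈ U := by simp [hU, hεp]
  have := hA.eqOn_of_preconnected_of_eventuallyEq hA' hUc hU0 hEq hIU
  simp only [complexMGF] at this
  rw [charFunDual_apply, charFunDual_apply]
  simpa [mul_comm] using this

variable {d : Fin N → CompLaw} {μ : Measure (Fin N → ℝ)}

/-- The positive and the negative part of `h` are densities of two finite measures with equal
moments, and determinacy identifies them. As `h` is only square integrable, Cauchy–Schwarz costs
half of the exponent: the measures have exponential moments for `δ / 2`. -/
theorem ae_eq_zero_of_moments_real (hμ : IsJointLaw d μ) {h : (Fin N → ℝ) → ℝ}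
    (hL : MemLp h 2 μ) (hm : ∀ α : Fin N → ℕ, ∫ z, (∏ j, z j ^ α j) * h z ∂μ = 0) :
    h =ᵐ[μ] 0 := by
  have := hμ.isProbabilityMeasure
  have hint : Integrable h μ := hL.integrable one_le_two
  have hfin : ∀ {g : (Fin N → ℝ) → ℝ}, Integrable g μ →
      IsFiniteMeasure (μ.withDensity fun z => ENNReal.ofReal (g z)) := fun hg =>
    isFiniteMeasure_withDensity_ofReal hg.2
  have f1 := hfin hint
  have f2 := hfin hint.neg
  obtain ⟨δ, hδ, hi⟩ := hμ.exists_integrable_exp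
  have hexp : MemLp (fun z : Fin N → ℝ => Real.exp (δ / 2 * ∑ j, |z j|)) 2 μ := by
    rw [memLp_two_iff_integrable_sq (Continuous.aestronglyMeasurable (by fun_prop))]
    refine hi.congr (Filter.Eventually.of_forall fun z => ?_)
    dsimp only
    rw [← Real.exp_nat_mul]
    congr 1
    push_cast
    ring
  have key : ∀ {g : (Fin N → ℝ) → ℝ}, Integrable g μ → ∀ {G : (Fin N → ℝ) → ℝ},
      Integrable G (μ.withDensity fun z => ENNReal.ofReal (g z)) ↔
      Integrable (fun z => max (g z) 0 * G z) μ := by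
    intro g hg G
    rw [integrable_withDensity_iff_integrable_smul₀' hg.1.aemeasurable.ennreal_ofReal
      (Filter.Eventually.of_forall fun _ => ENNReal.ofReal_lt_top)]
    simp only [ENNReal.toReal_ofReal', smul_eq_mul]
  have key2 : ∀ {g : (Fin N → ℝ) → ℝ}, Integrable g μ → ∀ {G : (Fin N → ℝ) → ℝ},
      ∫ z, G z ∂(μ.withDensity fun z => ENNReal.ofReal (g z)) =
      ∫ z, max (g z) 0 * G z ∂μ := by
    intro g hg G
    rw [integral_withDensity_eq_integral_toReal_smul₀ hg.1.aemeasurable.ennreal_ofReal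
      (Filter.Eventually.of_forall fun _ => ENNReal.ofReal_lt_top)]
    simp only [ENNReal.toReal_ofReal', smul_eq_mul]
  have hpos : ∀ {g : (Fin N → ℝ) → ℝ}, MemLp g 2 μ → ∀ {G : (Fin N → ℝ) → ℝ}, MemLp G 2 μ →
      Integrable (fun z => max (g z) 0 * G z) μ := by
    intro g hg G hG
    refine (hg.integrable_mul hG).norm.mono' ?_ (Filter.Eventually.of_forall fun z => ?_)
    · exact ((hg.1.aemeasurable.max aemeasurable_const).mul hG.1.aemeasurable).aestronglyMeasurable
    · simp only [Pi.mul_apply, norm_mul]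
      gcongr
      rw [Real.norm_of_nonneg (le_max_right _ _)]
      exact max_le (Real.le_norm_self _) (norm_nonneg _)
  have heq : μ.withDensity (fun z => ENNReal.ofReal (h z))
      = μ.withDensity (fun z => ENNReal.ofReal ((-h) z)) := by
    refine ext_of_moments (half_pos hδ) ((key hint).2 (hpos hL hexp))
      ((key hint.neg).2 (hpos hL.neg hexp)) fun α => ?_
    rw [key2 hint, key2 hint.neg, ← sub_eq_zero, ← integral_sub
      (hpos hL ((PolyGrowth.monomial α).memLp_two hμ))
      (hpos hL.neg ((PolyGrowth.monomial α).memLp_two hμ))]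
    refine Eq.trans ?_ (hm α)
    congr 1
    ext z
    simp only [Pi.neg_apply]
    rcases le_total (h z) 0 with hz | hz
    · rw [max_eq_right hz, max_eq_left (by linarith)]; ring
    · rw [max_eq_left hz, max_eq_right (by linarith)]; ring
  rw [withDensity_eq_iff_of_sigmaFinite hint.1.aemeasurable.ennreal_ofReal
    hint.neg.1.aemeasurable.ennreal_ofReal] at heq
  filter_upwards [heq] with z hz
  have := congrArg ENNReal.toReal hz
  simp only [ENNReal.toReal_ofReal', Pi.neg_apply] at this
  rcases le_total (h z) 0 with hz | hz
  · rw [max_eq_right hz, max_eq_left (by linarith)] at this; simp; linarith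
  · rw [max_eq_left hz, max_eq_right (by linarith)] at this; simpa using this

/-- Polynomials are dense: a square integrable function with vanishing moments is zero. -/
theorem ae_eq_zero_of_moments {E : Type*} [NormedAddCommGroup E] [InnerProductSpace ℂ E]
    [CompleteSpace E] [TopologicalSpace.SeparableSpace E] (hμ : IsJointLaw d μ)
    {g : (Fin N → ℝ) → E} (hL : MemLp g 2 μ)
    (hm : ∀ α : Fin N → ℕ, ∫ z, (∏ j, z j ^ α j) • g z ∂μ = 0) : g =ᵐ[μ] 0 := by
  have : SecondCountableTopology E := UniformSpace.secondCountable_of_separable E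
  refine ae_eq_zero_of_forall_inner (𝕜 := ℂ) fun e => ?_
  have h1 : MemLp (fun z => inner ℂ e (g z)) 2 μ := (innerSL ℂ e).comp_memLp' hL
  have h2 : ∀ α : Fin N → ℕ, ∫ z, ((∏ j, z j ^ α j : ℝ) : ℂ) * inner ℂ e (g z) ∂μ = 0 := by
    intro α
    have hi : Integrable (fun z => (∏ j, z j ^ α j) • g z) μ :=
      integrable_smul_of_memLp_two ((PolyGrowth.monomial α).memLp_two hμ) hL
    have := integral_inner (𝕜 := ℂ) hi e
    rw [hm α, inner_zero_right] at this
    rw [← this]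
    congr 1
    ext z
    rw [← Complex.real_smul]
    exact (inner_smul_right_eq_smul (𝕜 := ℂ) e (g z) (∏ j, z j ^ α j : ℝ)).symm
  have hi2 : ∀ α : Fin N → ℕ,
      Integrable (fun z => ((∏ j, z j ^ α j : ℝ) : ℂ) * inner ℂ e (g z)) μ := fun α => by
    have := integrable_smul_of_memLp_two ((PolyGrowth.monomial α).memLp_two hμ) h1
    refine this.congr (Filter.Eventually.of_forall fun z => ?_)
    exact Complex.real_smul
  have hre := ae_eq_zero_of_moments_real hμ h1.re fun α => by
    have := congrArg Complex.re (h2 α)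
    rw [Complex.zero_re, ← RCLike.re_eq_complex_re, ← integral_re (hi2 α)] at this
    rw [← this]
    congr 1
    ext z
    simp only [RCLike.re_eq_complex_re, Complex.re_ofReal_mul]
  have him := ae_eq_zero_of_moments_real hμ h1.im fun α => by
    have := congrArg Complex.im (h2 α)
    rw [Complex.zero_im, ← RCLike.im_eq_complex_im, ← integral_im (hi2 α)] at this
    rw [← this]
    congr 1
    ext z
    simp only [RCLike.im_eq_complex_im, Complex.im_ofReal_mul]
  filter_upwards [hre, him] with z hz1 hz2
  exact Complex.ext hz1 hz2

end Growth

/-! ### First order weak derivatives and their test functions -/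

section Weak

open Filter Topology

variable {N : ℕ} {E : Type*} [NormedAddCommGroup E] [NormedSpace ℝ E]

/-- `g` is the weak derivative of `f` in the `j`-th coordinate on `U`. -/
def WeakPartial (U : Set (Fin N → ℝ)) (j : Fin N) (f g : (Fin N → ℝ) → E) : Prop :=
  LocallyIntegrableOn f U volume ∧ LocallyIntegrableOn g U volume ∧
    ∀ φ : (Fin N → ℝ) → ℝ, ContDiff ℝ ∞ φ → HasCompactSupport φ → tsupport φ ⊆ U →
      ∫ z, partialDeriv j φ z • f z = -∫ z, φ z • g z

/-- Continuous test functions with compact support in `U` which have a continuous partial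
derivative in the `j`-th coordinate. -/
structure TestPair {F : Type*} [NormedAddCommGroup F] [NormedSpace ℝ F]
    (U : Set (Fin N → ℝ)) (j : Fin N) (ψ ψ' : (Fin N → ℝ) → F) : Prop where
  cont : Continuous ψ
  cont' : Continuous ψ'
  deriv : ∀ z, HasLineDerivAt ℝ ψ (ψ' z) z (Pi.single j 1)
  supp : ∃ K, IsCompact K ∧ K ⊆ U ∧ ∀ z, z ∉ K → ψ z = 0

namespace TestPair

variable {F : Type*} [NormedAddCommGroup F] [NormedSpace ℝ F]
  {U : Set (Fin N → ℝ)} {j : Fin N} {ψ ψ' : (Fin N → ℝ) → F}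

theorem exists_compact (h : TestPair U j ψ ψ') :
    ∃ K, IsCompact K ∧ K ⊆ U ∧ ∀ z, z ∉ K → ψ z = 0 ∧ ψ' z = 0 := by
  obtain ⟨K, hK, hKU, hz⟩ := h.supp
  refine ⟨K, hK, hKU, fun z hzK => ⟨hz z hzK, ?_⟩⟩
  have h0 : HasLineDerivAt ℝ ψ 0 z (Pi.single j 1) := by
    have hev : (fun t : ℝ => ψ (z + t • Pi.single j 1)) =ᶠ[𝓝 0] fun _ => 0 := by
      have hc : ContinuousAt (fun t : ℝ => z + t • (Pi.single j 1 : Fin N → ℝ)) 0 := by fun_prop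
      have : Kᶜ ∈ 𝓝 (z + (0 : ℝ) • (Pi.single j 1 : Fin N → ℝ)) := by
        rw [zero_smul, add_zero]
        exact hK.isClosed.isOpen_compl.mem_nhds hzK
      filter_upwards [hc.preimage_mem_nhds this] with t ht
      exact hz _ ht
    exact (hasDerivAt_const (0 : ℝ) (0 : F)).congr_of_eventuallyEq hev
  exact (h.deriv z).unique h0

theorem map_clm {F' : Type*} [NormedAddCommGroup F'] [NormedSpace ℝ F'] (L : F →L[ℝ] F')
    (h : TestPair U j ψ ψ') : TestPair U j (fun z => L (ψ z)) (fun z => L (ψ' z)) := by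
  refine ⟨L.continuous.comp h.cont, L.continuous.comp h.cont', fun z => ?_, ?_⟩
  · exact L.hasFDerivAt.comp_hasDerivAt (0 : ℝ) (h.deriv z)
  · obtain ⟨K, hK, hKU, hz⟩ := h.supp
    exact ⟨K, hK, hKU, fun z hzK => by rw [hz z hzK, map_zero]⟩

/-- A function which has a partial derivative on `U` and vanishes off a compact subset of `U` is a
test function. -/
theorem of_continuousOn (hU : IsOpen U) {K : Set (Fin N → ℝ)} (hK : IsCompact K) (hKU : K ⊆ U)
    (h0 : ∀ z, z ∉ K → ψ z = 0) (h0' : ∀ z, z ∉ K → ψ' z = 0) (hc : ContinuousOn ψ U)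
    (hc' : ContinuousOn ψ' U)
    (hd : ∀ z ∈ U, HasLineDerivAt ℝ ψ (ψ' z) z (Pi.single j 1)) : TestPair U j ψ ψ' := by
  have hcont : ∀ {χ : (Fin N → ℝ) → F}, (∀ z, z ∉ K → χ z = 0) → ContinuousOn χ U →
      Continuous χ := by
    intro χ hχ hχc
    rw [continuous_iff_continuousAt]
    intro z
    by_cases hz : z ∈ U
    · exact hχc.continuousAt (hU.mem_nhds hz)
    · have hz' : z ∈ Kᶜ := fun h => hz (hKU h)
      have : χ =ᶠ[𝓝 z] fun _ => 0 := by
        filter_upwards [hK.isClosed.isOpen_compl.mem_nhds hz'] with y hy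
        exact hχ y hy
      exact this.continuousAt
  refine ⟨hcont h0 hc, hcont h0' hc', fun z => ?_, K, hK, hKU, h0⟩
  by_cases hz : z ∈ U
  · exact hd z hz
  · have hzK : z ∉ K := fun h => hz (hKU h)
    rw [h0' z hzK]
    have hev : (fun t : ℝ => ψ (z + t • Pi.single j 1)) =ᶠ[𝓝 0] fun _ => 0 := by
      have hc : ContinuousAt (fun t : ℝ => z + t • (Pi.single j 1 : Fin N → ℝ)) 0 := by fun_prop
      have : Kᶜ ∈ 𝓝 (z + (0 : ℝ) • (Pi.single j 1 : Fin N → ℝ)) := by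
        rw [zero_smul, add_zero]
        exact hK.isClosed.isOpen_compl.mem_nhds hzK
      filter_upwards [hc.preimage_mem_nhds this] with t ht
      exact h0 _ ht
    exact (hasDerivAt_const (0 : ℝ) (0 : F)).congr_of_eventuallyEq hev

end TestPair

open scoped Convolution in
-- Mollification: the derivative of the convolution along the `j`-th axis is the convolution with
-- `ψ'`, by differentiation under the integral. Uniform continuity of both functions gives uniform
-- closeness, and a small radius keeps the supports in one compact subset of `U`.
theorem TestPair.exists_smooth_approx {U : Set (Fin N → ℝ)} (hU : IsOpen U) {j : Fin N}
    {ψ ψ' : (Fin N → ℝ) → ℝ} (h : TestPair U j ψ ψ') :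
    ∃ K, IsCompact K ∧ K ⊆ U ∧ (∀ z, z ∉ K → ψ z = 0 ∧ ψ' z = 0) ∧ ∀ ε : ℝ, 0 < ε →
      ∃ φ : (Fin N → ℝ) → ℝ, ContDiff ℝ ∞ φ ∧ tsupport φ ⊆ K ∧
        ∀ z, |φ z - ψ z| ≤ ε ∧ |partialDeriv j φ z - ψ' z| ≤ ε := by
  obtain ⟨K, hK, hKU, h0⟩ := h.exists_compact
  obtain ⟨δ, hδ, hδU⟩ := hK.exists_cthickening_subset_open hU hKU
  have hK' : IsCompact (Metric.cthickening δ K) := hK.cthickening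
  have hKK' : K ⊆ Metric.cthickening δ K := Metric.self_subset_cthickening K
  refine ⟨Metric.cthickening δ K, hK', hδU, fun z hz => h0 z fun hzK => hz (hKK' hzK), ?_⟩
  intro ε hε
  have hsupp : ∀ {χ : (Fin N → ℝ) → ℝ}, (∀ z, z ∉ K → χ z = 0) → HasCompactSupport χ :=
    fun hχ => HasCompactSupport.intro hK hχ
  have hcs := hsupp fun z hz => (h0 z hz).1
  have hcs' := hsupp fun z hz => (h0 z hz).2
  have hu := hcs.uniformContinuous_of_continuous h.cont
  have hu' := hcs'.uniformContinuous_of_continuous h.cont'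
  obtain ⟨r1, hr1, hr1'⟩ := Metric.uniformContinuous_iff.1 hu ε hε
  obtain ⟨r2, hr2, hr2'⟩ := Metric.uniformContinuous_iff.1 hu' ε hε
  set r := min δ (min r1 r2) with hr
  have hrp : 0 < r := lt_min hδ (lt_min hr1 hr2)
  let b : ContDiffBump (0 : Fin N → ℝ) := ⟨r / 2, r, half_pos hrp, half_lt_self hrp⟩
  set φ : (Fin N → ℝ) → ℝ := (b.normed volume ⋆[ContinuousLinearMap.lsmul ℝ ℝ, volume] ψ) with hφ
  have hsm : ContDiff ℝ ∞ φ :=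
    b.hasCompactSupport_normed.contDiff_convolution_left _ b.contDiff_normed
      h.cont.locallyIntegrable
  have hder : ∀ z, partialDeriv j φ z
      = (b.normed volume ⋆[ContinuousLinearMap.lsmul ℝ ℝ, volume] ψ') z := by
    intro z
    have h1 : HasLineDerivAt ℝ φ (partialDeriv j φ z) z (Pi.single j 1) :=
      ((hsm.differentiable (by simp)) z).hasFDerivAt.hasLineDerivAt _
    refine h1.unique ?_
    obtain ⟨C, hC⟩ := hcs'.exists_bound_of_continuous h.cont'
    have := hasDerivAt_integral_of_dominated_loc_of_deriv_le (μ := volume) (s := univ)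
      (F := fun (t : ℝ) (y : Fin N → ℝ) =>
        b.normed volume y * ψ (z + t • Pi.single j 1 - y))
      (F' := fun (t : ℝ) (y : Fin N → ℝ) =>
        b.normed volume y * ψ' (z + t • Pi.single j 1 - y))
      (x₀ := (0 : ℝ)) (bound := fun y => b.normed volume y * C) Filter.univ_mem ?_ ?_ ?_ ?_ ?_ ?_
    · have h2 := this.2
      simp only [zero_smul, add_zero] at h2
      exact h2
    · refine Filter.Eventually.of_forall fun t => Continuous.aestronglyMeasurable ?_
      have := h.cont
      have := b.continuous_normed (μ := volume)
      fun_prop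
    · refine Continuous.integrable_of_hasCompactSupport ?_ b.hasCompactSupport_normed.mul_right
      have := h.cont
      have := b.continuous_normed (μ := volume)
      fun_prop
    · refine Continuous.aestronglyMeasurable ?_
      have := h.cont'
      have := b.continuous_normed (μ := volume)
      fun_prop
    · refine Filter.Eventually.of_forall fun y t _ => ?_
      rw [norm_mul, Real.norm_of_nonneg (b.nonneg_normed y)]
      exact mul_le_mul_of_nonneg_left (hC _) (b.nonneg_normed y)
    · exact (Continuous.integrable_of_hasCompactSupport b.continuous_normed
        b.hasCompactSupport_normed).mul_const C
    · refine Filter.Eventually.of_forall fun y t _ => ?_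
      refine HasDerivAt.const_mul _ ?_
      have h3 := h.deriv (z + t • Pi.single j 1 - y)
      have h4 : HasDerivAt (fun s : ℝ => s - t) 1 t := (hasDerivAt_id t).sub_const t
      have h5 : HasDerivAt (fun s : ℝ => ψ (z + t • Pi.single j 1 - y + s • Pi.single j 1))
          (ψ' (z + t • Pi.single j 1 - y)) (t - t) := by rw [sub_self]; exact h3
      have h6 := HasDerivAt.scomp (h := fun s : ℝ => s - t) t h5 h4
      rw [one_smul] at h6
      refine h6.congr_of_eventuallyEq (Filter.Eventually.of_forall fun s => ?_)
      simp only [Function.comp_apply]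
      congr 1
      rw [sub_smul]
      abel
  refine ⟨φ, hsm, ?_, fun z => ⟨?_, ?_⟩⟩
  · refine closure_minimal ?_ Metric.isClosed_cthickening
    refine (support_convolution_subset _).trans ?_
    rintro _ ⟨t, ht, k, hk, rfl⟩
    rw [b.support_normed_eq, mem_ball_zero_iff] at ht
    have hkK : k ∈ K := by
      by_contra hk'
      exact hk (h0 k hk').1
    refine Metric.mem_cthickening_of_dist_le _ k _ _ hkK ?_
    rw [dist_eq_norm, add_sub_cancel_right]
    exact (ht.trans_le (min_le_left _ _)).le
  · rw [← Real.dist_eq]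
    refine b.dist_normed_convolution_le h.cont.aestronglyMeasurable fun x hx => ?_
    exact (hr1' (lt_of_lt_of_le hx ((min_le_right _ _).trans (min_le_left _ _)))).le
  · rw [← Real.dist_eq, hder]
    refine b.dist_normed_convolution_le h.cont'.aestronglyMeasurable fun x hx => ?_
    exact (hr2' (lt_of_lt_of_le hx ((min_le_right _ _).trans (min_le_right _ _)))).le

namespace WeakPartial

variable {U : Set (Fin N → ℝ)} {j : Fin N} {f g : (Fin N → ℝ) → E}

theorem integrableOn (h : WeakPartial U j f g) {K : Set (Fin N → ℝ)} (hK : IsCompact K)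
    (hKU : K ⊆ U) : IntegrableOn f K ∧ IntegrableOn g K :=
  ⟨h.1.integrableOn_compact_subset hKU hK, h.2.1.integrableOn_compact_subset hKU hK⟩

/-- The smooth approximations share a compact support on which `f` and `g` are integrable, so both
sides pass to the limit by dominated convergence. Functions with merely one continuous partial
derivative thereby become admissible for testing. -/
theorem test (h : WeakPartial U j f g) (hU : IsOpen U) {ψ ψ' : (Fin N → ℝ) → ℝ}
    (hψ : TestPair U j ψ ψ') : ∫ z, ψ' z • f z = -∫ z, ψ z • g z := by
  obtain ⟨K, hK, hKU, h0, happ⟩ := hψ.exists_smooth_approx hU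
  choose φ hφs hφK hφ using fun n : ℕ => happ (1 / ((n : ℝ) + 1)) (by positivity)
  obtain ⟨hf, hg⟩ := h.integrableOn hK hKU
  have hε : Tendsto (fun n : ℕ => 1 / ((n : ℝ) + 1)) atTop (𝓝 0) :=
    tendsto_one_div_add_atTop_nhds_zero_nat
  have hlim : ∀ {χ : ℕ → (Fin N → ℝ) → ℝ} {χ0 : (Fin N → ℝ) → ℝ} {u : (Fin N → ℝ) → E},
      IntegrableOn u K → (∀ n, Continuous (χ n)) → Continuous χ0 → (∀ n z, z ∉ K → χ n z = 0) →
      (∀ z, z ∉ K → χ0 z = 0) → (∀ n z, |χ n z - χ0 z| ≤ 1 / ((n : ℝ) + 1)) →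
      Tendsto (fun n => ∫ z, χ n z • u z) atTop (𝓝 (∫ z, χ0 z • u z)) := by
    intro χ χ0 u hu hχ hχ0 hz hz0 hd
    have e : ∀ {θ : (Fin N → ℝ) → ℝ}, (∀ z, z ∉ K → θ z = 0) →
        ∫ z, θ z • u z = ∫ z in K, θ z • u z := by
      intro θ hθ
      refine (setIntegral_eq_integral_of_forall_compl_eq_zero fun z hzK => ?_).symm
      rw [hθ z hzK, zero_smul]
    rw [e hz0]
    simp only [fun n => e (hz n)]
    obtain ⟨C, hC⟩ := (HasCompactSupport.intro hK hz0).exists_bound_of_continuous hχ0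
    refine tendsto_integral_of_dominated_convergence (fun z => (C + 1) * ‖u z‖)
      (fun n => (hχ n).aestronglyMeasurable.smul hu.1) (hu.norm.const_mul _)
      (fun n => Eventually.of_forall fun z => ?_) (Eventually.of_forall fun z => ?_)
    · rw [norm_smul]
      refine mul_le_mul_of_nonneg_right ?_ (norm_nonneg _)
      have h1 := hd n z
      have h2 : 1 / ((n : ℝ) + 1) ≤ 1 := by
        rw [div_le_one (by positivity)]
        have : (0 : ℝ) ≤ n := Nat.cast_nonneg n
        linarith
      have h3 := hC z
      rw [Real.norm_eq_abs] at *
      have h4 := abs_sub_abs_le_abs_sub (χ n z) (χ0 z)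
      linarith
    · refine Tendsto.smul_const ?_ _
      refine tendsto_iff_dist_tendsto_zero.2 (squeeze_zero (fun _ => dist_nonneg) (fun n => ?_) hε)
      rw [Real.dist_eq]
      exact hd n z
  have hφ0 : ∀ n z, z ∉ K → φ n z = 0 := fun n z hz =>
    image_eq_zero_of_notMem_tsupport fun hz' => hz (hφK n hz')
  have hφ0' : ∀ n z, z ∉ K → partialDeriv j (φ n) z = 0 := fun n z hz => by
    have : fderiv ℝ (φ n) z = 0 := by
      by_contra hne
      exact hz (hφK n (support_fderiv_subset ℝ hne))
    rw [partialDeriv, this]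
    rfl
  have hc : ∀ n, Continuous (partialDeriv j (φ n)) := fun n =>
    ((hφs n).continuous_fderiv (by simp)).clm_apply continuous_const
  have l1 := hlim hf hc hψ.cont' hφ0' (fun z hz => (h0 z hz).2) fun n z => (hφ n z).2
  have l2 := hlim hg (fun n => (hφs n).continuous) hψ.cont hφ0 (fun z hz => (h0 z hz).1)
    fun n z => (hφ n z).1
  refine tendsto_nhds_unique l1 ?_
  refine l2.neg.congr fun n => ?_
  exact (h.2.2 (φ n) (hφs n) (HasCompactSupport.of_support_subset_isCompact hK
    ((subset_tsupport _).trans (hφK n))) ((hφK n).trans hKU)).symm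

theorem map_clm [CompleteSpace E] {E' : Type*} [NormedAddCommGroup E'] [NormedSpace ℝ E']
    [CompleteSpace E'] (L : E →L[ℝ] E') (hU : IsOpen U) (h : WeakPartial U j f g) :
    WeakPartial U j (fun z => L (f z)) (fun z => L (g z)) := by
  have hli : ∀ {u : (Fin N → ℝ) → E}, LocallyIntegrableOn u U volume →
      LocallyIntegrableOn (fun z => L (u z)) U volume := by
    intro u hu
    rw [locallyIntegrableOn_iff hU.isLocallyClosed] at hu ⊢
    exact fun K hKU hK => L.integrable_comp (hu K hKU hK)
  refine ⟨hli h.1, hli h.2.1, fun φ hφ hc hs => ?_⟩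
  have hint : ∀ {u : (Fin N → ℝ) → E} {θ : (Fin N → ℝ) → ℝ}, Continuous θ → tsupport θ ⊆ U →
      HasCompactSupport θ → LocallyIntegrableOn u U volume →
      Integrable (fun z => θ z • u z) := by
    intro u θ hθ hθU hθc hu
    have h1 : IntegrableOn u (tsupport θ) := hu.integrableOn_compact_subset hθU hθc
    have h2 : IntegrableOn (fun z => θ z • u z) (tsupport θ) :=
      h1.continuousOn_smul hθ.continuousOn hθc
    rw [← integrableOn_iff_integrable_of_support_subset (s := tsupport θ)]
    · exact h2
    · intro z hz
      by_contra hz'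
      exact hz (by simp [image_eq_zero_of_notMem_tsupport hz'])
  have hsub : tsupport (partialDeriv j φ) ⊆ tsupport φ := by
    refine closure_minimal (fun z hz => ?_) isClosed_closure
    refine support_fderiv_subset ℝ (fun h0 => hz ?_)
    rw [partialDeriv, h0]
    rfl
  have hcd : Continuous (partialDeriv j φ) :=
    (hφ.continuous_fderiv (by simp)).clm_apply continuous_const
  have h1 := hint hcd
    (hsub.trans hs) (HasCompactSupport.of_support_subset_isCompact hc
      ((subset_tsupport _).trans hsub)) h.1
  have h2 := hint hφ.continuous hs hc h.2.1
  have e := congrArg L (h.2.2 φ hφ hc hs)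
  rw [map_neg, ← L.integral_comp_comm h1, ← L.integral_comp_comm h2] at e
  simpa only [map_smul] using e

end WeakPartial

end Weak

/-! ### Products of weakly differentiable functions and operator families -/

section Product

open Filter Topology

variable {N : ℕ} {H : Type*} [NormedAddCommGroup H] [InnerProductSpace ℂ H]

/-- Distinct orthonormal vectors have distance `√2`, so the balls of radius `1 / 2` around them are
disjoint open sets, of which a separable space has only countably many. -/
theorem exists_countable_hilbertBasis (H : Type*) [NormedAddCommGroup H] [InnerProductSpace ℂ H]
    [CompleteSpace H] [TopologicalSpace.SeparableSpace H] :
    ∃ w : Set H, w.Countable ∧ Nonempty (HilbertBasis w ℂ H) := by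
  obtain ⟨w, b, hb⟩ := exists_hilbertBasis ℂ H
  refine ⟨w, ?_, ⟨b⟩⟩
  refine Set.PairwiseDisjoint.countable_of_isOpen (s := fun x : H => Metric.ball x (1 / 2))
    ?_ (fun _ _ => Metric.isOpen_ball) (fun x _ => ⟨x, Metric.mem_ball_self (by norm_num)⟩)
  intro x hx y hy hxy
  refine Metric.ball_disjoint_ball ?_
  have hne : (⟨x, hx⟩ : w) ≠ ⟨y, hy⟩ := fun h => hxy (congrArg Subtype.val h)
  have h0 := b.orthonormal.2 hne
  have h1 := b.orthonormal.1 ⟨x, hx⟩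
  have h2 := b.orthonormal.1 ⟨y, hy⟩
  rw [hb] at h0 h1 h2
  have h3 := norm_sub_sq (𝕜 := ℂ) x y
  simp only at h0 h1 h2
  rw [h0, h1, h2] at h3
  rw [dist_eq_norm]
  norm_num at h3
  nlinarith [norm_nonneg (x - y)]

/-- The family `T` need not be measurable in operator norm. Expanding `y z` in a countable basis
leaves countably many terms, each measurable by the strong measurability of `T`. -/
theorem aestronglyMeasurable_apply {X : Type*} [MeasurableSpace X] {ν : Measure X} {w : Set H}
    [Countable w] (b : HilbertBasis w ℂ H) {F : Type*} [NormedAddCommGroup F] [NormedSpace ℂ F]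
    {T : X → H →L[ℂ] F}
    (hm : ∀ h, AEStronglyMeasurable (fun z => T z h) ν) {y : X → H}
    (hy : AEStronglyMeasurable y ν) : AEStronglyMeasurable (fun z => T z (y z)) ν := by
  refine aestronglyMeasurable_of_tendsto_ae (u := (atTop : Filter (Finset w)))
    (f := fun s z => ∑ i ∈ s, inner ℂ (b i : H) (y z) • T z (b i)) ?_ ?_
  · intro s
    exact Finset.aestronglyMeasurable_fun_sum s fun i _ =>
      (aestronglyMeasurable_const.inner hy).smul (hm _)
  · refine Eventually.of_forall fun z => ?_
    have h := (b.hasSum_repr (y z)).mapL (T z)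
    simp only [map_smul, b.repr_apply_apply] at h
    exact h

theorem aestronglyMeasurable_of_inner {X : Type*} [MeasurableSpace X] {ν : Measure X} {w : Set H}
    [Countable w] (b : HilbertBasis w ℂ H) {V : Type*} {ι : V → H} (hd : DenseRange ι) {y : X → H}
    (hy : ∀ v, AEStronglyMeasurable (fun z => (inner ℂ (ι v) (y z) : ℂ)) ν) :
    AEStronglyMeasurable y ν := by
  have h1 : ∀ k : H, AEStronglyMeasurable (fun z => (inner ℂ k (y z) : ℂ)) ν := by
    intro k
    have hk := hd k
    rw [mem_closure_iff_seq_limit] at hk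
    obtain ⟨x, hx, hxk⟩ := hk
    refine aestronglyMeasurable_of_tendsto_ae (u := atTop)
      (f := fun n z => (inner ℂ (x n) (y z) : ℂ)) ?_ ?_
    · intro n
      obtain ⟨v, hv⟩ := hx n
      rw [← hv]
      exact hy v
    · exact Eventually.of_forall fun z => hxk.inner tendsto_const_nhds
  refine aestronglyMeasurable_of_tendsto_ae (u := (atTop : Filter (Finset w)))
    (f := fun s z => ∑ i ∈ s, inner ℂ (b i : H) (y z) • (b i : H)) ?_ ?_
  · intro s
    exact Finset.aestronglyMeasurable_fun_sum s fun i _ => (h1 _).smul_const _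
  · refine Eventually.of_forall fun z => ?_
    have h := b.hasSum_repr (y z)
    simp only [b.repr_apply_apply] at h
    exact h

theorem norm_sum_inner_smul_le {κ : Type*} {b : κ → H} (hb : Orthonormal ℂ b) (s : Finset κ)
    (x : H) : ‖∑ i ∈ s, inner ℂ (b i) x • b i‖ ≤ ‖x‖ := by
  have h1 := hb.sum_inner_products_le x (s := s)
  have h2 : ‖∑ i ∈ s, inner ℂ (b i) x • b i‖ ^ 2 = ∑ i ∈ s, ‖inner ℂ (b i) x‖ ^ 2 := by
    rw [← inner_self_eq_norm_sq (𝕜 := ℂ), hb.inner_sum]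
    simp only [RCLike.conj_mul, map_sum]
    refine Finset.sum_congr rfl fun i _ => ?_
    norm_cast
  rw [← h2] at h1
  exact (sq_le_sq₀ (norm_nonneg _) (norm_nonneg _)).1 h1

/-- The partial sums are `T z` applied to orthogonal projections of `y z`, so `C ‖y z‖` dominates
all of them. This lets an operator product be treated one basis vector at a time. -/
theorem hasSum_integral_apply {X : Type*} [MeasurableSpace X] {ν : Measure X} {w : Set H}
    [Countable w] (b : HilbertBasis w ℂ H) {F : Type*} [NormedAddCommGroup F] [NormedSpace ℂ F]
    {T : X → H →L[ℂ] F}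
    (hm : ∀ h, AEStronglyMeasurable (fun z => T z h) ν) {C : ℝ} (hC : ∀ z, ‖T z‖ ≤ C) {y : X → H}
    (hy : Integrable y ν) :
    HasSum (fun i => ∫ z, inner ℂ (b i : H) (y z) • T z (b i) ∂ν) (∫ z, T z (y z) ∂ν) := by
  have hint : ∀ i, Integrable (fun z => inner ℂ (b i : H) (y z) • T z (b i)) ν := by
    intro i
    refine Integrable.mono' (hy.norm.const_mul C)
      ((aestronglyMeasurable_const.inner hy.1).smul (hm _)) (Eventually.of_forall fun z => ?_)
    have h1 := norm_inner_le_norm (𝕜 := ℂ) (b i : H) (y z)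
    have h2 := (T z).le_of_opNorm_le (hC z) (b i)
    rw [b.orthonormal.1 i] at h1 h2
    rw [norm_smul, mul_comm]
    exact mul_le_mul (by linarith) (by linarith) (norm_nonneg _) ((norm_nonneg _).trans (hC z))
  change Tendsto _ _ _
  simp only [← integral_finsetSum _ fun i _ => hint i]
  refine tendsto_integral_filter_of_dominated_convergence (fun z => C * ‖y z‖)
    (Eventually.of_forall fun s => ?_) (Eventually.of_forall fun s => Eventually.of_forall
    fun z => ?_) (hy.norm.const_mul C) (Eventually.of_forall fun z => ?_)
  · exact Finset.aestronglyMeasurable_fun_sum s fun i _ => (hint i).1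
  · have : ∑ i ∈ s, inner ℂ (b i : H) (y z) • T z (b i)
        = T z (∑ i ∈ s, inner ℂ (b i : H) (y z) • b i) := by
      simp only [map_sum, map_smul]
    rw [this]
    refine ((T z).le_of_opNorm_le (hC z) _).trans ?_
    exact mul_le_mul_of_nonneg_left (norm_sum_inner_smul_le b.orthonormal s _)
      ((norm_nonneg _).trans (hC z))
  · have h := (b.hasSum_repr (y z)).mapL (T z)
    simp only [map_smul, b.repr_apply_apply] at h
    exact h

theorem integrable_smul_of_compact {E 𝕜 : Type*} [RCLike 𝕜] [NormedAddCommGroup E]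
    [NormedSpace 𝕜 E] {U K : Set (Fin N → ℝ)} {f : (Fin N → ℝ) → E}
    (hf : LocallyIntegrableOn f U volume) (hK : IsCompact K) (hKU : K ⊆ U)
    {ψ : (Fin N → ℝ) → 𝕜} (hψ : Continuous ψ) (h0 : ∀ z, z ∉ K → ψ z = 0) :
    Integrable (fun z => ψ z • f z) := by
  have h1 : IntegrableOn f K := hf.integrableOn_compact_subset hKU hK
  rw [← integrableOn_iff_integrable_of_support_subset (s := K)]
  · exact h1.continuousOn_smul hψ.continuousOn hK
  · intro z hz
    by_contra hz'
    exact hz (by simp [h0 z hz'])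

theorem WeakPartial.test_complex {E : Type*} [NormedAddCommGroup E] [NormedSpace ℂ E]
    [CompleteSpace E] {U : Set (Fin N → ℝ)} {j : Fin N} {f g : (Fin N → ℝ) → E}
    (h : WeakPartial U j f g) (hU : IsOpen U) {ψ ψ' : (Fin N → ℝ) → ℂ}
    (hψ : TestPair U j ψ ψ') : ∫ z, ψ' z • f z = -∫ z, ψ z • g z := by
  have hre := hψ.map_clm Complex.reCLM
  have him := hψ.map_clm Complex.imCLM
  obtain ⟨K, hK, hKU, h0⟩ := hψ.exists_compact
  have key : ∀ {θ : (Fin N → ℝ) → ℂ} {u : (Fin N → ℝ) → E}, Continuous θ →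
      (∀ z, z ∉ K → θ z = 0) → LocallyIntegrableOn u U volume →
      ∫ z, θ z • u z = (∫ z, (θ z).re • u z) + Complex.I • ∫ z, (θ z).im • u z := by
    intro θ u hθ hθ0 hu
    have i1 := integrable_smul_of_compact (𝕜 := ℝ) hu hK hKU (Complex.continuous_re.comp hθ)
      (fun z hz => by simp [hθ0 z hz])
    have i2 := integrable_smul_of_compact (𝕜 := ℝ) hu hK hKU (Complex.continuous_im.comp hθ)
      (fun z hz => by simp [hθ0 z hz])
    simp only [Function.comp_apply] at i1 i2
    have i3 : Integrable (fun z => Complex.I • (θ z).im • u z) := i2.smul Complex.I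
    rw [← integral_smul, ← integral_add i1 i3]
    refine integral_congr_ae (Eventually.of_forall fun z => ?_)
    simp only
    conv_lhs => rw [← Complex.re_add_im (θ z)]
    rw [add_smul, mul_comm, mul_smul, Complex.coe_smul, Complex.coe_smul]
  rw [key hψ.cont' (fun z hz => (h0 z hz).2) h.1, key hψ.cont (fun z hz => (h0 z hz).1) h.2.1]
  have e1 := h.test hU hre
  have e2 := h.test hU him
  simp only [Complex.reCLM_apply, Complex.imCLM_apply] at e1 e2
  rw [e1, e2, smul_neg, neg_add]

/-- `F'` is the derivative of the operator family `F` in the `j`-th coordinate, in the weak sense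
given by a dense set of test vectors; both are locally bounded and weakly continuous. -/
structure OpDeriv {V : Type*} (U : Set (Fin N → ℝ)) (j : Fin N) (ι : V → H)
    (F F' : (Fin N → ℝ) → H →L[ℂ] H) : Prop where
  cont : ∀ v h, ContinuousOn (fun z => (inner ℂ (ι v) (F z h) : ℂ)) U
  cont' : ∀ v h, ContinuousOn (fun z => (inner ℂ (ι v) (F' z h) : ℂ)) U
  deriv : ∀ v h, ∀ z ∈ U, HasLineDerivAt ℝ (fun z => (inner ℂ (ι v) (F z h) : ℂ))
    (inner ℂ (ι v) (F' z h)) z (Pi.single j 1)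
  bdd : ∀ K, IsCompact K → K ⊆ U → ∃ C, ∀ z ∈ K, ‖F z‖ ≤ C
  bdd' : ∀ K, IsCompact K → K ⊆ U → ∃ C, ∀ z ∈ K, ‖F' z‖ ≤ C

theorem aestronglyMeasurable_op {w : Set H} [Countable w] (b : HilbertBasis w ℂ H) {V : Type*}
    {ι : V → H} (hd : DenseRange ι) {U : Set (Fin N → ℝ)} (hU : IsOpen U)
    {F : (Fin N → ℝ) → H →L[ℂ] H}
    (hF : ∀ v h, ContinuousOn (fun z => (inner ℂ (ι v) (F z h) : ℂ)) U) (h : H) :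
    AEStronglyMeasurable (fun z => F z h) (volume.restrict U) :=
  aestronglyMeasurable_of_inner b hd fun v =>
    (hF v h).aestronglyMeasurable hU.measurableSet

theorem locallyIntegrableOn_op {w : Set H} [Countable w] (b : HilbertBasis w ℂ H) {V : Type*}
    {ι : V → H} (hd : DenseRange ι) {U : Set (Fin N → ℝ)} (hU : IsOpen U)
    {F : (Fin N → ℝ) → H →L[ℂ] H}
    (hF : ∀ v h, ContinuousOn (fun z => (inner ℂ (ι v) (F z h) : ℂ)) U)
    (hb : ∀ K, IsCompact K → K ⊆ U → ∃ C, ∀ z ∈ K, ‖F z‖ ≤ C) {y : (Fin N → ℝ) → H}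
    (hy : LocallyIntegrableOn y U volume) :
    LocallyIntegrableOn (fun z => F z (y z)) U volume := by
  have hm : AEStronglyMeasurable (fun z => F z (y z)) (volume.restrict U) :=
    aestronglyMeasurable_apply b (aestronglyMeasurable_op b hd hU hF) hy.aestronglyMeasurable
  rw [locallyIntegrableOn_iff hU.isLocallyClosed] at hy ⊢
  intro K hKU hK
  obtain ⟨C, hC⟩ := hb K hK hKU
  refine Integrable.mono' ((hy K hKU hK).norm.const_mul C) (hm.mono_set hKU) ?_
  filter_upwards [ae_restrict_mem hK.measurableSet] with z hz
  exact (F z).le_of_opNorm_le (hC z hz) _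

/-- A Leibniz rule for families that are differentiable only against test vectors. After pairing
with `ι v` and expanding `y` in the basis, each term concerns the scalar function `(b i | y)`, and
`φ · (ι v | F b i)` is a legitimate test function for it. Thus no differentiability of `F` in norm
is needed. -/
theorem OpDeriv.weakPartial [CompleteSpace H] {w : Set H} [Countable w] (b : HilbertBasis w ℂ H)
    {V : Type*} {ι : V → H} (hd : DenseRange ι) {U : Set (Fin N → ℝ)} (hU : IsOpen U) {j : Fin N}
    {F F' : (Fin N → ℝ) → H →L[ℂ] H} (hF : OpDeriv U j ι F F') {y y' : (Fin N → ℝ) → H}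
    (hy : WeakPartial U j y y') :
    WeakPartial U j (fun z => F z (y z)) (fun z => F' z (y z) + F z (y' z)) := by
  have l1 := locallyIntegrableOn_op b hd hU hF.cont hF.bdd hy.1
  have l2 := locallyIntegrableOn_op b hd hU hF.cont' hF.bdd' hy.1
  have l3 := locallyIntegrableOn_op b hd hU hF.cont hF.bdd hy.2.1
  refine ⟨l1, l2.add l3, fun φ hφ hφc hφU => ?_⟩
  set K := tsupport φ with hKdef
  have hK : IsCompact K := hφc
  have hφ' : Continuous (partialDeriv j φ) :=
    (hφ.continuous_fderiv (by simp)).clm_apply continuous_const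
  have hφ0 : ∀ z, z ∉ K → φ z = 0 := fun z hz => image_eq_zero_of_notMem_tsupport hz
  have hφ0' : ∀ z, z ∉ K → partialDeriv j φ z = 0 := by
    intro z hz
    have : fderiv ℝ φ z = 0 := by
      by_contra hne
      exact hz (support_fderiv_subset ℝ hne)
    rw [partialDeriv, this]
    rfl
  have i1 := integrable_smul_of_compact (𝕜 := ℝ) l1 hK hφU hφ' hφ0'
  have i2 := integrable_smul_of_compact (𝕜 := ℝ) l2 hK hφU hφ.continuous hφ0
  have i3 := integrable_smul_of_compact (𝕜 := ℝ) l3 hK hφU hφ.continuous hφ0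
  simp only [Pi.add_apply, smul_add]
  rw [integral_add i2 i3, eq_neg_iff_add_eq_zero]
  refine hd.eq_zero_of_inner_right ℂ fun v => ?_
  rw [inner_add_right, inner_add_right, ← integral_inner i1, ← integral_inner i2,
    ← integral_inner i3]
  have red : ∀ {G : (Fin N → ℝ) → H →L[ℂ] H} {θ : (Fin N → ℝ) → ℝ} {u : (Fin N → ℝ) → H},
      (∀ v h, ContinuousOn (fun z => (inner ℂ (ι v) (G z h) : ℂ)) U) →
      (∀ K, IsCompact K → K ⊆ U → ∃ C, ∀ z ∈ K, ‖G z‖ ≤ C) → Continuous θ →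
      (∀ z, z ∉ K → θ z = 0) → LocallyIntegrableOn u U volume →
      HasSum (fun i => ∫ z, inner ℂ (b i : H) (u z) • ((θ z : ℂ) * inner ℂ (ι v) (G z (b i))))
        (∫ z, inner ℂ (ι v) (θ z • G z (u z))) := by
    intro G θ u hG hb hθ hθ0 hu
    obtain ⟨C, hC⟩ := hb K hK hφU
    obtain ⟨c, hc⟩ := (HasCompactSupport.intro hK hθ0).exists_bound_of_continuous hθ
    have huK : IntegrableOn u K := hu.integrableOn_compact_subset hφU hK
    let T : (Fin N → ℝ) → H →L[ℂ] ℂ := fun z => (θ z : ℂ) • ((innerSL ℂ (ι v)) ∘L G z)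
    have hT : ∀ z, ‖T z‖ ≤ c * (‖ι v‖ * C) ∨ z ∉ K := by
      intro z
      by_cases hz : z ∈ K
      · left
        have h1 : ‖(innerSL ℂ (ι v)) ∘L G z‖ ≤ ‖ι v‖ * C := by
          refine (ContinuousLinearMap.opNorm_comp_le _ _).trans ?_
          rw [innerSL_apply_norm]
          exact mul_le_mul_of_nonneg_left (hC z hz) (norm_nonneg _)
        rw [norm_smul]
        have h2 := hc z
        refine mul_le_mul (by simpa using h2) h1 (norm_nonneg _) ((norm_nonneg _).trans h2)
      · exact Or.inr hz
    have hT' : ∀ z, ‖T z‖ ≤ max 0 (c * (‖ι v‖ * C)) := by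
      intro z
      rcases hT z with h | h
      · exact h.trans (le_max_right _ _)
      · have : T z = 0 := by
          ext x
          simp [T, hθ0 z h]
        rw [this, norm_zero]
        exact le_max_left _ _
    have hTm : ∀ h, AEStronglyMeasurable (fun z => T z h) (volume.restrict K) := by
      intro h
      refine ((Complex.continuous_ofReal.comp hθ).aestronglyMeasurable).mul ?_
      exact ((hG v h).aestronglyMeasurable hU.measurableSet).mono_set hφU
    have hs := hasSum_integral_apply b hTm hT' huK
    have e : ∀ {q : (Fin N → ℝ) → ℂ}, (∀ z, z ∉ K → q z = 0) → ∫ z in K, q z = ∫ z, q z :=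
      fun hq => setIntegral_eq_integral_of_forall_compl_eq_zero hq
    have e1 : ∀ i, ∫ z in K, inner ℂ (b i : H) (u z) • T z (b i)
        = ∫ z, inner ℂ (b i : H) (u z) • ((θ z : ℂ) * inner ℂ (ι v) (G z (b i))) := by
      intro i
      rw [e]
      · rfl
      · intro z hz
        simp [T, hθ0 z hz]
    have e2 : ∫ z in K, T z (u z) = ∫ z, inner ℂ (ι v) (θ z • G z (u z)) := by
      rw [e]
      · refine integral_congr_ae (Eventually.of_forall fun z => ?_)
        simp [T, inner_smul_right_eq_smul]
      · intro z hz
        simp [T, hθ0 z hz]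
    simp only [e1, e2] at hs
    exact hs
  have h1 := red hF.cont hF.bdd hφ' hφ0' hy.1
  have h2 := red hF.cont' hF.bdd' hφ.continuous hφ0 hy.1
  have h3 := red hF.cont hF.bdd hφ.continuous hφ0 hy.2.1
  refine (h1.add (h2.add h3)).unique ?_
  convert hasSum_zero with i
  have hsc : WeakPartial U j (fun z => (inner ℂ (b i : H) (y z) : ℂ))
      (fun z => inner ℂ (b i : H) (y' z)) :=
    hy.map_clm ((innerSL ℂ (b i : H)).restrictScalars ℝ) hU
  have htp : TestPair U j (fun z => (φ z : ℂ) * inner ℂ (ι v) (F z (b i)))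
      (fun z => ((partialDeriv j φ z : ℝ) : ℂ) * inner ℂ (ι v) (F z (b i))
        + (φ z : ℂ) * inner ℂ (ι v) (F' z (b i))) := by
    refine TestPair.of_continuousOn hU hK hφU (fun z hz => by simp [hφ0 z hz])
      (fun z hz => by simp [hφ0 z hz, hφ0' z hz]) ?_ ?_ fun z hz => ?_
    · exact (Complex.continuous_ofReal.comp hφ.continuous).continuousOn.mul (hF.cont v _)
    · exact ((Complex.continuous_ofReal.comp hφ').continuousOn.mul (hF.cont v _)).add
        ((Complex.continuous_ofReal.comp hφ.continuous).continuousOn.mul (hF.cont' v _))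
    · have d1 : HasLineDerivAt ℝ (fun z => (φ z : ℂ)) ((partialDeriv j φ z : ℝ) : ℂ) z
          (Pi.single j 1) := by
        have : HasLineDerivAt ℝ φ (partialDeriv j φ z) z (Pi.single j 1) :=
          ((hφ.differentiable (by simp)) z).hasFDerivAt.hasLineDerivAt _
        exact HasDerivAt.ofReal_comp this
      have d2 := hF.deriv v (b i) z hz
      have := HasDerivAt.mul d1 d2
      simp only [zero_smul, add_zero] at this
      exact this
  have ht := hsc.test_complex hU htp
  obtain ⟨K', hK', hKU', hz'⟩ := htp.exists_compact
  have hGc : ∀ {G : (Fin N → ℝ) → H →L[ℂ] H} {θ : (Fin N → ℝ) → ℝ},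
      (∀ v h, ContinuousOn (fun z => (inner ℂ (ι v) (G z h) : ℂ)) U) → Continuous θ →
      (∀ z, z ∉ K → θ z = 0) →
      Integrable fun z => ((θ z : ℂ) * inner ℂ (ι v) (G z (b i))) • inner ℂ (b i : H) (y z) := by
    intro G θ hG hθ hθ0
    have h1 := hsc.1.integrableOn_compact_subset hφU hK
    rw [← integrableOn_iff_integrable_of_support_subset (s := K)]
    · refine h1.continuousOn_smul ?_ hK
      exact (Complex.continuous_ofReal.comp hθ).continuousOn.mul ((hG v _).mono hφU)
    · intro z hz
      by_contra hz'
      exact hz (by simp [hθ0 z hz'])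
  have j1 := hGc hF.cont hφ' hφ0'
  have j2 := hGc hF.cont' hφ.continuous hφ0
  simp only [add_smul] at ht
  rw [integral_add j1 j2] at ht
  simp only [smul_eq_mul] at ht ⊢
  simp only [mul_comm (inner ℂ (b i : H) _)]
  rw [← add_assoc, ht, neg_add_cancel]

end Product

/-! ### Weighted regularity in one coordinate -/

section WeightedRegularity

open Filter Topology
open scoped NNReal

variable {N : ℕ} {H : Type*} [NormedAddCommGroup H] [InnerProductSpace ℂ H]

/-- The square root of the weight in the `j`-th coordinate. -/
def sqrtRho (d : Fin N → CompLaw) (j : Fin N) (z : Fin N → ℝ) : ℝ := √((d j).rho (z j))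

theorem sqrtRho_nonneg (d : Fin N → CompLaw) (j : Fin N) (z : Fin N → ℝ) : 0 ≤ sqrtRho d j z :=
  Real.sqrt_nonneg _

theorem continuous_sqrtRho (d : Fin N → CompLaw) (j : Fin N) : Continuous (sqrtRho d j) :=
  Real.continuous_sqrt.comp ((d j).continuous_rho.comp (continuous_apply j))

theorem weight_single {d : Fin N → CompLaw} (j : Fin N) (i : ℕ) {z : Fin N → ℝ} (hz : z ∈ box d) :
    weight d (Pi.single j i) z = sqrtRho d j z ^ i := by
  rw [weight, Finset.prod_eq_single j]
  · rw [Pi.single_eq_same, sqrtRho, Real.sqrt_eq_rpow, ← Real.rpow_natCast,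
      ← Real.rpow_mul ((d j).rho_pos (hz j)).le]
    congr 1
    ring
  · intro k _ hk
    simp [Pi.single_eq_of_ne hk]
  · simp

/-- `f` has `m` weak derivatives in the `j`-th coordinate on the box, and the `k`-th one, multiplied
by the weight of order `i + k`, is bounded by `B` in `L₂(μ; H)`. -/
def WeightedReg (d : Fin N → CompLaw) (μ : Measure (Fin N → ℝ)) (j : Fin N) :
    ℕ → ℕ → ((Fin N → ℝ) → H) → ℝ≥0∞ → Prop
  | 0, i, f, B => AEStronglyMeasurable f μ ∧ eLpNorm (fun z => sqrtRho d j z ^ i • f z) 2 μ ≤ B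
  | m + 1, i, f, B => (AEStronglyMeasurable f μ ∧
      eLpNorm (fun z => sqrtRho d j z ^ i • f z) 2 μ ≤ B) ∧
      ∃ f', WeakPartial (box d) j f f' ∧ WeightedReg d μ j m (i + 1) f' B

theorem WeakPartial.add {U : Set (Fin N → ℝ)} {j : Fin N} {f g f' g' : (Fin N → ℝ) → H}
    (hf : WeakPartial U j f f') (hg : WeakPartial U j g g') :
    WeakPartial U j (f + g) (f' + g') := by
  refine ⟨hf.1.add hg.1, hf.2.1.add hg.2.1, fun φ hφ hc hs => ?_⟩
  have hφ' : Continuous (partialDeriv j φ) :=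
    (hφ.continuous_fderiv (by simp)).clm_apply continuous_const
  have hφ0 : ∀ z, z ∉ tsupport φ → φ z = 0 := fun z hz => image_eq_zero_of_notMem_tsupport hz
  have hφ0' : ∀ z, z ∉ tsupport φ → partialDeriv j φ z = 0 := by
    intro z hz
    have : fderiv ℝ φ z = 0 := by
      by_contra hne
      exact hz (support_fderiv_subset ℝ hne)
    rw [partialDeriv, this]
    rfl
  have hK : IsCompact (tsupport φ) := hc
  simp only [Pi.add_apply, smul_add]
  rw [integral_add (integrable_smul_of_compact (𝕜 := ℝ) hf.1 hK hs hφ' hφ0')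
      (integrable_smul_of_compact (𝕜 := ℝ) hg.1 hK hs hφ' hφ0'),
    integral_add (integrable_smul_of_compact (𝕜 := ℝ) hf.2.1 hK hs hφ.continuous hφ0)
      (integrable_smul_of_compact (𝕜 := ℝ) hg.2.1 hK hs hφ.continuous hφ0),
    hf.2.2 φ hφ hc hs, hg.2.2 φ hφ hc hs, neg_add]

theorem WeakPartial.neg {U : Set (Fin N → ℝ)} {j : Fin N} {f f' : (Fin N → ℝ) → H}
    (hf : WeakPartial U j f f') : WeakPartial U j (-f) (-f') := by
  refine ⟨hf.1.neg, hf.2.1.neg, fun φ hφ hc hs => ?_⟩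
  simp only [Pi.neg_apply, smul_neg, integral_neg, hf.2.2 φ hφ hc hs]

namespace WeightedReg

variable {d : Fin N → CompLaw} {μ : Measure (Fin N → ℝ)} {j : Fin N}

theorem base {m i : ℕ} {f : (Fin N → ℝ) → H} {B : ℝ≥0∞} (h : WeightedReg d μ j m i f B) :
    AEStronglyMeasurable f μ ∧ eLpNorm (fun z => sqrtRho d j z ^ i • f z) 2 μ ≤ B := by
  cases m with
  | zero => exact h
  | succ m => exact h.1

theorem mono {m : ℕ} : ∀ {i : ℕ} {f : (Fin N → ℝ) → H} {B B' : ℝ≥0∞},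
    WeightedReg d μ j m i f B → B ≤ B' → WeightedReg d μ j m i f B' := by
  induction m with
  | zero => exact fun h hB => ⟨h.1, h.2.trans hB⟩
  | succ m ih =>
    rintro i f B B' ⟨h, f', hf, h'⟩ hB
    exact ⟨⟨h.1, h.2.trans hB⟩, f', hf, ih h' hB⟩

theorem of_succ {m : ℕ} : ∀ {i : ℕ} {f : (Fin N → ℝ) → H} {B : ℝ≥0∞},
    WeightedReg d μ j (m + 1) i f B → WeightedReg d μ j m i f B := by
  induction m with
  | zero => exact fun h => h.1
  | succ m ih =>
    rintro i f B ⟨h, f', hf, h'⟩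
    exact ⟨h, f', hf, ih h'⟩

theorem add {m : ℕ} : ∀ {i : ℕ} {f g : (Fin N → ℝ) → H} {B B' : ℝ≥0∞},
    WeightedReg d μ j m i f B → WeightedReg d μ j m i g B' →
      WeightedReg d μ j m i (f + g) (B + B') := by
  have key : ∀ {i : ℕ} {f g : (Fin N → ℝ) → H} {B B' : ℝ≥0∞},
      AEStronglyMeasurable f μ ∧ eLpNorm (fun z => sqrtRho d j z ^ i • f z) 2 μ ≤ B →
      AEStronglyMeasurable g μ ∧ eLpNorm (fun z => sqrtRho d j z ^ i • g z) 2 μ ≤ B' →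
      AEStronglyMeasurable (f + g) μ ∧
        eLpNorm (fun z => sqrtRho d j z ^ i • (f + g) z) 2 μ ≤ B + B' := by
    intro i f g B B' hf hg
    have hs : AEStronglyMeasurable (fun z => sqrtRho d j z ^ i) μ :=
      ((continuous_sqrtRho d j).pow i).aestronglyMeasurable
    refine ⟨hf.1.add hg.1, ?_⟩
    simp only [Pi.add_apply, smul_add]
    exact (eLpNorm_add_le (hs.smul hf.1) (hs.smul hg.1) (by norm_num)).trans (add_le_add hf.2 hg.2)
  induction m with
  | zero => exact fun hf hg => key hf hg
  | succ m ih =>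
    rintro i f g B B' ⟨hf, f', hf', hff⟩ ⟨hg, g', hg', hgg⟩
    exact ⟨key hf hg, f' + g', hf'.add hg', ih hff hgg⟩

theorem neg {m : ℕ} : ∀ {i : ℕ} {f : (Fin N → ℝ) → H} {B : ℝ≥0∞},
    WeightedReg d μ j m i f B → WeightedReg d μ j m i (-f) B := by
  have key : ∀ {i : ℕ} {f : (Fin N → ℝ) → H} {B : ℝ≥0∞},
      AEStronglyMeasurable f μ ∧ eLpNorm (fun z => sqrtRho d j z ^ i • f z) 2 μ ≤ B →
      AEStronglyMeasurable (-f) μ ∧ eLpNorm (fun z => sqrtRho d j z ^ i • (-f) z) 2 μ ≤ B := by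
    intro i f B hf
    refine ⟨hf.1.neg, le_trans (eLpNorm_mono fun z => ?_) hf.2⟩
    simp [norm_smul]
  induction m with
  | zero => exact fun hf => key hf
  | succ m ih =>
    rintro i f B ⟨hf, f', hf', hff⟩
    exact ⟨key hf, -f', hf'.neg, ih hff⟩

variable [CompleteSpace H] {w : Set H} [Countable w] {V : Type*} {ι : V → H}

/-- Multiplication by an operator family with weighted bound. -/
theorem base_op (hμ : IsJointLaw d μ) (b : HilbertBasis w ℂ H) (hd : DenseRange ι)
    {F : (Fin N → ℝ) → H →L[ℂ] H}
    (hF : ∀ v h, ContinuousOn (fun z => (inner ℂ (ι v) (F z h) : ℂ)) (box d)) {C : ℝ≥0} {k : ℕ}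
    (hC : ∀ z ∈ box d, sqrtRho d j z ^ k * ‖F z‖ ≤ C) {i : ℕ} {f : (Fin N → ℝ) → H} {B : ℝ≥0∞}
    (hf : AEStronglyMeasurable f μ ∧ eLpNorm (fun z => sqrtRho d j z ^ i • f z) 2 μ ≤ B) :
    AEStronglyMeasurable (fun z => F z (f z)) μ ∧
      eLpNorm (fun z => sqrtRho d j z ^ (i + k) • F z (f z)) 2 μ ≤ C * B := by
  refine ⟨aestronglyMeasurable_apply b (fun h => (aestronglyMeasurable_op b hd (isOpen_box d) hF
    h).mono_ac hμ.absolutelyContinuous) hf.1, ?_⟩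
  refine (eLpNorm_le_nnreal_smul_eLpNorm_of_ae_le_mul (c := C)
    (g := fun z => sqrtRho d j z ^ i • f z) ?_ 2).trans ?_
  · filter_upwards [hμ.ae_mem_box] with z hz
    rw [← NNReal.coe_le_coe]
    push_cast
    rw [norm_smul, norm_smul, pow_add, norm_mul,
      Real.norm_of_nonneg (pow_nonneg (sqrtRho_nonneg d j z) k)]
    calc ‖sqrtRho d j z ^ i‖ * sqrtRho d j z ^ k * ‖F z (f z)‖
        ≤ ‖sqrtRho d j z ^ i‖ * sqrtRho d j z ^ k * (‖F z‖ * ‖f z‖) :=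
          mul_le_mul_of_nonneg_left ((F z).le_opNorm _)
            (mul_nonneg (norm_nonneg _) (pow_nonneg (sqrtRho_nonneg d j z) k))
      _ = (sqrtRho d j z ^ k * ‖F z‖) * (‖sqrtRho d j z ^ i‖ * ‖f z‖) := by ring
      _ ≤ C * (‖sqrtRho d j z ^ i‖ * ‖f z‖) :=
          mul_le_mul_of_nonneg_right (hC z hz) (mul_nonneg (norm_nonneg _) (norm_nonneg _))
  · rw [ENNReal.smul_def, smul_eq_mul]
    exact mul_le_mul_right hf.2 _

/-- The derivative of `F k f` is `F (k + 1) f + F k f'`, and each summand has one derivative fewer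
to account for and one more power of the weight. Two summands at each of `m` levels produce the
factor `2 ^ m`. -/
theorem leibniz (hμ : IsJointLaw d μ) (b : HilbertBasis w ℂ H) (hd : DenseRange ι) {M : ℕ}
    {F : ℕ → (Fin N → ℝ) → H →L[ℂ] H} (hF : ∀ k < M, OpDeriv (box d) j ι (F k) (F (k + 1)))
    (hF0 : ∀ k ≤ M, ∀ v h, ContinuousOn (fun z => (inner ℂ (ι v) (F k z h) : ℂ)) (box d)) {C : ℝ≥0}
    (hC : ∀ k ≤ M, ∀ z ∈ box d, sqrtRho d j z ^ k * ‖F k z‖ ≤ C) {m : ℕ} :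
    ∀ {i k : ℕ} {f : (Fin N → ℝ) → H} {B : ℝ≥0∞}, k + m ≤ M → WeightedReg d μ j m i f B →
      WeightedReg d μ j m (i + k) (fun z => F k z (f z)) (2 ^ m * (C * B)) := by
  induction m with
  | zero =>
    intro i k f B hk hf
    rw [pow_zero, one_mul]
    exact base_op hμ b hd (hF0 k hk) (hC k hk) hf
  | succ m ih =>
    rintro i k f B hk ⟨hf, f', hf', hff⟩
    have h0 : WeightedReg d μ j m i f B := WeightedReg.of_succ ⟨hf, f', hf', hff⟩
    have h1 := ih (k := k + 1) (by omega) h0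
    have h2 := ih (k := k) (by omega) hff
    rw [show i + 1 + k = i + (k + 1) by ring] at h2
    have h3 := base_op (j := j) hμ b hd (hF0 k (by omega)) (hC k (by omega)) hf
    refine ⟨⟨h3.1, h3.2.trans ?_⟩, _, (hF k (by omega)).weakPartial b hd (isOpen_box d) hf', ?_⟩
    · exact le_mul_of_one_le_left' (one_le_pow₀ (by norm_num))
    · rw [pow_succ, mul_comm (2 ^ m) 2, mul_assoc, two_mul]
      exact h1.add h2

end WeightedReg

/-- The constants in the estimate for the inverse of an operator family. -/
def invConst (M C : ℝ≥0) : ℕ → ℝ≥0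
  | 0 => M
  | m + 1 => invConst M C m + invConst M C m * (2 ^ m * (C * invConst M C m))

theorem le_invConst (M C : ℝ≥0) (m : ℕ) : M ≤ invConst M C m := by
  induction m with
  | zero => exact le_rfl
  | succ m ih => exact ih.trans (le_add_of_nonneg_right zero_le)

/-- The derivative of `Q f` is `-Q F₁ Q f + Q f'`. The induction hypothesis treats `Q f`, the
Leibniz rule `F₁ (Q f)`, and the induction hypothesis again the outer `Q`; this is the recursion of
`invConst`. The constant involves `Q` only through its supremum, which makes it uniform in the
spectral parameter. -/
theorem WeightedReg.inverse {d : Fin N → CompLaw} {μ : Measure (Fin N → ℝ)} {j : Fin N}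
    [CompleteSpace H] {w : Set H} [Countable w] {V : Type*} {ι : V → H}
    (hμ : IsJointLaw d μ) (b : HilbertBasis w ℂ H) (hd : DenseRange ι) {M : ℕ}
    {F : ℕ → (Fin N → ℝ) → H →L[ℂ] H} (hF : ∀ k < M, OpDeriv (box d) j ι (F k) (F (k + 1)))
    (hF0 : ∀ k ≤ M, ∀ v h, ContinuousOn (fun z => (inner ℂ (ι v) (F k z h) : ℂ)) (box d)) {C : ℝ≥0}
    (hC : ∀ k ≤ M, ∀ z ∈ box d, sqrtRho d j z ^ k * ‖F k z‖ ≤ C)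
    {Q : (Fin N → ℝ) → H →L[ℂ] H} {C' : ℝ≥0} (hQ : ∀ z ∈ box d, ‖Q z‖ ≤ C')
    (hQ' : OpDeriv (box d) j ι Q (fun z => -(Q z ∘L F 1 z ∘L Q z))) {m : ℕ} :
    ∀ {i : ℕ} {f : (Fin N → ℝ) → H} {B : ℝ≥0∞}, m ≤ M → WeightedReg d μ j m i f B →
      WeightedReg d μ j m i (fun z => Q z (f z)) (invConst C' C m * B) := by
  have hQ0 : ∀ z ∈ box d, sqrtRho d j z ^ 0 * ‖Q z‖ ≤ C' := by simpa using hQ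
  induction m with
  | zero =>
    intro i f B hk hf
    exact WeightedReg.base_op (k := 0) hμ b hd hQ'.cont hQ0 hf
  | succ m ih =>
    rintro i f B hk ⟨hf, f', hf', hff⟩
    have h0 : WeightedReg d μ j m i f B := WeightedReg.of_succ ⟨hf, f', hf', hff⟩
    have h1 := ih (by omega) hff
    have h2 := ih (by omega)
      (WeightedReg.leibniz hμ b hd hF hF0 hC (k := 1) (by omega) (ih (by omega) h0))
    have h3 := WeightedReg.base_op (k := 0) (j := j) hμ b hd hQ'.cont hQ0 hf
    refine ⟨⟨h3.1, h3.2.trans ?_⟩, _, hQ'.weakPartial b hd (isOpen_box d) hf', ?_⟩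
    · gcongr
      exact_mod_cast le_invConst C' C (m + 1)
    · refine (h2.neg.add h1).mono (le_of_eq ?_)
      simp only [invConst]
      push_cast
      ring

theorem multiDeriv_single {F : Type*} [NormedAddCommGroup F] [NormedSpace ℝ F] (j : Fin N) (i : ℕ)
    (g : (Fin N → ℝ) → F) : multiDeriv (Pi.single j i) g = (partialDeriv j)^[i] g := by
  have key : ∀ l : List (Fin N), l.Nodup →
      l.foldr (fun k h => (partialDeriv k)^[(Pi.single j i : Fin N → ℕ) k] h) g
        = if j ∈ l then (partialDeriv j)^[i] g else g := by
    intro l hl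
    induction l with
    | nil => simp
    | cons k l ih =>
      rw [List.nodup_cons] at hl
      rw [List.foldr_cons, ih hl.2]
      by_cases hk : j = k
      · subst hk
        simp [hl.1]
      · simp [Pi.single_eq_of_ne (Ne.symm hk), hk]
  rw [multiDeriv, key _ (List.nodup_finRange N), if_pos (List.mem_finRange j)]

theorem weakDeriv_spec {E : Type*} [NormedAddCommGroup E] [NormedSpace ℝ E]
    {U : Set (Fin N → ℝ)} {α : Fin N → ℕ} {f : (Fin N → ℝ) → E} (h : ∃ g, IsWeakDeriv U α f g) :
    IsWeakDeriv U α f (weakDeriv U α f) := by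
  rw [weakDeriv, dif_pos h]
  exact h.choose_spec

/-- Testing the derivative of order `i` with `∂_j φ` and that of order `i + 1` with `φ` produces the
same integral of `f`, with opposite signs. -/
theorem IsWeakDeriv.weakPartial {E : Type*} [NormedAddCommGroup E] [NormedSpace ℝ E]
    {U : Set (Fin N → ℝ)} {j : Fin N} {i : ℕ} {f g g' : (Fin N → ℝ) → E}
    (h : IsWeakDeriv U (Pi.single j i) f g) (h' : IsWeakDeriv U (Pi.single j (i + 1)) f g') :
    WeakPartial U j g g' := by
  refine ⟨h.2.1, h'.2.1, fun φ hφ hc hs => ?_⟩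
  have hsub : Function.support (partialDeriv j φ) ⊆ tsupport φ := fun z hz =>
    support_fderiv_subset ℝ (fun h0 => hz (by rw [partialDeriv, h0]; rfl))
  have e1 := h.2.2 (partialDeriv j φ)
    ((hφ.fderiv_right (m := ∞) (by simp)).clm_apply contDiff_const)
    (HasCompactSupport.of_support_subset_isCompact hc hsub)
    ((closure_minimal hsub isClosed_closure).trans hs)
  have e2 := h'.2.2 φ hφ hc hs
  rw [multiDeriv_single] at e1 e2
  rw [Function.iterate_succ_apply] at e2
  simp only [Finset.sum_pi_single', Finset.mem_univ, if_true] at e1 e2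
  rw [e2, pow_succ, mul_smul, ← sub_eq_zero, ← smul_sub] at e1
  have := (smul_eq_zero.1 e1).resolve_left (pow_ne_zero _ (by norm_num))
  rw [sub_eq_zero] at this
  rw [← this, neg_one_smul]

/-- Only pure derivatives along the axes are kept, since the approximation argument works in one
coordinate at a time. The representative is the chosen weak derivative of order zero, which starts
the recursion in every coordinate and agrees with `f` by the fundamental lemma of the calculus of
variations. -/
theorem exists_weightedReg_of_memSobolev [CompleteSpace H] {d : Fin N → CompLaw}
    {μ : Measure (Fin N → ℝ)} (hμ : IsJointLaw d μ) {m : ℕ} {f : Lp H 2 μ}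
    (hf : MemSobolev d μ m f) :
    ∃ g : (Fin N → ℝ) → H, f =ᵐ[μ] g ∧
      ∀ j, WeightedReg d μ j m 0 g (ENNReal.ofReal (sobolevNorm d μ m f)) := by
  have hsum : ∀ (j : Fin N) i, ∑ k, (Pi.single j i : Fin N → ℕ) k = i := by
    intro j i
    simp
  refine ⟨weakDeriv (box d) 0 f, ?_, fun j => ?_⟩
  · have h0 := weakDeriv_spec (hf 0 (by simp)).1
    have h1 := IsOpen.ae_eq_zero_of_integral_contDiff_smul_eq_zero (isOpen_box d)
      (h0.1.sub h0.2.1) (μ := volume) fun φ hφ hc hs => ?_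
    · have h2 : ∀ᵐ z ∂volume.restrict (box d), f z = weakDeriv (box d) 0 f z := by
        rw [ae_restrict_iff' (isOpen_box d).measurableSet]
        filter_upwards [h1] with z hz hzb
        exact sub_eq_zero.1 (hz hzb)
      exact hμ.absolutelyContinuous.ae_le h2
    · have e := h0.2.2 φ hφ hc hs
      have hm : multiDeriv (0 : Fin N → ℕ) φ = φ := by
        rw [multiDeriv]
        simp
      rw [hm] at e
      simp only [Pi.zero_apply, Finset.sum_const_zero, pow_zero, one_smul] at e
      have hφ0 : ∀ z, z ∉ tsupport φ → φ z = 0 := fun z hz => image_eq_zero_of_notMem_tsupport hz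
      simp only [Pi.sub_apply, smul_sub]
      rw [integral_sub (integrable_smul_of_compact (𝕜 := ℝ) h0.1 hc hs hφ.continuous hφ0)
        (integrable_smul_of_compact (𝕜 := ℝ) h0.2.1 hc hs hφ.continuous hφ0), e, sub_self]
  · have key : ∀ k i, i + k ≤ m → WeightedReg d μ j k i (weakDeriv (box d) (Pi.single j i) f)
        (ENNReal.ofReal (sobolevNorm d μ m f)) := by
      have hbase : ∀ i, i ≤ m → AEStronglyMeasurable (weakDeriv (box d) (Pi.single j i) f) μ ∧
          eLpNorm (fun z => sqrtRho d j z ^ i • weakDeriv (box d) (Pi.single j i) f z) 2 μ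
            ≤ ENNReal.ofReal (sobolevNorm d μ m f) := by
        intro i hi
        obtain ⟨hex, hL⟩ := hf (Pi.single j i) (by rw [hsum]; exact hi)
        have h0 := weakDeriv_spec hex
        refine ⟨h0.2.1.aestronglyMeasurable.mono_ac hμ.absolutelyContinuous, ?_⟩
        have e : eLpNorm (fun z => sqrtRho d j z ^ i • weakDeriv (box d) (Pi.single j i) f z) 2 μ
            = eLpNorm (fun z => weight d (Pi.single j i) z •
              weakDeriv (box d) (Pi.single j i) f z) 2 μ := by
          refine eLpNorm_congr_ae ?_
          filter_upwards [hμ.ae_mem_box] with z hz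
          rw [weight_single j i hz]
        rw [e, ← ENNReal.ofReal_toReal hL.2.ne]
        refine ENNReal.ofReal_le_ofReal (Real.le_sqrt_of_sq_le ?_)
        exact Finset.single_le_sum (f := fun α => (eLpNorm (fun z => weight d α z •
          weakDeriv (box d) α f z) 2 μ).toReal ^ 2) (fun _ _ => sq_nonneg _)
          (mem_multiIdx.2 (by rw [hsum]; exact hi))
      intro k
      induction k with
      | zero => exact fun i hi => hbase i hi
      | succ k ih =>
        intro i hi
        refine ⟨hbase i (by omega), _, ?_, ih (i + 1) (by omega)⟩
        exact (weakDeriv_spec (hf _ (by rw [hsum]; omega)).1).weakPartial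
          (weakDeriv_spec (hf _ (by rw [hsum]; omega)).1)
    have := key m 0 (by omega)
    rwa [Pi.single_zero] at this

end WeightedRegularity

/-! ### Cutoff functions on the box and integration by parts -/

section Cutoff

open Filter Topology

/-- The bound on `t Θ' t` is invariant under dilations, so it holds with the same constant for every
rescaling of the cutoff. -/
theorem exists_cutoff : ∃ (Θ Θ' : ℝ → ℝ) (C : ℝ), (∀ t, HasDerivAt Θ (Θ' t) t) ∧
    Continuous Θ' ∧ (∀ t, |Θ t| ≤ 1) ∧ (∀ t, t < 1 → Θ t = 1 ∧ Θ' t = 0) ∧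
    (∀ t, 2 < t → Θ t = 0 ∧ Θ' t = 0) ∧ ∀ t, |t * Θ' t| ≤ C := by
  set Θ : ℝ → ℝ := fun t => Real.smoothTransition (2 - t) with hΘ
  have hc : ContDiff ℝ 1 Θ := Real.smoothTransition.contDiff.comp (contDiff_const.sub contDiff_id)
  have hd : Continuous (deriv Θ) := hc.continuous_deriv le_rfl
  have h1 : ∀ t, t < 1 → Θ t = 1 ∧ deriv Θ t = 0 := by
    intro t ht
    refine ⟨Real.smoothTransition.one_of_one_le (by linarith), ?_⟩
    have : Θ =ᶠ[𝓝 t] fun _ => 1 := by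
      filter_upwards [Iio_mem_nhds ht] with s hs
      exact Real.smoothTransition.one_of_one_le (by rw [mem_Iio] at hs; linarith)
    rw [this.deriv_eq, deriv_const]
  have h2 : ∀ t, 2 < t → Θ t = 0 ∧ deriv Θ t = 0 := by
    intro t ht
    refine ⟨Real.smoothTransition.zero_of_nonpos (by linarith), ?_⟩
    have : Θ =ᶠ[𝓝 t] fun _ => 0 := by
      filter_upwards [Ioi_mem_nhds ht] with s hs
      exact Real.smoothTransition.zero_of_nonpos (by rw [mem_Ioi] at hs; linarith)
    rw [this.deriv_eq, deriv_const]
  have hcs : HasCompactSupport fun t => t * deriv Θ t := by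
    refine HasCompactSupport.intro (isCompact_Icc (a := (1 : ℝ)) (b := 2)) fun t ht => ?_
    rw [mem_Icc, not_and_or, not_le, not_le] at ht
    rcases ht with h | h
    · rw [(h1 t h).2, mul_zero]
    · rw [(h2 t h).2, mul_zero]
  obtain ⟨C, hC⟩ := hcs.exists_bound_of_continuous (continuous_id.mul hd)
  refine ⟨Θ, deriv Θ, C, fun t => (hc.differentiable (by norm_num) t).hasDerivAt, hd, fun t => ?_,
    h1, h2, hC⟩
  rw [abs_of_nonneg (Real.smoothTransition.nonneg _)]
  exact Real.smoothTransition.le_one _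

variable {N : ℕ}

theorem hasLineDerivAt_coord {g : ℝ → ℝ} {g' : ℝ} {j : Fin N} {z : Fin N → ℝ}
    (hg : HasDerivAt g g' (z j)) :
    HasLineDerivAt ℝ (fun y : Fin N → ℝ => g (y j)) g' z (Pi.single j 1) := by
  have h1 : HasDerivAt (fun t : ℝ => z j + t) 1 0 := (hasDerivAt_id (0 : ℝ)).const_add (z j)
  have h2 : HasDerivAt g g' (z j + 0) := by rwa [add_zero]
  have h3 := HasDerivAt.comp (0 : ℝ) h2 h1
  rw [mul_one] at h3
  refine h3.congr_of_eventuallyEq (Eventually.of_forall fun t => ?_)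
  simp

theorem hasLineDerivAt_const_along {F : Type*} [NormedAddCommGroup F] [NormedSpace ℝ F]
    {R : (Fin N → ℝ) → F} {j : Fin N} {z : Fin N → ℝ}
    (hR : ∀ t : ℝ, R (z + t • Pi.single j 1) = R z) :
    HasLineDerivAt ℝ R 0 z (Pi.single j 1) :=
  (hasDerivAt_const (0 : ℝ) (R z)).congr_of_eventuallyEq (Eventually.of_forall hR)

theorem hasLineDerivAt_mul {f g : (Fin N → ℝ) → ℝ} {f' g' : ℝ} {z v : Fin N → ℝ}
    (hf : HasLineDerivAt ℝ f f' z v) (hg : HasLineDerivAt ℝ g g' z v) :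
    HasLineDerivAt ℝ (fun y => f y * g y) (f' * g z + f z * g') z v := by
  have := HasDerivAt.mul hf hg
  simp only [zero_smul, add_zero] at this
  exact this

theorem line_coord_of_ne {j k : Fin N} (hk : k ≠ j) (z : Fin N → ℝ) (t : ℝ) :
    (z + t • (Pi.single j 1 : Fin N → ℝ)) k = z k := by
  simp [Pi.single_eq_of_ne hk]

theorem CompLaw.hasDerivAt_barrier (c : CompLaw) {x : ℝ} (hx : x ∈ c.interval) :
    HasDerivAt (fun x => x ^ 2 + (c.sig x)⁻¹) (2 * x - c.sig' x / c.sig x ^ 2) x := by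
  have h0 := ((c.mem_interval x).1 hx).ne'
  refine ((hasDerivAt_pow 2 x).add ((c.hasDerivAt_sig x).inv h0)).congr_deriv ?_
  push_cast
  ring

/-- The function `x² + 1 / σ` blows up at both ends of the interval, but slowly in terms of `σ
d/dx`: the inequality rests on `|σ'| ≤ 2` and `|2 x σ| ≤ 2 x² + 2 / σ`. -/
theorem CompLaw.barrier_bound (c : CompLaw) {x : ℝ} (hx : x ∈ c.interval) :
    |c.sig x * (2 * x - c.sig' x / c.sig x ^ 2)| ≤ 4 * (x ^ 2 + (c.sig x)⁻¹) := by
  have h0 := (c.mem_interval x).1 hx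
  have e : c.sig x * (2 * x - c.sig' x / c.sig x ^ 2)
      = 2 * x * c.sig x - c.sig' x * (c.sig x)⁻¹ := by
    field_simp
  have hi : 0 < (c.sig x)⁻¹ := inv_pos.2 h0
  have him : c.sig x * (c.sig x)⁻¹ = 1 := mul_inv_cancel₀ h0.ne'
  rw [e]
  set w := (c.sig x)⁻¹ with hw
  have key : |c.sig' x| ≤ 2 ∧ |2 * x * c.sig x| ≤ 2 * x ^ 2 + 2 * w := by
    cases c with
    | normal =>
      simp only [sig, sig', sigmaPoly, Polynomial.eval_one, Polynomial.derivative_one,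
        Polynomial.eval_zero, one_mul, mul_one] at him ⊢
      rw [him]
      refine ⟨by norm_num, abs_le.2 ⟨?_, ?_⟩⟩ <;> nlinarith [sq_nonneg (x + 1), sq_nonneg (x - 1)]
    | gamma α =>
      simp only [sig, sig', sigmaPoly, Polynomial.eval_X, Polynomial.derivative_X,
        Polynomial.eval_one] at him hi ⊢
      refine ⟨by norm_num, abs_le.2 ⟨?_, ?_⟩⟩ <;> nlinarith [sq_nonneg x]
    | beta α β =>
      simp only [interval, mem_Ioo] at hx
      have hs : (beta α β).sig x = 1 - x ^ 2 := by simp [sig, sigmaPoly]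
      have hs' : (beta α β).sig' x = -(2 * x) := by
        simp [sig', sigmaPoly, one_add_one_eq_two]
      rw [hs] at him h0
      rw [hs, hs']
      have hw1 : 1 ≤ w := by nlinarith [sq_nonneg x]
      refine ⟨by rw [abs_neg, abs_le]; constructor <;> linarith [hx.1, hx.2], abs_le.2 ⟨?_, ?_⟩⟩
      · nlinarith [sq_nonneg x]
      · nlinarith [sq_nonneg x]
  calc |2 * x * c.sig x - c.sig' x * w| ≤ |2 * x * c.sig x| + |c.sig' x * w| := abs_sub _ _
    _ ≤ (2 * x ^ 2 + 2 * w) + 2 * w := by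
        refine add_le_add key.2 ?_
        rw [abs_mul, abs_of_pos hi]
        exact mul_le_mul_of_nonneg_right key.1 hi.le
    _ ≤ _ := by nlinarith [sq_nonneg x]

/-- The cutoffs are `Θ(Φ / (n + 1))`, where `Φ` is the sum of the one-dimensional barriers. By the
barrier bound, `|σ χ'|` is at most `4 |t Θ'(t)|` at `t = Φ / (n + 1)`, uniformly in `n`; at a fixed
point the cutoff is eventually constant. -/
theorem exists_box_cutoff (d : Fin N → CompLaw) (j : Fin N) :
    ∃ (χ χ' : ℕ → (Fin N → ℝ) → ℝ) (C : ℝ),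
      (∀ n, ∃ K, IsCompact K ∧ K ⊆ box d ∧ ∀ z ∈ box d, z ∉ K → χ n z = 0 ∧ χ' n z = 0) ∧
      (∀ n, ContinuousOn (χ n) (box d)) ∧ (∀ n, ContinuousOn (χ' n) (box d)) ∧
      (∀ n, ∀ z ∈ box d, HasLineDerivAt ℝ (χ n) (χ' n z) z (Pi.single j 1)) ∧
      (∀ n z, |χ n z| ≤ 1) ∧ (∀ n, ∀ z ∈ box d, |(d j).sig (z j) * χ' n z| ≤ C) ∧
      ∀ z ∈ box d, Tendsto (fun n => χ n z) atTop (𝓝 1) ∧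
        Tendsto (fun n => χ' n z) atTop (𝓝 0) := by
  obtain ⟨Θ, Θ', C, hΘ, hΘc, hΘ1, hΘl, hΘr, hC⟩ := exists_cutoff
  set h : Fin N → ℝ → ℝ := fun k x => x ^ 2 + ((d k).sig x)⁻¹ with hh
  set h' : ℝ → ℝ := fun x => 2 * x - (d j).sig' x / (d j).sig x ^ 2 with hh'
  set Φ : (Fin N → ℝ) → ℝ := fun z => ∑ k, h k (z k) with hΦ
  have hpos : ∀ z ∈ box d, ∀ k, 0 < (d k).sig (z k) := fun z hz k => ((d k).mem_interval _).1 (hz k)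
  have hhn : ∀ z ∈ box d, ∀ k, 0 ≤ h k (z k) := fun z hz k => by
    have := hpos z hz k
    simp only [hh]
    positivity
  have hle : ∀ z ∈ box d, ∀ k, h k (z k) ≤ Φ z := fun z hz k =>
    Finset.single_le_sum (f := fun k => h k (z k)) (fun i _ => hhn z hz i) (Finset.mem_univ k)
  have hΦc : ContinuousOn Φ (box d) := by
    refine continuousOn_finsetSum _ fun k _ => ?_
    have h1 : Continuous fun z : Fin N → ℝ => (d k).sig (z k) :=
      (d k).continuous_sig.comp (continuous_apply k)
    exact ((continuous_apply k).pow 2).continuousOn.add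
      (h1.continuousOn.inv₀ fun z hz => (hpos z hz k).ne')
  have hh'c : ContinuousOn (fun z : Fin N → ℝ => h' (z j)) (box d) := by
    have h1 : Continuous fun z : Fin N → ℝ => (d j).sig (z j) :=
      (d j).continuous_sig.comp (continuous_apply j)
    have h2 : Continuous fun z : Fin N → ℝ => (d j).sig' (z j) :=
      (d j).continuous_sig'.comp (continuous_apply j)
    exact (continuous_const.mul (continuous_apply j)).continuousOn.sub
      (h2.continuousOn.div (h1.pow 2).continuousOn fun z hz => pow_ne_zero _ (hpos z hz j).ne')
  have hΦd : ∀ z ∈ box d, HasLineDerivAt ℝ Φ (h' (z j)) z (Pi.single j 1) := by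
    intro z hz
    have h1 : HasLineDerivAt ℝ (fun y : Fin N → ℝ => h j (y j)) (h' (z j)) z (Pi.single j 1) :=
      hasLineDerivAt_coord ((d j).hasDerivAt_barrier (hz j))
    have h2 : HasLineDerivAt ℝ (fun y : Fin N → ℝ => ∑ k ∈ Finset.univ.erase j, h k (y k)) 0 z
        (Pi.single j 1) :=
      hasLineDerivAt_const_along fun t => Finset.sum_congr rfl fun k hk => by
        rw [line_coord_of_ne (Finset.ne_of_mem_erase hk)]
    have h3 := HasDerivAt.add h1 h2
    rw [add_zero] at h3
    refine h3.congr_of_eventuallyEq (Eventually.of_forall fun t => ?_)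
    exact (Finset.add_sum_erase _ (fun k => h k ((z + t • (Pi.single j 1 : Fin N → ℝ)) k))
      (Finset.mem_univ j)).symm
  have hnp : ∀ n : ℕ, (0 : ℝ) < n + 1 := fun n => by positivity
  have hlim : ∀ z, ∀ᶠ n : ℕ in atTop, Φ z / (n + 1) < 1 := by
    intro z
    obtain ⟨m, hm⟩ := exists_nat_gt (Φ z)
    filter_upwards [eventually_ge_atTop m] with n hn
    rw [div_lt_one (hnp n)]
    have : (m : ℝ) ≤ n := by exact_mod_cast hn
    linarith
  refine ⟨fun n z => Θ (Φ z / (n + 1)), fun n z => Θ' (Φ z / (n + 1)) * (h' (z j) / (n + 1)),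
    4 * C, fun n => ?_, fun n => ?_, fun n => ?_, fun n z hz => ?_, fun n z => hΘ1 _,
    fun n z hz => ?_, fun z hz => ⟨?_, ?_⟩⟩
  -- Inside the box this set contains the sublevel set `Φ ≤ 2 (n + 1)`. Multiplying out `1 / σ`
  -- makes it closed in the whole space and forces `σ > 0` on it.
  · refine ⟨{z | ∀ k, z k ^ 2 ≤ 2 * (n + 1) ∧ 1 ≤ 2 * (n + 1) * (d k).sig (z k)}, ?_, ?_, ?_⟩
    · refine Metric.isCompact_of_isClosed_isBounded ?_ ?_
      · have : {z : Fin N → ℝ | ∀ k, z k ^ 2 ≤ 2 * (n + 1) ∧ 1 ≤ 2 * (n + 1) * (d k).sig (z k)}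
            = ⋂ k, {z | z k ^ 2 ≤ 2 * ((n : ℝ) + 1) ∧
              1 ≤ 2 * ((n : ℝ) + 1) * (d k).sig (z k)} := by
          ext z
          simp
        rw [this]
        refine isClosed_iInter fun k => ?_
        exact (isClosed_le ((continuous_apply k).pow 2) continuous_const).inter
          (isClosed_le continuous_const (continuous_const.mul
            ((d k).continuous_sig.comp (continuous_apply k))))
      · refine (Metric.isBounded_iff_subset_closedBall 0).2 ⟨2 * (n + 1), fun z hz => ?_⟩
        rw [mem_closedBall_zero_iff, pi_norm_le_iff_of_nonneg (by positivity)]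
        intro k
        have h1 := (hz k).1
        have h2 : (0 : ℝ) ≤ n := Nat.cast_nonneg n
        rw [Real.norm_eq_abs]
        exact abs_le_of_sq_le_sq (by nlinarith) (by positivity)
    · intro z hz k
      rw [CompLaw.mem_interval]
      have h1 := (hz k).2
      by_contra h2
      push Not at h2
      have := mul_nonpos_of_nonneg_of_nonpos (mul_nonneg zero_le_two (hnp n).le) h2
      linarith
    · intro z hz hzK
      have h2 : 2 < Φ z / (n + 1) := by
        rw [lt_div_iff₀ (hnp n)]
        simp only [mem_ofPred_eq, not_forall, not_and_or, not_le] at hzK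
        obtain ⟨k, hk⟩ := hzK
        have hσ := hpos z hz k
        have h3 := hle z hz k
        have h4 : h k (z k) = z k ^ 2 + ((d k).sig (z k))⁻¹ := rfl
        rcases hk with hk | hk
        · have : 0 < ((d k).sig (z k))⁻¹ := inv_pos.2 hσ
          linarith
        · have : 2 * ((n : ℝ) + 1) < ((d k).sig (z k))⁻¹ := by
            rw [lt_inv_comm₀ (by have := hnp n; positivity) hσ, inv_eq_one_div,
              lt_div_iff₀ (by have := hnp n; positivity)]
            linarith
          nlinarith [sq_nonneg (z k)]
      exact ⟨(hΘr _ h2).1, by simp only [(hΘr _ h2).2, zero_mul]⟩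
  · exact (continuous_iff_continuousAt.2 fun t => (hΘ t).continuousAt).comp_continuousOn
      (hΦc.div_const _)
  · exact (hΘc.comp_continuousOn (hΦc.div_const _)).mul (hh'c.div_const _)
  · have h1 : HasDerivAt (fun t : ℝ => Φ (z + t • Pi.single j 1) / (n + 1))
        (h' (z j) / (n + 1)) 0 := HasDerivAt.div_const (hΦd z hz) _
    have h2 : HasDerivAt Θ (Θ' (Φ z / (n + 1)))
        (Φ (z + (0 : ℝ) • Pi.single j 1) / (n + 1)) := by
      rw [zero_smul, add_zero]
      exact hΘ _
    exact HasDerivAt.comp (0 : ℝ) h2 h1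
  · have e : (d j).sig (z j) * (Θ' (Φ z / (n + 1)) * (h' (z j) / (n + 1)))
        = Θ' (Φ z / (n + 1)) * ((d j).sig (z j) * h' (z j)) / (n + 1) := by ring
    have h1 : |(d j).sig (z j) * h' (z j)| ≤ 4 * Φ z :=
      ((d j).barrier_bound (hz j)).trans (mul_le_mul_of_nonneg_left (hle z hz j) (by norm_num))
    have h2 := hC (Φ z / (n + 1))
    have h0 : 0 ≤ Φ z := (hhn z hz j).trans (hle z hz j)
    simp only
    rw [e, abs_div, abs_mul, abs_of_pos (hnp n), div_le_iff₀ (hnp n)]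
    rw [abs_mul, abs_of_nonneg (div_nonneg h0 (hnp n).le), div_mul_eq_mul_div,
      div_le_iff₀ (hnp n)] at h2
    nlinarith [mul_le_mul_of_nonneg_left h1 (abs_nonneg (Θ' (Φ z / (n + 1))))]
  · refine tendsto_const_nhds.congr' ?_
    filter_upwards [hlim z] with n hn
    exact (hΘl _ hn).1.symm
  · refine tendsto_const_nhds.congr' ?_
    filter_upwards [hlim z] with n hn
    rw [(hΘl _ hn).2, zero_mul]

/-- By Pearson's equation the derivative of `w σ^(i+1)` is `w σ^i (τ + i σ')`, so the left integrand
comes from differentiating `w σ^(i+1) G`. After cutting off, the additional term carries `σ χ'`,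
which is bounded and tends to zero pointwise, so no boundary terms survive. -/
theorem integral_byParts {d : Fin N → CompLaw} {μ : Measure (Fin N → ℝ)} (hμ : IsJointLaw d μ)
    {E : Type*} [NormedAddCommGroup E] [NormedSpace ℝ E] {j : Fin N} (i : ℕ)
    {G G' : (Fin N → ℝ) → ℝ} (hG : Continuous G) (hG' : Continuous G')
    (hd : ∀ z, HasLineDerivAt ℝ G (G' z) z (Pi.single j 1)) {y y' : (Fin N → ℝ) → E}
    (hy : WeakPartial (box d) j y y')
    (h1 : Integrable (fun z => ((d j).sig (z j) ^ i * ((d j).sig (z j) * G' z +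
      ((d j).tau (z j) + i * (d j).sig' (z j)) * G z)) • y z) μ)
    (h2 : Integrable (fun z => ((d j).sig (z j) ^ i * G z) • y z) μ)
    (h3 : Integrable (fun z => ((d j).sig (z j) ^ (i + 1) * G z) • y' z) μ) :
    ∫ z, ((d j).sig (z j) ^ i * ((d j).sig (z j) * G' z +
      ((d j).tau (z j) + i * (d j).sig' (z j)) * G z)) • y z ∂μ
      = -∫ z, ((d j).sig (z j) ^ (i + 1) * G z) • y' z ∂μ := by
  obtain ⟨χ, χ', C, hK, hχc, hχc', hχd, hχ1, hχC, hχl⟩ := exists_box_cutoff d j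
  set s : (Fin N → ℝ) → ℝ := fun z => (d j).sig (z j) with hs
  have hsc : Continuous s := (d j).continuous_sig.comp (continuous_apply j)
  have hpos : ∀ z ∈ box d, 0 < s z := fun z hz => ((d j).mem_interval _).1 (hz j)
  set T : (Fin N → ℝ) → ℝ := fun z => (d j).tau (z j) + i * (d j).sig' (z j) with hT
  have hTc : Continuous T := ((d j).continuous_tau.comp (continuous_apply j)).add
    (continuous_const.mul ((d j).continuous_sig'.comp (continuous_apply j)))
  have hbd : ContinuousOn (boxDens d) (box d) := continuousOn_boxDens
  have hwd : ∀ z ∈ box d, HasLineDerivAt ℝ (fun z => boxDens d z * s z ^ (i + 1))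
      (boxDens d z * s z ^ i * T z) z (Pi.single j 1) := by
    intro z hz
    have e1 : HasLineDerivAt ℝ (boxDens d)
        (((d j).tau (z j) - (d j).sig' (z j)) / s z * boxDens d z) z (Pi.single j 1) := by
      have a1 := hasLineDerivAt_coord ((d j).hasDerivAt_dens (hz j))
      have a2 : HasLineDerivAt ℝ
          (fun y : Fin N → ℝ => ∏ k ∈ Finset.univ.erase j, (d k).dens (y k)) 0 z
          (Pi.single j 1) :=
        hasLineDerivAt_const_along fun t => Finset.prod_congr rfl fun k hk => by
          rw [line_coord_of_ne (Finset.ne_of_mem_erase hk)]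
      have a3 := hasLineDerivAt_mul a1 a2
      have e : boxDens d = fun y : Fin N → ℝ =>
          (d j).dens (y j) * ∏ k ∈ Finset.univ.erase j, (d k).dens (y k) := by
        funext y
        exact (Finset.mul_prod_erase _ (fun k => (d k).dens (y k)) (Finset.mem_univ j)).symm
      rw [e]
      refine HasDerivAt.congr_deriv a3 ?_
      simp only [hs]
      ring
    have e2 : HasLineDerivAt ℝ (fun z => s z ^ (i + 1))
        (((i + 1 : ℕ) : ℝ) * s z ^ i * (d j).sig' (z j)) z (Pi.single j 1) :=
      hasLineDerivAt_coord (g := fun x => (d j).sig x ^ (i + 1))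
        (((d j).hasDerivAt_sig (z j)).pow (i + 1))
    refine HasDerivAt.congr_deriv (hasLineDerivAt_mul e1 e2) ?_
    have := (hpos z hz).ne'
    simp only [hT]
    push_cast
    field_simp
    ring
  let ψ : ℕ → (Fin N → ℝ) → ℝ := fun n =>
    (box d).indicator fun z => χ n z * (boxDens d z * s z ^ (i + 1) * G z)
  let ψ' : ℕ → (Fin N → ℝ) → ℝ := fun n => (box d).indicator fun z =>
    χ' n z * (boxDens d z * s z ^ (i + 1) * G z)
      + χ n z * (boxDens d z * (s z ^ i * (s z * G' z + T z * G z)))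
  have hψ : ∀ n, TestPair (box d) j (ψ n) (ψ' n) := by
    intro n
    obtain ⟨K, hKc, hKb, hK0⟩ := hK n
    refine TestPair.of_continuousOn (isOpen_box d) hKc hKb (fun z hz => ?_) (fun z hz => ?_) ?_ ?_
      fun z hz => ?_
    · by_cases hzb : z ∈ box d
      · simp [ψ, hzb, hK0 z hzb hz]
      · simp [ψ, hzb]
    · by_cases hzb : z ∈ box d
      · simp [ψ', hzb, hK0 z hzb hz]
      · simp [ψ', hzb]
    · refine ContinuousOn.congr ?_ (fun z hz => indicator_of_mem hz _)
      exact (hχc n).mul ((hbd.mul (hsc.pow _).continuousOn).mul hG.continuousOn)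
    · refine ContinuousOn.congr ?_ (fun z hz => indicator_of_mem hz _)
      refine ((hχc' n).mul ((hbd.mul (hsc.pow _).continuousOn).mul hG.continuousOn)).add
        ((hχc n).mul (hbd.mul ?_))
      exact ((hsc.pow i).mul ((hsc.mul hG').add (hTc.mul hG))).continuousOn
    · have a1 := hasLineDerivAt_mul (hχd n z hz) (hasLineDerivAt_mul (hwd z hz) (hd z))
      have hc : ContinuousAt (fun t : ℝ => z + t • (Pi.single j 1 : Fin N → ℝ)) 0 := by fun_prop
      have hmem : box d ∈ 𝓝 (z + (0 : ℝ) • (Pi.single j 1 : Fin N → ℝ)) := by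
        rw [zero_smul, add_zero]
        exact (isOpen_box d).mem_nhds hz
      have a2 := HasDerivAt.congr_of_eventuallyEq
        (f₁ := fun t : ℝ => ψ n (z + t • Pi.single j 1)) a1 (by
          filter_upwards [hc.preimage_mem_nhds hmem] with t ht
          exact indicator_of_mem (mem_preimage.1 ht) _)
      refine HasDerivAt.congr_deriv a2 ?_
      simp only [ψ', indicator_of_mem hz]
      ring
  have hind : ∀ {P : (Fin N → ℝ) → ℝ} {u : (Fin N → ℝ) → E},
      ∫ z, (box d).indicator (fun z => boxDens d z * P z) z • u z = ∫ z, P z • u z ∂μ := by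
    intro P u
    rw [hμ.integral_eq, ← integral_indicator (isOpen_box d).measurableSet]
    refine integral_congr_ae (Eventually.of_forall fun z => ?_)
    by_cases hz : z ∈ box d
    · simp [hz, mul_smul]
    · simp [hz]
  have hmeas : ∀ {f : (Fin N → ℝ) → ℝ}, ContinuousOn f (box d) → AEStronglyMeasurable f μ :=
    fun hf => (hf.aestronglyMeasurable (isOpen_box d).measurableSet).mono_ac
      hμ.absolutelyContinuous
  have hint : ∀ n, ∫ z, ((s z * χ' n z) * (s z ^ i * G z)) • y z ∂μ
      + ∫ z, (χ n z * (s z ^ i * (s z * G' z + T z * G z))) • y z ∂μ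
      = -∫ z, (χ n z * (s z ^ (i + 1) * G z)) • y' z ∂μ := by
    intro n
    have e := hy.test (isOpen_box d) (hψ n)
    have e1 : ψ n = (box d).indicator fun z => boxDens d z * (χ n z * (s z ^ (i + 1) * G z)) := by
      simp only [ψ]
      congr 1
      funext z
      ring
    have e2 : ψ' n = (box d).indicator fun z => boxDens d z * ((s z * χ' n z) * (s z ^ i * G z)
        + χ n z * (s z ^ i * (s z * G' z + T z * G z))) := by
      simp only [ψ']
      congr 1
      funext z
      ring
    rw [e1, e2, hind, hind] at e
    rw [← e, ← integral_add]
    · simp only [add_smul]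
    · simp only [mul_smul (s _ * χ' n _)]
      exact h2.bdd_smul C (hmeas (hsc.continuousOn.mul (hχc' n))) (by
        filter_upwards [hμ.ae_mem_box] with z hz
        exact hχC n z hz)
    · simp only [mul_smul (χ n _)]
      exact h1.bdd_smul 1 (hmeas (hχc n)) (Eventually.of_forall fun z => hχ1 n z)
  have l1 : Tendsto (fun n => ∫ z, ((s z * χ' n z) * (s z ^ i * G z)) • y z ∂μ) atTop (𝓝 0) := by
    have := tendsto_integral_of_dominated_convergence (μ := μ) (f := fun _ => (0 : E))
      (F := fun n z => ((s z * χ' n z) * (s z ^ i * G z)) • y z)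
      (fun z => C * ‖(s z ^ i * G z) • y z‖) (fun n => ?_) (h2.norm.const_mul C) (fun n => ?_) ?_
    · simpa using this
    · simp only [mul_smul (s _ * χ' n _)]
      exact (hmeas (hsc.continuousOn.mul (hχc' n))).smul h2.1
    · filter_upwards [hμ.ae_mem_box] with z hz
      rw [mul_smul, norm_smul]
      exact mul_le_mul_of_nonneg_right (hχC n z hz) (norm_nonneg _)
    · filter_upwards [hμ.ae_mem_box] with z hz
      have := (((hχl z hz).2.const_mul (s z)).mul_const (s z ^ i * G z)).smul_const (y z)
      simpa using this
  have l2 : ∀ {P : (Fin N → ℝ) → ℝ} {u : (Fin N → ℝ) → E}, Integrable (fun z => P z • u z) μ →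
      Tendsto (fun n => ∫ z, (χ n z * P z) • u z ∂μ) atTop (𝓝 (∫ z, P z • u z ∂μ)) := by
    intro P u hP
    refine tendsto_integral_of_dominated_convergence (fun z => ‖P z • u z‖) (fun n => ?_) hP.norm
      (fun n => Eventually.of_forall fun z => ?_) ?_
    · simp only [mul_smul (χ n _)]
      exact (hmeas (hχc n)).smul hP.1
    · rw [mul_smul, norm_smul]
      exact mul_le_of_le_one_left (norm_nonneg _) (hχ1 n z)
    · filter_upwards [hμ.ae_mem_box] with z hz
      have := ((hχl z hz).1.mul_const (P z)).smul_const (u z)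
      simpa using this
  have l3 := l1.add (l2 h1)
  rw [zero_add] at l3
  exact tendsto_nhds_unique l3 (((l2 h3).neg).congr fun n => (hint n).symm)

end Cutoff

/-! ### Eigenpolynomials -/

section Eigen

namespace CompLaw

open Polynomial

/-- The Sturm–Liouville operator of the law on polynomials. -/
def diffOp (c : CompLaw) : ℝ[X] →ₗ[ℝ] ℝ[X] :=
  LinearMap.mulLeft ℝ c.sigmaPoly ∘ₗ derivative ∘ₗ derivative
    + LinearMap.mulLeft ℝ c.tauPoly ∘ₗ derivative

theorem diffOp_apply (c : CompLaw) (p : ℝ[X]) :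
    c.diffOp p = c.sigmaPoly * derivative (derivative p) + c.tauPoly * derivative p := rfl

/-- The eigenvalues of the Sturm–Liouville operator, up to the sign. -/
def eig : CompLaw → ℕ → ℝ
  | normal, k => k
  | gamma _, k => k
  | beta α β, k => k * (k + α + β + 1)

/-- A lower bound for the gaps between the eigenvalues. -/
def gap : CompLaw → ℝ
  | normal => 1
  | gamma _ => 1
  | beta α β => α + β + 2

theorem gap_pos {c : CompLaw} (hc : c.Admissible) : 0 < c.gap := by
  cases c with
  | normal => exact one_pos
  | gamma α => exact one_pos
  | beta α β =>
    have h1 := hc.1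
    have h2 := hc.2
    simp only [gap]
    linarith

/-- In the Beta case the difference is `(k - i)(k + i + α + β + 1)`, and `k + i ≥ 1` once `i < k`.
The eigenvalues grow quadratically there, but a linear bound common to all laws is what the final
rate needs. -/
theorem gap_mul_le {c : CompLaw} (hc : c.Admissible) {i k : ℕ} (hik : i ≤ k) :
    c.gap * ((k : ℝ) - i) ≤ c.eig k - c.eig i := by
  cases c with
  | normal => simp [gap, eig]
  | gamma α => simp [gap, eig]
  | beta α β =>
    simp only [gap, eig]
    rcases hik.eq_or_lt with rfl | h
    · simp
    · have h1 : (i : ℝ) + 1 ≤ k := by exact_mod_cast h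
      have h2 : (0 : ℝ) ≤ i := Nat.cast_nonneg i
      nlinarith

theorem eig_lt {c : CompLaw} (hc : c.Admissible) {i k : ℕ} (hik : i < k) : c.eig i < c.eig k := by
  have h1 := gap_mul_le hc hik.le
  have h2 : (0 : ℝ) < (k : ℝ) - i := sub_pos.2 (by exact_mod_cast hik)
  have := mul_pos (gap_pos hc) h2
  linarith

theorem coeff_X_mul_derivative (p : ℝ[X]) (m : ℕ) : (X * derivative p).coeff m = m * p.coeff m := by
  cases m with
  | zero => simp
  | succ m =>
    rw [coeff_X_mul, coeff_derivative]
    push_cast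
    ring

theorem coeff_X_sq_mul_derivative (p : ℝ[X]) (m : ℕ) :
    (X ^ 2 * derivative (derivative p)).coeff m = m * (m - 1) * p.coeff m := by
  rw [pow_two, mul_assoc]
  cases m with
  | zero => simp
  | succ m =>
    rw [coeff_X_mul, coeff_X_mul_derivative, coeff_derivative]
    push_cast
    ring

/-- In the monomial basis the operator is upper triangular with the negatives of the eigenvalues on
the diagonal: it never raises degrees. The coefficients `A` and `B` do not matter. -/
theorem coeff_diffOp (c : CompLaw) (m : ℕ) : ∃ A B : ℝ, ∀ p : ℝ[X], (c.diffOp p).coeff m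
    = -c.eig m * p.coeff m + A * p.coeff (m + 1) + B * p.coeff (m + 2) := by
  cases c with
  | normal =>
    refine ⟨0, (m + 2) * (m + 1), fun p => ?_⟩
    simp only [diffOp_apply, sigmaPoly, tauPoly, eig, one_mul, neg_mul, coeff_add, coeff_neg,
      coeff_X_mul_derivative, coeff_derivative]
    push_cast
    ring
  | gamma α =>
    refine ⟨m * (m + 1) + (α + 1) * (m + 1), 0, fun p => ?_⟩
    simp only [diffOp_apply, sigmaPoly, tauPoly, eig, sub_mul, coeff_add, coeff_sub, coeff_C_mul,
      coeff_X_mul_derivative, coeff_derivative]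
    ring
  | beta α β =>
    refine ⟨(β - α) * (m + 1), (m + 2) * (m + 1), fun p => ?_⟩
    simp only [diffOp_apply, sigmaPoly, tauPoly, eig, sub_mul, one_mul, mul_assoc, coeff_add,
      coeff_sub, coeff_C_mul, coeff_X_mul_derivative, coeff_X_sq_mul_derivative, coeff_derivative]
    push_cast
    ring

/-- On polynomials of degree below `k`, the shifted operator is triangular with nonzero diagonal,
hence bijective. It maps `X ^ k` into this space since the top coefficient cancels, so a lower order
correction of `X ^ k` lies in its kernel. -/
theorem exists_eigenpoly {c : CompLaw} (hc : c.Admissible) (k : ℕ) :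
    ∃ p : ℝ[X], p.Monic ∧ p.natDegree = k ∧ c.diffOp p = -(c.eig k • p) := by
  let T : ℝ[X] →ₗ[ℝ] ℝ[X] := c.diffOp + c.eig k • LinearMap.id
  have hT : ∀ p m, ∃ A B : ℝ, (T p).coeff m
      = (c.eig k - c.eig m) * p.coeff m + A * p.coeff (m + 1) + B * p.coeff (m + 2) := by
    intro p m
    obtain ⟨A, B, h⟩ := c.coeff_diffOp m
    refine ⟨A, B, ?_⟩
    have : T p = c.diffOp p + c.eig k • p := rfl
    rw [this, coeff_add, h, coeff_smul, smul_eq_mul]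
    ring
  have hmem : ∀ p ∈ degreeLT ℝ k, T p ∈ degreeLT ℝ k := by
    intro p hp
    rw [mem_degreeLT, degree_lt_iff_coeff_zero] at hp ⊢
    intro m hm
    obtain ⟨A, B, h⟩ := hT p m
    rw [h, hp m hm, hp (m + 1) (by omega), hp (m + 2) (by omega)]
    ring
  have hinj : Function.Injective (T.restrict hmem) := by
    rw [← LinearMap.ker_eq_bot, LinearMap.ker_eq_bot']
    rintro ⟨p, hp⟩ h0
    have h1 : T p = 0 := congrArg Subtype.val h0
    by_contra hne
    have hne' : p ≠ 0 := fun h => hne (Subtype.ext h)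
    have hlt : p.natDegree < k := by
      rw [mem_degreeLT] at hp
      exact (natDegree_lt_iff_degree_lt hne').2 hp
    obtain ⟨A, B, h⟩ := hT p p.natDegree
    rw [h1, coeff_zero, coeff_eq_zero_of_natDegree_lt (n := p.natDegree + 1) (by omega),
      coeff_eq_zero_of_natDegree_lt (n := p.natDegree + 2) (by omega)] at h
    have h2 : (c.eig k - c.eig p.natDegree) * p.leadingCoeff = 0 := by
      rw [leadingCoeff]
      linarith
    rcases mul_eq_zero.1 h2 with h3 | h3
    · have := eig_lt hc hlt
      linarith
    · exact hne' (leadingCoeff_eq_zero.1 h3)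
  have : Module.Finite ℝ (degreeLT ℝ k) := Module.Finite.equiv (degreeLTEquiv ℝ k).symm
  have hsurj := LinearMap.injective_iff_surjective.1 hinj
  have hX : -T (X ^ k) ∈ degreeLT ℝ k := by
    rw [mem_degreeLT, degree_lt_iff_coeff_zero]
    intro m hm
    obtain ⟨A, B, h⟩ := hT (X ^ k) m
    rw [coeff_neg, h, coeff_X_pow, coeff_X_pow, coeff_X_pow, if_neg (by omega : ¬ m + 1 = k),
      if_neg (by omega : ¬ m + 2 = k)]
    split_ifs with hmk
    · rw [hmk]
      ring
    · ring
  obtain ⟨⟨q, hq⟩, hqT⟩ := hsurj ⟨_, hX⟩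
  have hqT' : T q = -T (X ^ k) := congrArg Subtype.val hqT
  have hqd : q.degree < (k : WithBot ℕ) := mem_degreeLT.1 hq
  have hdeg : (X ^ k + q).degree = (k : WithBot ℕ) := by
    rw [degree_add_eq_left_of_degree_lt (by rwa [degree_X_pow]), degree_X_pow]
  refine ⟨X ^ k + q, monic_X_pow_add hqd, natDegree_eq_of_degree_eq_some hdeg, ?_⟩
  have e : T (X ^ k + q) = 0 := by rw [map_add, hqT', add_neg_cancel]
  exact eq_neg_of_add_eq_zero_left e

open Classical in
/-- The monic eigenpolynomial of degree `k`. -/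
def eigPoly (c : CompLaw) (k : ℕ) : ℝ[X] :=
  if hc : c.Admissible then (exists_eigenpoly hc k).choose else 0

variable {c : CompLaw} (hc : c.Admissible)
include hc

theorem eigPoly_spec (k : ℕ) : (c.eigPoly k).Monic ∧ (c.eigPoly k).natDegree = k ∧
    c.diffOp (c.eigPoly k) = -(c.eig k • c.eigPoly k) := by
  rw [eigPoly, dif_pos hc]
  exact (exists_eigenpoly hc k).choose_spec

theorem span_eigPoly : Submodule.span ℝ (range c.eigPoly) = ⊤ := by
  let S : Polynomial.Sequence ℝ := ⟨c.eigPoly, fun k => by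
    obtain ⟨h1, h2, -⟩ := eigPoly_spec hc k
    rw [degree_eq_natDegree h1.ne_zero, h2]⟩
  exact S.span fun k => by
    have : (S k).leadingCoeff = 1 := (eigPoly_spec hc k).1
    rw [this]
    exact isUnit_one

/-- Each differentiation of the equation replaces `τ` by `τ + σ'` and shifts the eigenvalue, and the
shifts telescope because `τ' + i σ''` equals `eig i - eig (i + 1)`. Derivatives of eigenpolynomials
thus solve equations of the same type. -/
theorem iterate_derivative_eigPoly (k i : ℕ) :
    c.sigmaPoly * derivative^[i + 2] (c.eigPoly k)
      + (c.tauPoly + C (i : ℝ) * derivative c.sigmaPoly) * derivative^[i + 1] (c.eigPoly k)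
      = C (c.eig i - c.eig k) * derivative^[i] (c.eigPoly k) := by
  induction i with
  | zero =>
    have h := (eigPoly_spec hc k).2.2
    rw [diffOp_apply] at h
    have h0 : c.eig 0 = 0 := by cases c <;> simp [eig]
    simp only [Function.iterate_succ_apply', Function.iterate_zero, id, Nat.cast_zero, C_0,
      zero_mul, add_zero, h0, zero_sub, C_neg, neg_mul, ← smul_eq_C_mul]
    exact h
  | succ i ih =>
    have h := congrArg derivative ih
    have hs : derivative (derivative c.sigmaPoly) + derivative c.tauPoly
        + C (i : ℝ) * derivative (derivative c.sigmaPoly)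
        - derivative (derivative c.sigmaPoly) = C (c.eig i - c.eig (i + 1)) := by
      cases c with
      | normal => simp [sigmaPoly, tauPoly, eig]
      | gamma α => simp [sigmaPoly, tauPoly, eig]
      | beta α β =>
        have e : derivative (derivative (beta α β).sigmaPoly) = C (-2) := by
          simp [sigmaPoly, one_add_one_eq_two]
        have e' : derivative (beta α β).tauPoly = C (-(α + β + 2)) := by
          simp [tauPoly]
        rw [e, e', ← C_mul, ← C_add, ← C_add, ← C_sub]
        congr 1
        simp only [eig]
        push_cast
        ring
    simp only [derivative_add, derivative_mul, derivative_C, zero_mul, zero_add,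
      ← Function.iterate_succ_apply' derivative] at h
    have hs' := congrArg (· * derivative^[i + 1] (c.eigPoly k)) hs
    simp only [C_sub] at h hs' ⊢
    push_cast
    simp only [C_add, C_1]
    rw [show i + 1 + 2 = i + 2 + 1 by ring, show i + 1 + 1 = i + 2 by ring] at *
    have n1 : (i + 1).succ = i + 2 := rfl
    have n2 : (i + 2).succ = i + 2 + 1 := rfl
    have n3 : i.succ = i + 1 := rfl
    simp only [n1, n2, n3] at h
    linear_combination h - hs'

end CompLaw

end Eigen

/-! ### Products of eigenpolynomials -/

section ChaosPoly

open Filter Topology Polynomial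
open scoped NNReal

variable {N : ℕ} {d : Fin N → CompLaw} {μ : Measure (Fin N → ℝ)}

/-- The product of the eigenpolynomials with degrees `k`, differentiated `i` times in the `j`-th
coordinate. -/
def chaosPoly (d : Fin N → CompLaw) (j : Fin N) (i : ℕ) (k : Fin N → ℕ) (z : Fin N → ℝ) : ℝ :=
  (derivative^[i] ((d j).eigPoly (k j))).eval (z j) *
    ∏ j' ∈ Finset.univ.erase j, ((d j').eigPoly (k j')).eval (z j')

theorem chaosPoly_zero (j : Fin N) (k : Fin N → ℕ) (z : Fin N → ℝ) :
    chaosPoly d j 0 k z = ∏ j', ((d j').eigPoly (k j')).eval (z j') :=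
  Finset.mul_prod_erase _ (fun j' => ((d j').eigPoly (k j')).eval (z j')) (Finset.mem_univ j)

theorem polyGrowth_chaosPoly (j : Fin N) (i : ℕ) (k : Fin N → ℕ) :
    PolyGrowth (chaosPoly d j i k) :=
  (PolyGrowth.eval_coord _ j).mul
    (PolyGrowth.finset_prod _ fun j' _ => PolyGrowth.eval_coord _ j')

theorem hasLineDerivAt_chaosPoly (j : Fin N) (i : ℕ) (k : Fin N → ℕ) (z : Fin N → ℝ) :
    HasLineDerivAt ℝ (chaosPoly d j i k) (chaosPoly d j (i + 1) k z) z (Pi.single j 1) := by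
  have h1 := hasLineDerivAt_coord
    ((derivative^[i] ((d j).eigPoly (k j))).hasDerivAt (z j))
  have h2 : HasLineDerivAt ℝ (fun y : Fin N → ℝ => ∏ j' ∈ Finset.univ.erase j,
      ((d j').eigPoly (k j')).eval (y j')) 0 z (Pi.single j 1) :=
    hasLineDerivAt_const_along fun t => Finset.prod_congr rfl fun j' hj' => by
      rw [line_coord_of_ne (Finset.ne_of_mem_erase hj')]
  refine HasDerivAt.congr_deriv (hasLineDerivAt_mul h1 h2) ?_
  rw [chaosPoly, Function.iterate_succ_apply', mul_zero, add_zero]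

theorem chaosPoly_ode (hμ : IsJointLaw d μ) (j : Fin N) (i : ℕ) (k : Fin N → ℕ) (z : Fin N → ℝ) :
    (d j).sig (z j) * chaosPoly d j (i + 2) k z
      + ((d j).tau (z j) + i * (d j).sig' (z j)) * chaosPoly d j (i + 1) k z
      = -(((d j).eig (k j) - (d j).eig i) * chaosPoly d j i k z) := by
  have h := congrArg (Polynomial.eval (z j)) (CompLaw.iterate_derivative_eigPoly (hμ.adm j) (k j) i)
  simp only [eval_add, eval_mul, eval_C] at h
  simp only [chaosPoly, CompLaw.sig, CompLaw.tau, CompLaw.sig']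
  linear_combination (∏ j' ∈ Finset.univ.erase j, ((d j').eigPoly (k j')).eval (z j')) * h

theorem polyGrowth_sig (j : Fin N) : PolyGrowth fun z : Fin N → ℝ => (d j).sig (z j) :=
  PolyGrowth.eval_coord _ j

/-- Integrate by parts with the derivative of order `i + 1` as the factor `G`; the differential
equation collapses the integrand on the other side to a multiple of the derivative of order `i`. One
derivative is moved onto `y` at the price of an eigenvalue difference. -/
theorem integral_chaosPoly_step (hμ : IsJointLaw d μ) {E : Type*} [NormedAddCommGroup E]
    [NormedSpace ℝ E] {j : Fin N} {i : ℕ} {y y' : (Fin N → ℝ) → E}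
    (hy : WeakPartial (box d) j y y')
    (h1 : ∀ P, PolyGrowth P → Integrable (fun z => (P z * (d j).sig (z j) ^ i) • y z) μ)
    (h2 : ∀ P, PolyGrowth P → Integrable (fun z => (P z * (d j).sig (z j) ^ (i + 1)) • y' z) μ)
    (k : Fin N → ℕ) :
    ((d j).eig (k j) - (d j).eig i) •
        ∫ z, (chaosPoly d j i k z * (d j).sig (z j) ^ i) • y z ∂μ
      = ∫ z, (chaosPoly d j (i + 1) k z * (d j).sig (z j) ^ (i + 1)) • y' z ∂μ := by
  have e : ∀ z, (d j).sig (z j) ^ i * ((d j).sig (z j) * chaosPoly d j (i + 1 + 1) k z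
      + ((d j).tau (z j) + i * (d j).sig' (z j)) * chaosPoly d j (i + 1) k z)
      = -((d j).eig (k j) - (d j).eig i) * (chaosPoly d j i k z * (d j).sig (z j) ^ i) := by
    intro z
    rw [chaosPoly_ode hμ]
    ring
  have hi := h1 _ (polyGrowth_chaosPoly (d := d) j i k)
  have := integral_byParts hμ i (polyGrowth_chaosPoly j (i + 1) k).1
    (polyGrowth_chaosPoly (d := d) j (i + 1 + 1) k).1 (hasLineDerivAt_chaosPoly j (i + 1) k) hy ?_
    ?_ ?_
  · simp only [e] at this
    simp only [mul_smul (-((d j).eig (k j) - (d j).eig i))] at this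
    rw [integral_smul, neg_smul, neg_inj] at this
    rw [this]
    simp only [mul_comm]
  · simp only [e]
    simp only [mul_smul (-((d j).eig (k j) - (d j).eig i))]
    exact hi.smul (-((d j).eig (k j) - (d j).eig i))
  · simp only [mul_comm ((d j).sig _ ^ i)]
    exact h1 _ (polyGrowth_chaosPoly j (i + 1) k)
  · simp only [mul_comm ((d j).sig _ ^ (i + 1))]
    exact h2 _ (polyGrowth_chaosPoly j (i + 1) k)

theorem WeakPartial.of_hasLineDerivAt {U : Set (Fin N → ℝ)} {j : Fin N} {y y' : (Fin N → ℝ) → ℝ}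
    (hy : Continuous y) (hy' : Continuous y')
    (hd : ∀ z, HasLineDerivAt ℝ y (y' z) z (Pi.single j 1)) : WeakPartial U j y y' := by
  refine ⟨hy.locallyIntegrable.locallyIntegrableOn U, hy'.locallyIntegrable.locallyIntegrableOn U,
    fun φ hφ hc hs => ?_⟩
  have hφ' : Continuous (partialDeriv j φ) :=
    (hφ.continuous_fderiv (by simp)).clm_apply continuous_const
  have hsub : Function.support (partialDeriv j φ) ⊆ tsupport φ := fun z hz =>
    support_fderiv_subset ℝ (fun h0 => hz (by rw [partialDeriv, h0]; rfl))
  have hc' : HasCompactSupport (partialDeriv j φ) :=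
    HasCompactSupport.of_support_subset_isCompact hc hsub
  have := integral_bilinear_hasLineDerivAt_right_eq_neg_left_of_integrable (μ := volume)
    (B := ContinuousLinearMap.mul ℝ ℝ) (f := φ) (f' := partialDeriv j φ) (g := y) (g' := y')
    (v := Pi.single j 1) ?_ ?_ ?_
    (fun z _ => ((hφ.differentiable (by simp)) z).hasFDerivAt.hasLineDerivAt _) (fun z _ => hd z)
  · simp only [ContinuousLinearMap.mul_apply'] at this
    simp only [smul_eq_mul]
    rw [this, neg_neg]
  · exact (hφ'.mul hy).integrable_of_hasCompactSupport hc'.mul_right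
  · exact (hφ.continuous.mul hy').integrable_of_hasCompactSupport hc.mul_right
  · exact (hφ.continuous.mul hy).integrable_of_hasCompactSupport hc.mul_right

/-- Applying the step to a second eigenpolynomial product shows that orthogonality persists under
differentiation, with the weight `σ^i`. This makes Bessel's inequality available for derivatives. -/
theorem integral_chaosPoly_mul_step (hμ : IsJointLaw d μ) (j : Fin N) (i : ℕ)
    (k k' : Fin N → ℕ) :
    ((d j).eig (k j) - (d j).eig i) *
        ∫ z, chaosPoly d j i k z * chaosPoly d j i k' z * (d j).sig (z j) ^ i ∂μ
      = ∫ z, chaosPoly d j (i + 1) k z * chaosPoly d j (i + 1) k' z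
          * (d j).sig (z j) ^ (i + 1) ∂μ := by
  have := integral_chaosPoly_step hμ (i := i) (WeakPartial.of_hasLineDerivAt (U := box d)
    (polyGrowth_chaosPoly j i k').1 (polyGrowth_chaosPoly (d := d) j (i + 1) k').1
    (hasLineDerivAt_chaosPoly j i k'))
    (fun P hP => ((hP.mul ((polyGrowth_sig j).pow i)).mul (polyGrowth_chaosPoly j i k')).integrable
      hμ)
    (fun P hP => ((hP.mul ((polyGrowth_sig j).pow (i + 1))).mul
      (polyGrowth_chaosPoly j (i + 1) k')).integrable hμ) k
  simp only [smul_eq_mul] at this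
  simp only [mul_right_comm _ (chaosPoly d j _ k' _)]
  exact this

theorem integral_chaosPoly_mul (hμ : IsJointLaw d μ) (j : Fin N) (m : ℕ) (k k' : Fin N → ℕ) :
    (∏ i ∈ Finset.range m, ((d j).eig (k j) - (d j).eig i)) *
        ∫ z, chaosPoly d j 0 k z * chaosPoly d j 0 k' z ∂μ
      = ∫ z, chaosPoly d j m k z * chaosPoly d j m k' z * (d j).sig (z j) ^ m ∂μ := by
  induction m with
  | zero => simp
  | succ m ih =>
    rw [Finset.prod_range_succ, mul_comm (∏ i ∈ Finset.range m, _), mul_assoc, ih,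
      integral_chaosPoly_mul_step hμ]

/-- Symmetry of the Sturm–Liouville operator in a coordinate where the degrees differ: the integral
is multiplied by two distinct eigenvalues with the same result. The undifferentiated product does
not depend on the distinguished coordinate, so that coordinate may be chosen freely. -/
theorem integral_chaosPoly_of_ne (hμ : IsJointLaw d μ) (j : Fin N) {k k' : Fin N → ℕ}
    (hk : k ≠ k') : ∫ z, chaosPoly d j 0 k z * chaosPoly d j 0 k' z ∂μ = 0 := by
  obtain ⟨j', hj'⟩ := Function.ne_iff.1 hk
  have e : ∀ k, chaosPoly d j 0 k = chaosPoly d j' 0 k := fun k => by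
    funext z
    rw [chaosPoly_zero, chaosPoly_zero]
  rw [e, e]
  have h1 := integral_chaosPoly_mul_step hμ j' 0 k k'
  have h2 := integral_chaosPoly_mul_step hμ j' 0 k' k
  simp only [mul_comm (chaosPoly d j' _ k' _), pow_zero, mul_one] at h1 h2
  have h3 : ((d j').eig (k j') - (d j').eig (k' j')) *
      ∫ z, chaosPoly d j' 0 k z * chaosPoly d j' 0 k' z ∂μ = 0 := by linarith
  refine (mul_eq_zero.1 h3).resolve_left fun h => ?_
  rcases lt_or_gt_of_ne hj' with h' | h'
  · have := CompLaw.eig_lt (hμ.adm j') h'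
    linarith
  · have := CompLaw.eig_lt (hμ.adm j') h'
    linarith

/-- If the integral vanished, continuity would make the product zero on the whole box. Each factor
has finitely many roots and each interval is infinite, so the factors have a common point of
nonvanishing. -/
theorem integral_chaosPoly_sq_pos (hμ : IsJointLaw d μ) (j : Fin N) (k : Fin N → ℕ) :
    0 < ∫ z, chaosPoly d j 0 k z * chaosPoly d j 0 k z ∂μ := by
  have hi := ((polyGrowth_chaosPoly (d := d) j 0 k).mul
    (polyGrowth_chaosPoly (d := d) j 0 k)).integrable hμ
  have h0 : 0 ≤ ∫ z, chaosPoly d j 0 k z * chaosPoly d j 0 k z ∂μ :=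
    integral_nonneg fun z => mul_self_nonneg _
  refine h0.lt_of_ne fun h => ?_
  rw [eq_comm, integral_eq_zero_iff_of_nonneg (fun z => mul_self_nonneg _) hi] at h
  have h1 : ∀ j', ∃ x ∈ (d j').interval, ((d j').eigPoly (k j')).eval x ≠ 0 := by
    intro j'
    by_contra hne
    push Not at hne
    have hinf : (d j').interval.Infinite := by
      cases d j' with
      | normal => exact infinite_univ
      | gamma α => exact Ioi_infinite 0
      | beta α β => exact Ioo_infinite (by norm_num)
    exact (CompLaw.eigPoly_spec (hμ.adm j') (k j')).1.ne_zero
      (Polynomial.eq_zero_of_infinite_isRoot _ (hinf.mono hne))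
  choose z hz hz' using h1
  have h2 := hμ.dense_of_ae (P := fun z => chaosPoly d j 0 k z = 0) (by
    filter_upwards [h] with z hz
    exact mul_self_eq_zero.1 hz) (z := z) hz
  have h3 : IsClosed {z | chaosPoly d j 0 k z = 0} :=
    isClosed_eq (polyGrowth_chaosPoly j 0 k).1 continuous_const
  have h4 : chaosPoly d j 0 k z = 0 := closure_minimal (fun y hy => hy.2) h3 h2
  rw [chaosPoly_zero] at h4
  exact Finset.prod_ne_zero_iff.2 (fun j' _ => hz' j') h4

end ChaosPoly

/-! ### Approximation by polynomial chaos -/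

section Approximation

open Filter Topology Polynomial
open scoped NNReal

variable {N : ℕ} {d : Fin N → CompLaw} {μ : Measure (Fin N → ℝ)}
  {H : Type*} [NormedAddCommGroup H] [InnerProductSpace ℂ H]

/-- Half-integer powers of `σ` occur in the normalized derivatives, which is why the working class
is polynomial growth and not polynomials. -/
theorem PolyGrowth.sqrt {G : (Fin N → ℝ) → ℝ} (h : PolyGrowth G) :
    PolyGrowth fun z => √(G z) := by
  obtain ⟨hc, C, k, hC, hb⟩ := h
  refine ⟨Real.continuous_sqrt.comp hc, 1 + C, k, by positivity, fun z => ?_⟩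
  rw [abs_of_nonneg (Real.sqrt_nonneg _)]
  have h1 : (1 : ℝ) ≤ (1 + ∑ j, |z j|) ^ k := one_le_pow₀ (one_le_one_add_sum z)
  have h2 := hb z
  refine (Real.sqrt_le_sqrt (le_abs_self _)).trans ?_
  rw [Real.sqrt_le_left (by positivity)]
  nlinarith [abs_nonneg (G z)]

theorem memLp_smul_const {X : Type*} [MeasurableSpace X] {ν : Measure X} {φ : X → ℝ}
    (hφ : MemLp φ 2 ν) (v : H) : MemLp (fun z => φ z • v) 2 ν :=
  (ContinuousLinearMap.toSpanSingleton ℝ v).comp_memLp' hφ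

/-- The elementary tensor `φ ⊗ v` in `L₂(μ; H)`. -/
def tensorLp {X : Type*} [MeasurableSpace X] {ν : Measure X} {φ : X → ℝ}
    (hφ : MemLp φ 2 ν) (v : H) : Lp H 2 ν := (memLp_smul_const hφ v).toLp

theorem coeFn_tensorLp {X : Type*} [MeasurableSpace X] {ν : Measure X} {φ : X → ℝ}
    (hφ : MemLp φ 2 ν) (v : H) : tensorLp hφ v =ᵐ[ν] fun z => φ z • v :=
  (memLp_smul_const hφ v).coeFn_toLp

variable [CompleteSpace H]

theorem inner_tensorLp {X : Type*} [MeasurableSpace X] {ν : Measure X} {φ : X → ℝ}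
    (hφ : MemLp φ 2 ν) (v : H) (f : Lp H 2 ν) :
    inner ℂ (tensorLp hφ v) f = inner ℂ v (∫ z, φ z • f z ∂ν) := by
  rw [L2.inner_def, ← integral_inner (𝕜 := ℂ) (integrable_smul_of_memLp_two hφ (Lp.memLp f))]
  refine integral_congr_ae ?_
  filter_upwards [coeFn_tensorLp hφ v] with z hz
  rw [hz, ← Complex.coe_smul, ← Complex.coe_smul, inner_smul_left, inner_smul_right,
    Complex.conj_ofReal]

theorem integral_smul_tensorLp {X : Type*} [MeasurableSpace X] {ν : Measure X} {φ φ' : X → ℝ}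
    (hφ : MemLp φ 2 ν) (v : H) :
    ∫ z, φ' z • tensorLp hφ v z ∂ν = (∫ z, φ' z * φ z ∂ν) • v := by
  rw [← integral_smul_const]
  refine integral_congr_ae ?_
  filter_upwards [coeFn_tensorLp hφ v] with z hz
  rw [hz, mul_smul]

theorem orthonormal_tensorLp {X κ : Type*} [MeasurableSpace X] {ν : Measure X} {φ : κ → X → ℝ}
    (hφ : ∀ k, MemLp (φ k) 2 ν) (h1 : ∀ k, ∫ z, φ k z * φ k z ∂ν = 1)
    (h0 : ∀ k k', k ≠ k' → ∫ z, φ k z * φ k' z ∂ν = 0) {w : Type*} {b : w → H}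
    (hb : Orthonormal ℂ b) :
    Orthonormal ℂ fun p : κ × w => tensorLp (hφ p.1) (b p.2) := by
  classical
  rw [orthonormal_iff_ite] at hb ⊢
  rintro ⟨k, i⟩ ⟨k', i'⟩
  simp only
  rw [inner_tensorLp, integral_smul_tensorLp, ← Complex.coe_smul, inner_smul_right, hb]
  by_cases hk : k = k'
  · subst hk
    rw [h1]
    by_cases hi : i = i' <;> simp [hi]
  · rw [h0 k k' hk]
    simp [hk]

/-- On the box `P σ^i f` is the product of `P √σ^i` and `√σ^i f`. The first factor has polynomial
growth, and the second is controlled by the weight `ρ` because `σ ≤ ρ`. -/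
theorem WeightedReg.integrable (hμ : IsJointLaw d μ) {j : Fin N} {i : ℕ} {f : (Fin N → ℝ) → H}
    {B : ℝ≥0∞} (hB : B ≠ ⊤)
    (hf : AEStronglyMeasurable f μ ∧ eLpNorm (fun z => sqrtRho d j z ^ i • f z) 2 μ ≤ B) :
    (MemLp (fun z => √((d j).sig (z j)) ^ i • f z) 2 μ ∧
      eLpNorm (fun z => √((d j).sig (z j)) ^ i • f z) 2 μ ≤ B) ∧
    ∀ P, PolyGrowth P → Integrable (fun z => (P z * (d j).sig (z j) ^ i) • f z) μ := by
  have hs := (polyGrowth_sig (d := d) j).sqrt.pow i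
  have hle : eLpNorm (fun z => √((d j).sig (z j)) ^ i • f z) 2 μ ≤ B := by
    refine le_trans (eLpNorm_mono_ae ?_) hf.2
    filter_upwards [hμ.ae_mem_box] with z hz
    rw [norm_smul, norm_smul, norm_pow, norm_pow, Real.norm_of_nonneg (Real.sqrt_nonneg _),
      Real.norm_of_nonneg (sqrtRho_nonneg d j z)]
    gcongr
    exact Real.sqrt_le_sqrt ((d j).sig_le_rho (hz j))
  have hm : MemLp (fun z => √((d j).sig (z j)) ^ i • f z) 2 μ :=
    ⟨hs.1.aestronglyMeasurable.smul hf.1, hle.trans_lt hB.lt_top⟩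
  refine ⟨⟨hm, hle⟩, fun P hP => ?_⟩
  refine (integrable_smul_of_memLp_two ((hP.mul hs).memLp_two hμ) hm).congr ?_
  filter_upwards [hμ.ae_mem_box] with z hz
  rw [smul_smul, mul_assoc, ← mul_pow, Real.mul_self_sqrt (((d j).mem_interval _).1 (hz j)).le]

/-- Iterates the integration by parts; `g` is the last derivative in the chain, and one eigenvalue
difference is collected at each level. -/
theorem WeightedReg.exists_top (hμ : IsJointLaw d μ) {j : Fin N} {m : ℕ} :
    ∀ {i : ℕ} {f : (Fin N → ℝ) → H} {B : ℝ≥0∞}, B ≠ ⊤ → WeightedReg d μ j m i f B →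
      ∃ g, (AEStronglyMeasurable g μ ∧ eLpNorm (fun z => sqrtRho d j z ^ (i + m) • g z) 2 μ ≤ B) ∧
        ∀ k : Fin N → ℕ, (∏ t ∈ Finset.range m, ((d j).eig (k j) - (d j).eig (i + t))) •
          ∫ z, (chaosPoly d j i k z * (d j).sig (z j) ^ i) • f z ∂μ
            = ∫ z, (chaosPoly d j (i + m) k z * (d j).sig (z j) ^ (i + m)) • g z ∂μ := by
  induction m with
  | zero =>
    intro i f B hB hf
    refine ⟨f, hf, fun k => ?_⟩
    rw [Finset.range_zero, Finset.prod_empty, one_smul, add_zero]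
  | succ m ih =>
    rintro i f B hB ⟨hf, f', hf', hff⟩
    obtain ⟨g, hg, hk⟩ := ih hB hff
    have h1 := (WeightedReg.integrable hμ hB hf).2
    have h2 := (WeightedReg.integrable hμ hB hff.base).2
    refine ⟨g, by rwa [show i + (m + 1) = i + 1 + m by ring], fun k => ?_⟩
    rw [show i + (m + 1) = i + 1 + m by ring, ← hk k, ← integral_chaosPoly_step hμ hf' h1 h2,
      Finset.prod_range_succ', smul_smul, add_zero]
    congr 2
    refine Finset.prod_congr rfl fun t _ => ?_
    rw [show i + (t + 1) = i + 1 + t by ring]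

/-- The normalizing factor of the product of eigenpolynomials. -/
def chaosNorm (d : Fin N → CompLaw) (μ : Measure (Fin N → ℝ)) (j : Fin N) (k : Fin N → ℕ) : ℝ :=
  √(∫ z, chaosPoly d j 0 k z * chaosPoly d j 0 k z ∂μ)

theorem chaosPoly_zero_eq (j j' : Fin N) : chaosPoly d j 0 = chaosPoly d j' 0 := by
  funext k z
  rw [chaosPoly_zero, chaosPoly_zero]

theorem chaosNorm_eq (j j' : Fin N) : chaosNorm d μ j = chaosNorm d μ j' := by
  funext k
  rw [chaosNorm, chaosNorm, chaosPoly_zero_eq j j']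

theorem chaosNorm_pos (hμ : IsJointLaw d μ) (j : Fin N) (k : Fin N → ℕ) : 0 < chaosNorm d μ j k :=
  Real.sqrt_pos.2 (integral_chaosPoly_sq_pos hμ j k)

theorem chaosNorm_sq (hμ : IsJointLaw d μ) (j : Fin N) (k : Fin N → ℕ) :
    chaosNorm d μ j k ^ 2 = ∫ z, chaosPoly d j 0 k z * chaosPoly d j 0 k z ∂μ :=
  Real.sq_sqrt (integral_chaosPoly_sq_pos hμ j k).le

/-- The normalized products of eigenpolynomials. -/
def chaosFun (d : Fin N → CompLaw) (μ : Measure (Fin N → ℝ)) (j : Fin N) (k : Fin N → ℕ)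
    (z : Fin N → ℝ) : ℝ := chaosPoly d j 0 k z * (chaosNorm d μ j k)⁻¹

theorem chaosFun_eq (j j' : Fin N) : chaosFun d μ j = chaosFun d μ j' := by
  funext k z
  rw [chaosFun, chaosFun, chaosPoly_zero_eq j j', chaosNorm_eq j j']

theorem memLp_chaosFun (hμ : IsJointLaw d μ) (j : Fin N) (k : Fin N → ℕ) :
    MemLp (chaosFun d μ j k) 2 μ :=
  ((polyGrowth_chaosPoly j 0 k).mul (PolyGrowth.const _)).memLp_two hμ

theorem integral_chaosFun_self (hμ : IsJointLaw d μ) (j : Fin N) (k : Fin N → ℕ) :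
    ∫ z, chaosFun d μ j k z * chaosFun d μ j k z ∂μ = 1 := by
  have h0 := (chaosNorm_pos hμ j k).ne'
  simp only [chaosFun]
  simp only [mul_mul_mul_comm _ (chaosNorm d μ j k)⁻¹]
  rw [integral_mul_const, ← chaosNorm_sq hμ]
  field_simp

theorem integral_chaosFun_of_ne (hμ : IsJointLaw d μ) (j : Fin N) {k k' : Fin N → ℕ}
    (hk : k ≠ k') : ∫ z, chaosFun d μ j k z * chaosFun d μ j k' z ∂μ = 0 := by
  simp only [chaosFun]
  simp only [mul_mul_mul_comm _ (chaosNorm d μ j k)⁻¹]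
  rw [integral_mul_const, integral_chaosPoly_of_ne hμ j hk, zero_mul]

/-- The product of the first `m` differences of eigenvalues. -/
def eigProd (d : Fin N → CompLaw) (j : Fin N) (m : ℕ) (k : Fin N → ℕ) : ℝ :=
  ∏ t ∈ Finset.range m, ((d j).eig (k j) - (d j).eig t)

theorem eigProd_pos (hμ : IsJointLaw d μ) {j : Fin N} {m : ℕ} {k : Fin N → ℕ} (hk : m ≤ k j) :
    0 < eigProd d j m k :=
  Finset.prod_pos fun _ ht => sub_pos.2 (CompLaw.eig_lt (hμ.adm j)
    ((Finset.mem_range.1 ht).trans_le hk))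

/-- The functions `p^(m) σ^(m/2)`, with `p` the eigenpolynomial product and degree at least `m` in
the `j`-th coordinate, are orthogonal with squared norm `eigProd · ‖p‖²`; `c` normalizes them. Their
inner products with `σ^(m/2) ∂_j^m f` are the coefficients of `f` times `√eigProd`. Bessel's
inequality for this system is the claim. -/
theorem sum_coeff_sq_le (hμ : IsJointLaw d μ) {j : Fin N} {m : ℕ} {f : (Fin N → ℝ) → H}
    {B : ℝ≥0∞} (hB : B ≠ ⊤) (hf : WeightedReg d μ j m 0 f B) {w : Type*} {b : w → H}
    (hb : Orthonormal ℂ b) {L : ℝ} (hL : 0 < L) (s : Finset ((Fin N → ℕ) × w))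
    (hs : ∀ p ∈ s, m ≤ p.1 j ∧ L ≤ eigProd d j m p.1) :
    ∑ p ∈ s, ‖(inner ℂ (b p.2) (∫ z, chaosFun d μ j p.1 z • f z ∂μ) : ℂ)‖ ^ 2
      ≤ L⁻¹ * B.toReal ^ 2 := by
  classical
  obtain ⟨g, hg, hk⟩ := WeightedReg.exists_top hμ hB hf
  obtain ⟨⟨hgL, hgB⟩, -⟩ := WeightedReg.integrable hμ hB hg
  simp only [zero_add, pow_zero, mul_one] at hk hgL hgB
  let c : (Fin N → ℕ) → ℝ := fun k => (√(eigProd d j m k) * chaosNorm d μ j k)⁻¹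
  let φ : {k : Fin N → ℕ // m ≤ k j} → (Fin N → ℝ) → ℝ := fun k z =>
    chaosPoly d j m k z * √((d j).sig (z j)) ^ m * c k
  have hφ : ∀ k, MemLp (φ k) 2 μ := fun k =>
    (((polyGrowth_chaosPoly j m _).mul ((polyGrowth_sig j).sqrt.pow m)).mul
      (PolyGrowth.const _)).memLp_two hμ
  have hφφ : ∀ k k', ∫ z, φ k z * φ k' z ∂μ = c k * c k' * (eigProd d j m k *
      ∫ z, chaosPoly d j 0 k z * chaosPoly d j 0 k' z ∂μ) := by
    intro k k'
    rw [eigProd, integral_chaosPoly_mul hμ, ← integral_const_mul]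
    refine integral_congr_ae ?_
    filter_upwards [hμ.ae_mem_box] with z hz
    have h1 := Real.mul_self_sqrt (((d j).mem_interval _).1 (hz j)).le
    simp only [φ]
    nth_rw 3 [← h1]
    rw [mul_pow]
    ring
  have hon := orthonormal_tensorLp hφ (fun k => ?_) (fun k k' hkk => ?_) hb
  rotate_left
  · have h1 := eigProd_pos hμ k.2
    have h2 := chaosNorm_pos hμ j k
    have h3 := Real.sq_sqrt h1.le
    rw [hφφ, ← chaosNorm_sq hμ]
    simp only [c]
    have h4 := (Real.sqrt_pos.2 h1).ne'
    have h5 := h2.ne'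
    rw [← mul_inv, inv_mul_eq_one₀ (by positivity)]
    rw [mul_mul_mul_comm, ← pow_two, h3, ← pow_two]
  · rw [hφφ, integral_chaosPoly_of_ne hμ j fun h => hkk (Subtype.ext h), mul_zero, mul_zero]
  have hbes := hon.sum_inner_products_le (hgL.toLp)
    (s := s.attach.image fun p => ((⟨p.1.1, (hs p.1 p.2).1⟩ : {k : Fin N → ℕ // m ≤ k j}), p.1.2))
  rw [Finset.sum_image] at hbes
  swap
  · rintro ⟨⟨k, i⟩, h⟩ - ⟨⟨k', i'⟩, h'⟩ - he
    simp only [Prod.mk.injEq, Subtype.mk.injEq] at he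
    exact Subtype.ext (Prod.ext he.1 he.2)
  have hnorm : ‖hgL.toLp‖ ≤ B.toReal := by
    rw [Lp.norm_toLp]
    exact ENNReal.toReal_mono hB hgB
  have hcoef : ∀ p ∈ s, L * ‖(inner ℂ (b p.2) (∫ z, chaosFun d μ j p.1 z • f z ∂μ) : ℂ)‖ ^ 2
      ≤ ‖(inner ℂ (b p.2) (c p.1 • ∫ z, (chaosPoly d j m p.1 z * (d j).sig (z j) ^ m) • g z ∂μ)
        : ℂ)‖ ^ 2 := by
    intro p hp
    obtain ⟨h1, h2⟩ := hs p hp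
    have h3 := eigProd_pos hμ h1
    have h4 : (√(eigProd d j m p.1)) ≠ 0 := (Real.sqrt_pos.2 h3).ne'
    have h5 := (chaosNorm_pos hμ j p.1).ne'
    have e : ∫ z, chaosFun d μ j p.1 z • f z ∂μ
        = (chaosNorm d μ j p.1)⁻¹ • ∫ z, chaosPoly d j 0 p.1 z • f z ∂μ := by
      rw [← integral_smul]
      refine integral_congr_ae (Eventually.of_forall fun z => ?_)
      simp only [chaosFun]
      rw [mul_comm, mul_smul]
    have e2 : c p.1 • ∫ z, (chaosPoly d j m p.1 z * (d j).sig (z j) ^ m) • g z ∂μ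
        = √(eigProd d j m p.1) • ∫ z, chaosFun d μ j p.1 z • f z ∂μ := by
      rw [← hk, e, smul_smul, smul_smul]
      congr 1
      change (√(eigProd d j m p.1) * chaosNorm d μ j p.1)⁻¹ * eigProd d j m p.1 = _
      rw [mul_inv, mul_right_comm]
      congr 1
      rw [inv_mul_eq_div, Real.div_sqrt]
    rw [e2, ← Complex.coe_smul, inner_smul_right, norm_mul, mul_pow, Complex.norm_real,
      Real.norm_of_nonneg (Real.sqrt_nonneg _), Real.sq_sqrt h3.le]
    exact mul_le_mul_of_nonneg_right h2 (sq_nonneg _)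
  rw [inv_mul_eq_div, le_div_iff₀ hL, mul_comm, Finset.mul_sum]
  refine (Finset.sum_le_sum hcoef).trans ?_
  refine le_trans (le_of_eq ?_) (hbes.trans (pow_le_pow_left₀ (norm_nonneg _) hnorm 2))
  rw [← Finset.sum_attach s]
  refine Finset.sum_congr rfl fun p _ => ?_
  rw [inner_tensorLp, ← integral_smul]
  congr 3
  refine integral_congr_ae ?_
  filter_upwards [hμ.ae_mem_box, hgL.coeFn_toLp] with z hz hz'
  have h1 := Real.mul_self_sqrt (((d j).mem_interval _).1 (hz j)).le
  rw [hz', smul_smul, smul_smul]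
  congr 1
  simp only [φ]
  nth_rw 1 [← h1]
  rw [mul_pow]
  ring

theorem integral_monomial_eq_zero (hμ : IsJointLaw d μ) (j : Fin N) {g : (Fin N → ℝ) → H}
    (hg : MemLp g 2 μ) (h : ∀ k, ∫ z, chaosPoly d j 0 k z • g z ∂μ = 0) (α : Fin N → ℕ) :
    ∫ z, (∏ j', z j' ^ α j') • g z ∂μ = 0 := by
  have hspan : ∀ j', ∃ c : ℕ →₀ ℝ, (c.sum fun m a => a • (d j').eigPoly m) = X ^ α j' := by
    intro j'
    rw [← Finsupp.mem_span_range_iff_exists_finsupp, CompLaw.span_eigPoly (hμ.adm j')]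
    trivial
  choose c hc using hspan
  have e : ∀ z : Fin N → ℝ, ∏ j', z j' ^ α j'
      = ∑ k ∈ Fintype.piFinset fun j' => (c j').support,
          (∏ j', c j' (k j')) * chaosPoly d j 0 k z := by
    intro z
    have e1 : ∀ j', z j' ^ α j'
        = ∑ m ∈ (c j').support, c j' m * ((d j').eigPoly m).eval (z j') := by
      intro j'
      have := congrArg (Polynomial.eval (z j')) (hc j')
      rw [Finsupp.sum, eval_finsetSum, eval_pow, eval_X] at this
      rw [← this]
      simp only [eval_smul, smul_eq_mul]
    simp only [e1]
    rw [Finset.prod_univ_sum]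
    refine Finset.sum_congr rfl fun k _ => ?_
    rw [Finset.prod_mul_distrib, chaosPoly_zero]
  simp only [e, Finset.sum_smul, mul_smul]
  rw [integral_finsetSum]
  · refine Finset.sum_eq_zero fun k _ => ?_
    rw [integral_smul, h, smul_zero]
  · intro k _
    exact (integrable_smul_of_memLp_two ((polyGrowth_chaosPoly j 0 k).memLp_two hμ) hg).smul _

theorem polyEval_of_chaosPoly (hμ : IsJointLaw d μ) (j : Fin N) {n : ℕ} {k : Fin N → ℕ}
    (hk : ∑ j', k j' ≤ n) {W : Type*} [AddCommGroup W] [Module ℂ W] (v : W) :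
    ∃ c : (Fin N → ℕ) → W, ∀ z, polyEval n c z = (chaosPoly d j 0 k z : ℂ) • v := by
  refine ⟨fun α => ((∏ j', ((d j').eigPoly (k j')).coeff (α j') : ℝ) : ℂ) • v, fun z => ?_⟩
  have hdeg : ∀ j', ((d j').eigPoly (k j')).natDegree = k j' := fun j' =>
    (CompLaw.eigPoly_spec (hμ.adm j') _).2.1
  have e : chaosPoly d j 0 k z = ∑ α ∈ multiIdx N n,
      (∏ j', z j' ^ α j') * ∏ j', ((d j').eigPoly (k j')).coeff (α j') := by
    rw [chaosPoly_zero]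
    simp only [Polynomial.eval_eq_sum_range]
    rw [Finset.prod_univ_sum]
    have hsub : (Fintype.piFinset fun j' =>
        Finset.range (((d j').eigPoly (k j')).natDegree + 1)) ⊆ multiIdx N n := by
      intro α hα
      rw [Fintype.mem_piFinset] at hα
      rw [mem_multiIdx]
      refine le_trans (Finset.sum_le_sum fun j' _ => ?_) hk
      have := hα j'
      rw [hdeg, Finset.mem_range] at this
      omega
    rw [← Finset.sum_subset hsub]
    · refine Finset.sum_congr rfl fun α _ => ?_
      rw [Finset.prod_mul_distrib, mul_comm]
    · intro α _ hα
      rw [Fintype.mem_piFinset, not_forall] at hα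
      obtain ⟨j', hj'⟩ := hα
      rw [Finset.mem_range, not_lt] at hj'
      have h0 : ∏ j', ((d j').eigPoly (k j')).coeff (α j') = 0 :=
        Finset.prod_eq_zero (Finset.mem_univ j') (coeff_eq_zero_of_natDegree_lt hj')
      rw [h0, mul_zero]
  rw [e, polyEval, Complex.ofReal_sum, Finset.sum_smul]
  refine Finset.sum_congr rfl fun α _ => ?_
  rw [smul_smul, Complex.ofReal_mul]

theorem tensorLp_mem_chaosSpace (hμ : IsJointLaw d μ) (j : Fin N) {n : ℕ} {k : Fin N → ℕ}
    (hk : ∑ j', k j' ≤ n) (v : H) : tensorLp (memLp_chaosFun hμ j k) v ∈ chaosSpace H μ n := by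
  obtain ⟨c, hc⟩ := polyEval_of_chaosPoly hμ j hk ((((chaosNorm d μ j k)⁻¹ : ℝ) : ℂ) • v)
  refine ⟨c, ?_⟩
  filter_upwards [coeFn_tensorLp (memLp_chaosFun hμ j k) v] with z hz
  rw [hz, hc, smul_smul, ← Complex.ofReal_mul, Complex.coe_smul, chaosFun]

theorem _root_.HilbertBasis.eq_zero_of_inner {w : Type*} (b : HilbertBasis w ℂ H) {x : H}
    (h : ∀ i, (inner ℂ (b i) x : ℂ) = 0) : x = 0 := by
  have := b.hasSum_repr x
  simp only [b.repr_apply_apply, h, zero_smul] at this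
  exact this.unique hasSum_zero

theorem _root_.HilbertBasis.norm_sq_le_of_sum_le {w : Type*} (b : HilbertBasis w ℂ H) {x : H}
    {M : ℝ} (h : ∀ s : Finset w, ∑ i ∈ s, ‖(inner ℂ (b i) x : ℂ)‖ ^ 2 ≤ M) : ‖x‖ ^ 2 ≤ M := by
  have h1 := (b.hasSum_repr x).norm.pow 2
  refine le_of_tendsto h1 (Eventually.of_forall fun s => ?_)
  refine le_trans (le_of_eq ?_) (h s)
  simp only [b.repr_apply_apply]
  rw [← inner_self_eq_norm_sq (𝕜 := ℂ), b.orthonormal.inner_sum, map_sum]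
  refine Finset.sum_congr rfl fun i _ => ?_
  rw [RCLike.conj_mul]
  norm_cast

/-- The approximant is the truncated eigenpolynomial expansion. A multi-index of size above `n` has
a coordinate with `N k_j > n`; when `n ≥ 4Nl`, every `t < 2l` is at most `k_j / 2`, so each of the
`2l` eigenvalue differences is at least `q j * n`. Summing the Bessel bounds over the coordinates
controls the tail. -/
theorem exists_chaos_approx [TopologicalSpace.SeparableSpace H] (hμ : IsJointLaw d μ) (j₀ : Fin N)
    (l : ℕ) : ∃ C : ℝ, 0 ≤ C ∧ ∀ (y : Lp H 2 μ) (f : (Fin N → ℝ) → H) (B : ℝ≥0∞), B ≠ ⊤ →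
      y =ᵐ[μ] f → (∀ j, WeightedReg d μ j (2 * l) 0 f B) → ∀ n : ℕ, 1 ≤ n →
      ∃ x ∈ chaosSpace H μ n, ‖y - x‖ ≤ C * (n : ℝ) ^ (-(l : ℤ)) * B.toReal := by
  have hN : 0 < N := Fin.pos j₀
  set q : Fin N → ℝ := fun j => (d j).gap / (2 * N) with hq
  have hqp : ∀ j, 0 < q j := fun j => by
    have := CompLaw.gap_pos (hμ.adm j)
    simp only [hq]
    positivity
  set D : ℝ := ∑ j, ((q j) ^ (2 * l))⁻¹ with hD
  have hD0 : 0 ≤ D := Finset.sum_nonneg fun j _ => by have := hqp j; positivity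
  refine ⟨√D + (4 * N * l : ℝ) ^ l, by positivity, fun y f B hB hyf hf n hn => ?_⟩
  have hn0 : (0 : ℝ) < n := by exact_mod_cast hn
  have hBn : 0 ≤ B.toReal := ENNReal.toReal_nonneg
  have hnl : (n : ℝ) ^ (-(l : ℤ)) = ((n : ℝ) ^ l)⁻¹ := by rw [zpow_neg, zpow_natCast]
  rw [hnl]
  -- For small `n` the approximant is zero, and the summand `(4Nl)^l` of the constant absorbs the
  -- factor `n^l`.
  by_cases hbig : n < 4 * N * l
  · refine ⟨0, Submodule.zero_mem _, ?_⟩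
    rw [sub_zero]
    have h1 : ‖y‖ ≤ B.toReal := by
      rw [Lp.norm_def]
      refine ENNReal.toReal_mono hB ?_
      have := (hf j₀).base.2
      simp only [pow_zero, one_smul] at this
      rwa [eLpNorm_congr_ae hyf]
    have h2 : (1 : ℝ) ≤ (4 * N * l : ℝ) ^ l * ((n : ℝ) ^ l)⁻¹ := by
      rw [← div_eq_mul_inv, one_le_div (by positivity)]
      refine pow_le_pow_left₀ hn0.le ?_ l
      exact_mod_cast hbig.le
    have h3 : (1 : ℝ) ≤ (√D + (4 * N * l : ℝ) ^ l) * ((n : ℝ) ^ l)⁻¹ := by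
      refine h2.trans (mul_le_mul_of_nonneg_right ?_ (by positivity))
      linarith [Real.sqrt_nonneg D]
    nlinarith
  · push Not at hbig
    obtain ⟨w, hw, ⟨b⟩⟩ := exists_countable_hilbertBasis H
    have hbon := b.orthonormal
    set Ψ : (Fin N → ℕ) × w → Lp H 2 μ := fun p => tensorLp (memLp_chaosFun hμ j₀ p.1) (b p.2)
      with hΨ
    have hon : Orthonormal ℂ Ψ := orthonormal_tensorLp (fun k => memLp_chaosFun hμ j₀ k)
      (fun k => integral_chaosFun_self hμ j₀ k) (fun k k' h => integral_chaosFun_of_ne hμ j₀ h) hbon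
    have htot : (Submodule.span ℂ (range Ψ))ᗮ = ⊥ := by
      rw [Submodule.eq_bot_iff]
      intro g hg
      rw [Submodule.mem_orthogonal] at hg
      have h1 : ∀ k, ∫ z, chaosFun d μ j₀ k z • g z ∂μ = 0 := by
        intro k
        refine b.eq_zero_of_inner fun i => ?_
        rw [← inner_tensorLp (memLp_chaosFun hμ j₀ k)]
        exact hg _ (Submodule.subset_span ⟨(k, i), rfl⟩)
      have h2 : ∀ k, ∫ z, chaosPoly d j₀ 0 k z • g z ∂μ = 0 := by
        intro k
        have h3 : (chaosNorm d μ j₀ k)⁻¹ • ∫ z, chaosPoly d j₀ 0 k z • g z ∂μ = 0 := by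
          rw [← integral_smul, ← h1 k]
          refine integral_congr_ae (Eventually.of_forall fun z => ?_)
          simp only [chaosFun]
          rw [mul_comm, mul_smul]
        exact (smul_eq_zero.1 h3).resolve_left (inv_ne_zero (chaosNorm_pos hμ j₀ k).ne')
      rw [Lp.eq_zero_iff_ae_eq_zero]
      exact ae_eq_zero_of_moments hμ (Lp.memLp g)
        (integral_monomial_eq_zero hμ j₀ (Lp.memLp g) h2)
    let b' := HilbertBasis.mkOfOrthogonalEqBot hon htot
    have hb' : ⇑b' = Ψ := HilbertBasis.coe_mkOfOrthogonalEqBot hon htot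
    set v : (Fin N → ℕ) → H := fun k => ∫ z, chaosFun d μ j₀ k z • y z ∂μ with hv
    set x : Lp H 2 μ := ∑ k ∈ multiIdx N n, tensorLp (memLp_chaosFun hμ j₀ k) (v k) with hx
    have hcoef : ∀ p, (inner ℂ (Ψ p) (y - x) : ℂ)
        = if p.1 ∈ multiIdx N n then 0 else inner ℂ (b p.2 : H) (v p.1) := by
      rintro ⟨k, i⟩
      have e1 : (inner ℂ (Ψ (k, i)) x : ℂ)
          = if k ∈ multiIdx N n then inner ℂ (b i : H) (v k) else 0 := by
        rw [hx, inner_sum, ← Finset.sum_ite_eq (multiIdx N n) k fun k => inner ℂ (b i : H) (v k)]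
        refine Finset.sum_congr rfl fun k' _ => ?_
        simp only [hΨ]
        rw [inner_tensorLp, integral_smul_tensorLp]
        split_ifs with h
        · rw [← h, integral_chaosFun_self hμ, one_smul]
        · rw [integral_chaosFun_of_ne hμ j₀ h, zero_smul, inner_zero_right]
      rw [inner_sub_right, e1]
      simp only [hΨ]
      rw [inner_tensorLp]
      split_ifs <;> simp [hv]
    refine ⟨x, Submodule.sum_mem _ fun k hk => tensorLp_mem_chaosSpace hμ j₀ (mem_multiIdx.1 hk) _,
      ?_⟩
    have hvf : ∀ j k, ∫ z, chaosFun d μ j k z • f z ∂μ = v k := by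
      intro j k
      rw [chaosFun_eq j j₀]
      refine integral_congr_ae ?_
      filter_upwards [hyf] with z hz
      rw [hz]
    have hj : ∀ (j : Fin N) (s : Finset ((Fin N → ℕ) × w)), (∀ p ∈ s, n < N * p.1 j) →
        ∑ p ∈ s, ‖(inner ℂ (b p.2 : H) (v p.1) : ℂ)‖ ^ 2
          ≤ (q j ^ (2 * l))⁻¹ * (((n : ℝ) ^ l)⁻¹ * B.toReal) ^ 2 := by
      intro j s hs
      have h1 := sum_coeff_sq_le hμ hB (hf j) hbon
        (pow_pos (mul_pos (hqp j) hn0) (2 * l)) s fun p hp => ?_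
      · simp only [hvf] at h1
        refine h1.trans (le_of_eq ?_)
        have hnn : (n : ℝ) ^ (2 * l) = ((n : ℝ) ^ l) ^ 2 := by rw [← pow_mul, mul_comm]
        rw [mul_pow, mul_pow, hnn, mul_inv, inv_pow ((n : ℝ) ^ l) 2]
        ring
      · have h2 := hs p hp
        have h3 : 4 * l < p.1 j := by
          by_contra h
          push Not at h
          have : N * p.1 j ≤ N * (4 * l) := Nat.mul_le_mul_left N h
          have e : N * (4 * l) = 4 * N * l := by ring
          omega
        refine ⟨by omega, ?_⟩
        rw [eigProd, ← Finset.card_range (2 * l), ← Finset.prod_const, Finset.card_range]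
        refine Finset.prod_le_prod (fun _ _ => (mul_pos (hqp j) hn0).le) fun t ht => ?_
        rw [Finset.mem_range] at ht
        refine le_trans ?_ (CompLaw.gap_mul_le (hμ.adm j) (by omega))
        have h4 : (n : ℝ) ≤ N * p.1 j := by exact_mod_cast h2.le
        have h5 : 2 * (t : ℝ) ≤ p.1 j := by
          have : 2 * t ≤ p.1 j := by omega
          exact_mod_cast this
        have hNp : (0 : ℝ) < N := by exact_mod_cast hN
        have hg := CompLaw.gap_pos (hμ.adm j)
        simp only [hq]
        rw [div_mul_eq_mul_div, mul_div_assoc]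
        refine mul_le_mul_of_nonneg_left ?_ hg.le
        rw [div_le_iff₀ (by positivity)]
        nlinarith
    have hsq : ‖y - x‖ ^ 2 ≤ D * (((n : ℝ) ^ l)⁻¹ * B.toReal) ^ 2 := by
      refine b'.norm_sq_le_of_sum_le fun s => ?_
      simp only [hb', hcoef]
      rw [hD, Finset.sum_mul]
      refine le_trans ?_ (Finset.sum_le_sum fun j _ => hj j (s.filter fun p => n < N * p.1 j)
        fun p hp => (Finset.mem_filter.1 hp).2)
      simp only [Finset.sum_filter]
      rw [Finset.sum_comm]
      refine Finset.sum_le_sum fun p _ => ?_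
      split_ifs with hp
      · simp only [norm_zero]
        rw [zero_pow two_ne_zero]
        exact Finset.sum_nonneg fun j _ => by split_ifs <;> positivity
      · have : ∃ j, n < N * p.1 j := by
          by_contra hne
          push Not at hne
          refine hp (mem_multiIdx.2 ?_)
          have h6 : N * ∑ j, p.1 j ≤ N * n := by
            rw [Finset.mul_sum]
            refine (Finset.sum_le_sum fun j _ => hne j).trans (le_of_eq ?_)
            simp
          exact Nat.le_of_mul_le_mul_left h6 hN
        obtain ⟨j, hjn⟩ := this
        refine le_trans (le_of_eq ?_) (Finset.single_le_sum (fun j _ => ?_) (Finset.mem_univ j))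
        · rw [if_pos hjn]
        · split_ifs <;> positivity
    have h7 : ‖y - x‖ ≤ √D * (((n : ℝ) ^ l)⁻¹ * B.toReal) := by
      refine abs_le_of_sq_le_sq' ?_ (by positivity) |>.2
      rw [mul_pow, Real.sq_sqrt hD0]
      exact hsq
    refine h7.trans ?_
    rw [mul_assoc]
    refine mul_le_mul_of_nonneg_right ?_ (by positivity)
    have : (0 : ℝ) ≤ (4 * N * l : ℝ) ^ l := by positivity
    linarith

end Approximation

/-! ### Operator families with sesquilinear coefficients -/

section Coefficients

open Filter Topology
open scoped NNReal

variable {N : ℕ} {V H : Type*} [NormedAddCommGroup V] [InnerProductSpace ℂ V] [CompleteSpace V]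
  [NormedAddCommGroup H] [InnerProductSpace ℂ H] [CompleteSpace H] {ι : V →L[ℂ] H}

theorem opNorm_le_of_inner (hd : DenseRange ι) {T : H →L[ℂ] H} {C : ℝ} (hC : 0 ≤ C)
    (h : ∀ x v, ‖(inner ℂ (ι v) (T x) : ℂ)‖ ≤ C * ‖x‖ * ‖ι v‖) : ‖T‖ ≤ C := by
  refine T.opNorm_le_bound hC fun x => ?_
  have h1 : ∀ k : H, ‖(inner ℂ k (T x) : ℂ)‖ ≤ C * ‖x‖ * ‖k‖ := by
    intro k
    refine hd.induction_on (p := fun k => ‖(inner ℂ k (T x) : ℂ)‖ ≤ C * ‖x‖ * ‖k‖) k ?_ (h x)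
    exact isClosed_le (by fun_prop) (by fun_prop)
  have h2 := h1 (T x)
  rw [inner_self_eq_norm_sq_to_K, norm_pow, RCLike.norm_ofReal, abs_norm] at h2
  rcases (norm_nonneg (T x)).eq_or_lt with h3 | h3
  · rw [← h3]
    positivity
  · nlinarith

/-- For fixed `h` the form is bounded in the norm of `H` on the dense image of `V`, so its conjugate
extends to a functional on `H` and the Riesz theorem represents it. -/
theorem exists_op_of_sesquilinear (hd : DenseRange ι) {β : H → V → ℂ} {C : ℝ} (hC : 0 ≤ C)
    (h1 : ∀ h h' v, β (h + h') v = β h v + β h' v) (h2 : ∀ (c : ℂ) h v, β (c • h) v = c * β h v)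
    (h3 : ∀ h v v', β h (v + v') = β h v + β h v')
    (h4 : ∀ (c : ℂ) h v, β h (c • v) = conj c * β h v)
    (hb : ∀ h v, ‖β h v‖ ≤ C * ‖h‖ * ‖ι v‖) :
    ∃ T : H →L[ℂ] H, (∀ h v, inner ℂ (ι v) (T h) = β h v) ∧ ‖T‖ ≤ C := by
  let f : H → V →ₗ[ℂ] ℂ := fun h =>
    { toFun := fun v => conj (β h v)
      map_add' := fun v v' => by rw [h3, map_add]
      map_smul' := fun c v => by rw [h4, map_mul, Complex.conj_conj]; rfl }
  have hf : ∀ h v, ‖f h v‖ ≤ C * ‖h‖ * ‖ι.toLinearMap v‖ := fun h v => by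
    change ‖conj (β h v)‖ ≤ _
    rw [RCLike.norm_conj]
    exact hb h v
  let x : H → H := fun h => (InnerProductSpace.toDual ℂ H).symm ((f h).extendOfNorm ι.toLinearMap)
  have hx : ∀ h v, inner ℂ (ι v) (x h) = β h v := by
    intro h v
    rw [← inner_conj_symm, InnerProductSpace.toDual_symm_apply]
    have := (f h).extendOfNorm_eq (e := ι.toLinearMap) hd ⟨_, hf h⟩ v
    rw [ContinuousLinearMap.coe_coe] at this
    rw [this]
    change conj (conj (β h v)) = _
    rw [Complex.conj_conj]
  let T0 : H →ₗ[ℂ] H :=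
    { toFun := x
      map_add' := fun h h' => inner_ext_denseRange hd fun v => by
        rw [inner_add_right, hx, hx, hx, h1]
      map_smul' := fun c h => inner_ext_denseRange hd fun v => by
        rw [RingHom.id_apply, inner_smul_right, hx, hx, h2] }
  have hT0 : ∀ h, ‖T0 h‖ ≤ C * ‖h‖ := by
    intro h
    change ‖(InnerProductSpace.toDual ℂ H).symm _‖ ≤ _
    rw [LinearIsometryEquiv.norm_map]
    exact (f h).opNorm_extendOfNorm_le (e := ι.toLinearMap) hd (by positivity) (hf h)
  exact ⟨T0.mkContinuous C hT0, hx, T0.mkContinuous_norm_le hC hT0⟩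

/-- Weak convergence of the operators on a dense set extends to all vectors by the common bound.
Vectors moving on both sides cause no harm because they converge in norm. -/
theorem tendsto_inner_op (hd : DenseRange ι) {α : Type*} {f : Filter α} {x : α → H} {x₀ : H}
    (hx : Tendsto x f (𝓝 x₀)) {T : α → H →L[ℂ] H} {T₀ : H →L[ℂ] H} {C : ℝ}
    (hC : ∀ᶠ t in f, ‖T t‖ ≤ C)
    (hT : ∀ v h, Tendsto (fun t => (inner ℂ (ι v) (T t h) : ℂ)) f (𝓝 (inner ℂ (ι v) (T₀ h))))
    {h : α → H} {h₀ : H} (hh : Tendsto h f (𝓝 h₀)) :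
    Tendsto (fun t => (inner ℂ (x t) (T t (h t)) : ℂ)) f (𝓝 (inner ℂ x₀ (T₀ h₀))) := by
  rcases f.eq_or_neBot with rfl | hf
  · exact tendsto_bot
  have hC0 : 0 ≤ C := by
    obtain ⟨t, ht⟩ := hC.exists
    exact (norm_nonneg _).trans ht
  have hk : ∀ k : H, Tendsto (fun t => (inner ℂ k (T t h₀) : ℂ)) f (𝓝 (inner ℂ k (T₀ h₀))) := by
    intro k
    rw [Metric.tendsto_nhds]
    intro ε hε
    have hD : 0 < C * ‖h₀‖ + ‖T₀ h₀‖ + 1 := by positivity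
    obtain ⟨v, hv⟩ := hd.exists_dist_lt k (ε := ε / 2 / (C * ‖h₀‖ + ‖T₀ h₀‖ + 1)) (by positivity)
    filter_upwards [hC, Metric.tendsto_nhds.1 (hT v h₀) (ε / 2) (by positivity)] with t h1 h2
    rw [dist_eq_norm] at h2 hv ⊢
    have e : (inner ℂ k (T t h₀) : ℂ) - inner ℂ k (T₀ h₀)
        = inner ℂ (k - ι v) (T t h₀ - T₀ h₀)
          + (inner ℂ (ι v) (T t h₀) - inner ℂ (ι v) (T₀ h₀)) := by
      rw [inner_sub_left, inner_sub_right, inner_sub_right]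
      ring
    rw [e]
    have h3 : ‖T t h₀ - T₀ h₀‖ ≤ C * ‖h₀‖ + ‖T₀ h₀‖ + 1 := by
      refine (norm_sub_le _ _).trans ?_
      have := (T t).le_of_opNorm_le h1 h₀
      linarith
    have h4 : ‖(inner ℂ (k - ι v) (T t h₀ - T₀ h₀) : ℂ)‖ ≤ ε / 2 := by
      refine (norm_inner_le_norm _ _).trans ?_
      refine (mul_le_mul hv.le h3 (norm_nonneg _) (by positivity)).trans (le_of_eq ?_)
      field_simp
    calc _ ≤ _ := norm_add_le _ _
      _ < ε / 2 + ε / 2 := add_lt_add_of_le_of_lt h4 h2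
      _ = ε := by ring
  have e : ∀ t, (inner ℂ (x t) (T t (h t)) : ℂ) = inner ℂ (x t - x₀) (T t (h t))
      + inner ℂ x₀ (T t (h t - h₀)) + inner ℂ x₀ (T t h₀) := by
    intro t
    rw [inner_sub_left, map_sub, inner_sub_right]
    ring
  have hTb : ∀ᶠ t in f, ∀ y, ‖T t y‖ ≤ C * ‖y‖ := by
    filter_upwards [hC] with t ht y
    exact (T t).le_of_opNorm_le ht y
  have l1 : Tendsto (fun t => (inner ℂ (x t - x₀) (T t (h t)) : ℂ)) f (𝓝 0) := by
    have h0 : Tendsto (fun t => ‖x t - x₀‖ * (C * ‖h t‖)) f (𝓝 (‖x₀ - x₀‖ * (C * ‖h₀‖))) :=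
      (hx.sub_const x₀).norm.mul (hh.norm.const_mul C)
    rw [sub_self, norm_zero, zero_mul] at h0
    refine squeeze_zero_norm' ?_ h0
    filter_upwards [hTb] with t ht
    exact (norm_inner_le_norm _ _).trans (mul_le_mul_of_nonneg_left (ht _) (norm_nonneg _))
  have l2 : Tendsto (fun t => (inner ℂ x₀ (T t (h t - h₀)) : ℂ)) f (𝓝 0) := by
    have h0 : Tendsto (fun t => ‖x₀‖ * (C * ‖h t - h₀‖)) f (𝓝 (‖x₀‖ * (C * ‖h₀ - h₀‖))) :=
      ((hh.sub_const h₀).norm.const_mul C).const_mul _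
    rw [sub_self, norm_zero, mul_zero, mul_zero] at h0
    refine squeeze_zero_norm' ?_ h0
    filter_upwards [hTb] with t ht
    exact (norm_inner_le_norm _ _).trans (mul_le_mul_of_nonneg_left (ht _) (norm_nonneg _))
  simp only [e]
  simpa using (l1.add l2).add (hk x₀)

section Iterate

variable {F : Type*} [NormedAddCommGroup F] [NormedSpace ℝ F]

theorem contDiff_partialDeriv {j : Fin N} {m : ℕ} {g : (Fin N → ℝ) → F}
    (hg : ContDiff ℝ ((m + 1 : ℕ) : ℕ∞ω) g) : ContDiff ℝ (m : ℕ∞ω) (partialDeriv j g) :=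
  (hg.fderiv_right (m := m) (by norm_cast)).clm_apply contDiff_const

theorem contDiff_iterate_partialDeriv (j : Fin N) {i : ℕ} : ∀ {m : ℕ} {g : (Fin N → ℝ) → F},
    ContDiff ℝ ((m + i : ℕ) : ℕ∞ω) g → ContDiff ℝ (m : ℕ∞ω) ((partialDeriv j)^[i] g) := by
  induction i with
  | zero => exact fun h => h
  | succ i ih =>
    intro m g hg
    rw [Function.iterate_succ_apply]
    exact ih (contDiff_partialDeriv (by rwa [← add_assoc] at hg))

theorem iterate_partialDeriv_add (j : Fin N) {i : ℕ} : ∀ {f g : (Fin N → ℝ) → F},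
    ContDiff ℝ (i : ℕ∞ω) f → ContDiff ℝ (i : ℕ∞ω) g →
    (partialDeriv j)^[i] (f + g) = (partialDeriv j)^[i] f + (partialDeriv j)^[i] g := by
  induction i with
  | zero => exact fun _ _ => rfl
  | succ i ih =>
    intro f g hf hg
    have h1 : partialDeriv j (f + g) = partialDeriv j f + partialDeriv j g := by
      funext z
      rw [partialDeriv, fderiv_add (hf.differentiable (by simp) z) (hg.differentiable (by simp) z)]
      rfl
    rw [Function.iterate_succ_apply, Function.iterate_succ_apply, Function.iterate_succ_apply, h1,
      ih (contDiff_partialDeriv hf) (contDiff_partialDeriv hg)]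

theorem iterate_partialDeriv_const_mul (j : Fin N) (c : ℂ) {i : ℕ} : ∀ {f : (Fin N → ℝ) → ℂ},
    ContDiff ℝ (i : ℕ∞ω) f →
    (partialDeriv j)^[i] (fun z => c * f z) = fun z => c * (partialDeriv j)^[i] f z := by
  induction i with
  | zero => exact fun _ => rfl
  | succ i ih =>
    intro f hf
    have h1 : partialDeriv j (fun z => c * f z) = fun z => c * partialDeriv j f z := by
      funext z
      rw [partialDeriv, fderiv_const_mul (hf.differentiable (by simp) z)]
      rfl
    rw [Function.iterate_succ_apply, Function.iterate_succ_apply, h1, ih (contDiff_partialDeriv hf)]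

end Iterate

/-- The operators `S j i z` represent the `i`-th partial derivatives in the `j`-th coordinate of
the coefficients `φ h v`, with weighted bounds. -/
structure CoeffFamily (d : Fin N → CompLaw) (ι : V →L[ℂ] H) (m : ℕ) (φ : H → V → (Fin N → ℝ) → ℂ)
    (C : ℝ≥0) (S : Fin N → ℕ → (Fin N → ℝ) → H →L[ℂ] H) : Prop where
  smooth : ∀ h v, ContDiff ℝ (m : ℕ∞ω) (φ h v)
  repr : ∀ j, ∀ i ≤ m, ∀ z ∈ box d, ∀ h v,
    inner ℂ (ι v) (S j i z h) = (partialDeriv j)^[i] (φ h v) z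
  bound : ∀ j, ∀ i ≤ m, ∀ z ∈ box d, sqrtRho d j z ^ i * ‖S j i z‖ ≤ C

/-- The derivative bound is given almost surely, but both of its sides are continuous in `z`; hence
it holds throughout the box, and the Riesz construction applies at each point. Off the box, or
beyond order `m`, the operators are arbitrary. -/
theorem exists_coeffFamily {d : Fin N → CompLaw} {μ : Measure (Fin N → ℝ)} (hμ : IsJointLaw d μ)
    (hd : DenseRange ι) {m : ℕ} {φ : H → V → (Fin N → ℝ) → ℂ} {C : ℝ≥0}
    (hs : ∀ h v, ContDiff ℝ (m : ℕ∞ω) (φ h v))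
    (h1 : ∀ h h' v, φ (h + h') v = φ h v + φ h' v)
    (h2 : ∀ (c : ℂ) h v, φ (c • h) v = fun z => c * φ h v z)
    (h3 : ∀ h v v', φ h (v + v') = φ h v + φ h v')
    (h4 : ∀ (c : ℂ) h v, φ h (c • v) = fun z => conj c * φ h v z)
    (hb : ∀ᵐ z ∂μ, ∀ j, ∀ i ≤ m, ∀ h v,
      sqrtRho d j z ^ i * ‖(partialDeriv j)^[i] (φ h v) z‖ ≤ C * ‖h‖ * ‖ι v‖) :
    ∃ S, CoeffFamily d ι m φ C S := by
  have hpos : ∀ j, ∀ z ∈ box d, 0 < sqrtRho d j z := fun j z hz =>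
    Real.sqrt_pos.2 ((d j).rho_pos (hz j))
  have hsi : ∀ i ≤ m, ∀ h v, ContDiff ℝ (i : ℕ∞ω) (φ h v) := fun i hi h v =>
    (hs h v).of_le (by exact_mod_cast hi)
  have hc : ∀ j, ∀ i ≤ m, ∀ h v, Continuous ((partialDeriv j)^[i] (φ h v)) := fun j i hi h v =>
    (contDiff_iterate_partialDeriv (m := 0) j (by rw [zero_add]; exact hsi i hi h v)).continuous
  have key : ∀ j i z, ∃ T : H →L[ℂ] H, i ≤ m → z ∈ box d →
      (∀ h v, inner ℂ (ι v) (T h) = (partialDeriv j)^[i] (φ h v) z) ∧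
        ‖T‖ ≤ C / sqrtRho d j z ^ i := by
    intro j i z
    by_cases hiz : i ≤ m ∧ z ∈ box d
    swap
    · exact ⟨0, fun hi hz => (hiz ⟨hi, hz⟩).elim⟩
    obtain ⟨hi, hz⟩ := hiz
    have hp := pow_pos (hpos j z hz) i
    have hbz : ∀ h v, ‖(partialDeriv j)^[i] (φ h v) z‖
        ≤ C / sqrtRho d j z ^ i * ‖h‖ * ‖ι v‖ := by
      intro h v
      have h5 := hμ.dense_of_ae (P := fun z => sqrtRho d j z ^ i *
        ‖(partialDeriv j)^[i] (φ h v) z‖ ≤ C * ‖h‖ * ‖ι v‖) (by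
          filter_upwards [hb] with z hz
          exact hz j i hi h v) hz
      have h6 : IsClosed {z | sqrtRho d j z ^ i * ‖(partialDeriv j)^[i] (φ h v) z‖
          ≤ C * ‖h‖ * ‖ι v‖} :=
        isClosed_le (((continuous_sqrtRho d j).pow i).mul (hc j i hi h v).norm) continuous_const
      have h7 : sqrtRho d j z ^ i * ‖(partialDeriv j)^[i] (φ h v) z‖ ≤ C * ‖h‖ * ‖ι v‖ :=
        closure_minimal (fun y hy => hy.2) h6 h5
      rw [div_mul_eq_mul_div, div_mul_eq_mul_div, le_div_iff₀ hp, mul_comm]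
      exact h7
    obtain ⟨T, hT, hTn⟩ := exists_op_of_sesquilinear hd
      (β := fun h v => (partialDeriv j)^[i] (φ h v) z) (C := C / sqrtRho d j z ^ i) (by positivity)
      (fun h h' v => by rw [h1, iterate_partialDeriv_add j (hsi i hi _ _) (hsi i hi _ _)]; rfl)
      (fun c h v => by rw [h2, iterate_partialDeriv_const_mul j c (hsi i hi _ _)])
      (fun h v v' => by rw [h3, iterate_partialDeriv_add j (hsi i hi _ _) (hsi i hi _ _)]; rfl)
      (fun c h v => by rw [h4, iterate_partialDeriv_const_mul j _ (hsi i hi _ _)]) hbz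
    exact ⟨T, fun _ _ => ⟨hT, hTn⟩⟩
  choose S hS using key
  refine ⟨S, hs, fun j i hi z hz => (hS j i z hi hz).1, fun j i hi z hz => ?_⟩
  have := (hS j i z hi hz).2
  rwa [le_div_iff₀ (pow_pos (hpos j z hz) i), mul_comm] at this

namespace CoeffFamily

variable {d : Fin N → CompLaw} {m : ℕ} {φ : H → V → (Fin N → ℝ) → ℂ} {C : ℝ≥0}
  {S : Fin N → ℕ → (Fin N → ℝ) → H →L[ℂ] H} (hS : CoeffFamily d ι m φ C S)
include hS

theorem continuousOn {j : Fin N} {i : ℕ} (hi : i ≤ m) (v : V) (h : H) :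
    ContinuousOn (fun z => (inner ℂ (ι v) (S j i z h) : ℂ)) (box d) := by
  have : Continuous ((partialDeriv j)^[i] (φ h v)) :=
    (contDiff_iterate_partialDeriv (m := 0) j (by
      rw [zero_add]; exact (hS.smooth h v).of_le (by exact_mod_cast hi))).continuous
  exact this.continuousOn.congr fun z hz => hS.repr j i hi z hz h v

theorem exists_bound {j : Fin N} {i : ℕ} (hi : i ≤ m) (K : Set (Fin N → ℝ)) (hK : IsCompact K)
    (hKb : K ⊆ box d) : ∃ C', ∀ z ∈ K, ‖S j i z‖ ≤ C' := by
  have hpos : ∀ z ∈ K, 0 < sqrtRho d j z ^ i := fun z hz =>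
    pow_pos (Real.sqrt_pos.2 ((d j).rho_pos (hKb hz j))) i
  have hc : ContinuousOn (fun z => (C : ℝ) / sqrtRho d j z ^ i) K :=
    continuousOn_const.div ((continuous_sqrtRho d j).pow i).continuousOn fun z hz => (hpos z hz).ne'
  obtain ⟨C', hC'⟩ := hK.bddAbove_image hc
  refine ⟨C', fun z hz => le_trans ?_ (hC' ⟨z, hz, rfl⟩)⟩
  have := hS.bound j i hi z (hKb hz)
  rwa [le_div_iff₀ (hpos z hz), mul_comm]

theorem opDeriv {j : Fin N} {i : ℕ} (hi : i < m) :
    OpDeriv (box d) j ι (S j i) (S j (i + 1)) where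
  cont := hS.continuousOn hi.le
  cont' := hS.continuousOn hi
  bdd := hS.exists_bound hi.le
  bdd' := hS.exists_bound hi
  deriv := by
    intro v h z hz
    have h1 : ContDiff ℝ ((1 : ℕ) : ℕ∞ω) ((partialDeriv j)^[i] (φ h v)) :=
      contDiff_iterate_partialDeriv j ((hS.smooth h v).of_le (by
        rw [add_comm]
        exact_mod_cast hi))
    have h2 := ((h1.differentiable (by simp)) z).hasFDerivAt.hasLineDerivAt (Pi.single j 1)
    have h3 : (fderiv ℝ ((partialDeriv j)^[i] (φ h v)) z) (Pi.single j 1)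
        = inner ℂ (ι v) (S j (i + 1) z h) := by
      rw [hS.repr j (i + 1) hi z hz, Function.iterate_succ_apply']
      rfl
    rw [h3] at h2
    have hc : ContinuousAt (fun t : ℝ => z + t • (Pi.single j 1 : Fin N → ℝ)) 0 := by fun_prop
    have hmem : box d ∈ 𝓝 (z + (0 : ℝ) • (Pi.single j 1 : Fin N → ℝ)) := by
      rw [zero_smul, add_zero]
      exact (isOpen_box d).mem_nhds hz
    exact HasDerivAt.congr_of_eventuallyEq h2 (by
      filter_upwards [hc.preimage_mem_nhds hmem] with t ht
      exact hS.repr j i hi.le _ ht h v)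

/-- The gradients of the scalar coefficients are bounded by the first order operators, uniformly
over unit vectors `h` and `ι v`. The mean value inequality then gives a Lipschitz bound in operator
norm, although the differentiability is only weak. -/
theorem locally_lipschitz (hd : DenseRange ι) (hm : 1 ≤ m) (j : Fin N) {z : Fin N → ℝ}
    (hz : z ∈ box d) : ∃ L : ℝ, ∀ᶠ y in 𝓝 z, y ∈ box d ∧ ‖S j 0 y - S j 0 z‖ ≤ L * ‖y - z‖ := by
  obtain ⟨r, hr, hrb⟩ := Metric.nhds_basis_closedBall.mem_iff.1 ((isOpen_box d).mem_nhds hz)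
  choose c hc using fun k : Fin N => hS.exists_bound (j := k) hm (Metric.closedBall z r)
    (isCompact_closedBall z r) hrb
  have hzr : z ∈ Metric.closedBall z r := Metric.mem_closedBall_self hr.le
  have hc0 : ∀ k, 0 ≤ c k := fun k => (norm_nonneg _).trans (hc k z hzr)
  refine ⟨∑ k, c k, ?_⟩
  filter_upwards [Metric.closedBall_mem_nhds z hr] with y hy
  refine ⟨hrb hy, opNorm_le_of_inner hd (mul_nonneg (Finset.sum_nonneg fun k _ => hc0 k)
    (norm_nonneg _)) fun h v => ?_⟩
  have hdiff : Differentiable ℝ (φ h v) :=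
    (hS.smooth h v).differentiable (by exact_mod_cast (by omega : m ≠ 0))
  have hbd : ∀ x ∈ Metric.closedBall z r, ‖fderiv ℝ (φ h v) x‖ ≤ (∑ k, c k) * ‖h‖ * ‖ι v‖ := by
    intro x hx
    have hnn : 0 ≤ (∑ k, c k) * ‖h‖ * ‖ι v‖ :=
      mul_nonneg (mul_nonneg (Finset.sum_nonneg fun k _ => hc0 k) (norm_nonneg _)) (norm_nonneg _)
    refine ContinuousLinearMap.opNorm_le_bound _ hnn fun u => ?_
    have e : fderiv ℝ (φ h v) x u = ∑ k, u k • inner ℂ (ι v) (S k 1 x h) := by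
      conv_lhs => rw [← Finset.univ_sum_single u]
      rw [map_sum]
      refine Finset.sum_congr rfl fun k _ => ?_
      rw [hS.repr k 1 hm x (hrb hx)]
      have : (Pi.single k (u k) : Fin N → ℝ) = u k • Pi.single k 1 := by
        rw [← Pi.single_smul, smul_eq_mul, mul_one]
      rw [this, map_smul]
      rfl
    rw [e, Finset.sum_mul, Finset.sum_mul, Finset.sum_mul]
    refine (norm_sum_le _ _).trans (Finset.sum_le_sum fun k _ => ?_)
    rw [norm_smul]
    have h5 : ‖(inner ℂ (ι v) (S k 1 x h) : ℂ)‖ ≤ ‖ι v‖ * (c k * ‖h‖) :=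
      (norm_inner_le_norm _ _).trans (mul_le_mul_of_nonneg_left
        ((S k 1 x).le_of_opNorm_le (hc k x hx) h) (norm_nonneg _))
    calc ‖u k‖ * ‖(inner ℂ (ι v) (S k 1 x h) : ℂ)‖ ≤ ‖u‖ * (‖ι v‖ * (c k * ‖h‖)) :=
          mul_le_mul (norm_le_pi_norm u k) h5 (norm_nonneg _) (norm_nonneg _)
      _ = c k * ‖h‖ * ‖ι v‖ * ‖u‖ := by ring
  have h6 := (convex_closedBall z r).norm_image_sub_le_of_norm_fderiv_le (𝕜 := ℝ)
    (fun x _ => hdiff x) hbd hzr hy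
  rw [sub_apply, inner_sub_right, hS.repr j 0 (Nat.zero_le _) y (hrb hy),
    hS.repr j 0 (Nat.zero_le _) z hz]
  refine h6.trans (le_of_eq ?_)
  ring

end CoeffFamily

end Coefficients

/-! ### Inverses of operator families -/

section InverseFamily

open Filter Topology
open scoped NNReal

variable {N : ℕ} {V H : Type*} [NormedAddCommGroup V] [InnerProductSpace ℂ V] [CompleteSpace V]
  [NormedAddCommGroup H] [InnerProductSpace ℂ H] [CompleteSpace H] {ι : V →L[ℂ] H}

theorem isUnit_of_surjective_of_bound {T : H →L[ℂ] H} (hs : Function.Surjective T) {M : ℝ}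
    (hb : ∀ h, ‖h‖ ≤ M * ‖T h‖) : IsUnit T := by
  rw [ContinuousLinearMap.isUnit_iff_bijective]
  refine ⟨(injective_iff_map_eq_zero T).2 fun h hh => ?_, hs⟩
  have := hb h
  rw [hh, norm_zero, mul_zero] at this
  exact norm_le_zero_iff.1 this

theorem norm_inverse_le_of_bound {T : H →L[ℂ] H} (hT : IsUnit T) {M : ℝ} (hM : 0 ≤ M)
    (hb : ∀ h, ‖h‖ ≤ M * ‖T h‖) : ‖Ring.inverse T‖ ≤ M := by
  refine ContinuousLinearMap.opNorm_le_bound _ hM fun x => ?_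
  have h1 := hb (Ring.inverse T x)
  have h2 : T (Ring.inverse T x) = x := by
    rw [← mul_apply_eq_comp, Ring.mul_inverse_cancel _ hT, one_apply_eq_self]
  rwa [h2] at h1

/-- An operator family which is invertible with bounded inverses on a dense set is invertible. -/
theorem isUnit_family {d : Fin N → CompLaw} {μ : Measure (Fin N → ℝ)} (hμ : IsJointLaw d μ)
    {Q : (Fin N → ℝ) → H →L[ℂ] H} (hQ : ContinuousOn Q (box d)) {M : ℝ} (hM : 0 ≤ M)
    (h : ∀ᵐ z ∂μ, Function.Surjective (Q z) ∧ ∀ x, ‖x‖ ≤ M * ‖Q z x‖) {z : Fin N → ℝ}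
    (hz : z ∈ box d) : IsUnit (Q z) ∧ ∀ x, ‖x‖ ≤ M * ‖Q z x‖ := by
  have hcl := hμ.dense_of_ae h hz
  have hcz : ContinuousAt Q z := hQ.continuousAt ((isOpen_box d).mem_nhds hz)
  constructor
  · rcases subsingleton_or_nontrivial H with hH | hH
    · have : Subsingleton (H →L[ℂ] H) := ⟨fun a b => ContinuousLinearMap.ext fun x =>
        Subsingleton.elim _ _⟩
      exact isUnit_of_subsingleton _
    have hball := hcz (Metric.ball_mem_nhds (Q z) (ε := (M + 1)⁻¹) (by positivity))
    obtain ⟨y, hy, -, hs, hb⟩ := mem_closure_iff_nhds.1 hcl _ hball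
    obtain ⟨u, hu⟩ := isUnit_of_surjective_of_bound hs hb
    have h1 : ‖((u⁻¹ : (H →L[ℂ] H)ˣ) : H →L[ℂ] H)‖ ≤ M := by
      have := norm_inverse_le_of_bound ⟨u, hu⟩ hM hb
      rwa [← hu, Ring.inverse_unit] at this
    have h2 : 0 < ‖((u⁻¹ : (H →L[ℂ] H)ˣ) : H →L[ℂ] H)‖ := norm_pos_iff.2 (u⁻¹).ne_zero
    have h3 : ‖Q z - u‖ < ‖((u⁻¹ : (H →L[ℂ] H)ˣ) : H →L[ℂ] H)‖⁻¹ := by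
      rw [hu, norm_sub_rev, ← dist_eq_norm]
      refine lt_of_lt_of_le hy ?_
      rw [inv_le_inv₀ (by positivity) h2]
      linarith
    exact (u.ofNearby (Q z) h3).isUnit
  · intro x
    by_contra hx
    push Not at hx
    have hc : ContinuousAt (fun y => M * ‖Q y x‖) z :=
      ((hcz.clm_apply continuousAt_const).norm).const_mul M
    obtain ⟨y, hy, -, -, hb⟩ := mem_closure_iff_nhds.1 hcl _ (hc (Iio_mem_nhds hx))
    exact (hb x).not_gt hy

theorem CoeffFamily.continuousAt_norm {d : Fin N → CompLaw} {m : ℕ}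
    {φ : H → V → (Fin N → ℝ) → ℂ}
    {C : ℝ≥0} {S : Fin N → ℕ → (Fin N → ℝ) → H →L[ℂ] H} (hS : CoeffFamily d ι m φ C S)
    (hd : DenseRange ι) (hm : 1 ≤ m) (j : Fin N) {z : Fin N → ℝ} (hz : z ∈ box d) :
    ContinuousAt (S j 0) z := by
  obtain ⟨L, hL⟩ := hS.locally_lipschitz hd hm j hz
  rw [ContinuousAt, tendsto_iff_norm_sub_tendsto_zero]
  have h0 : Tendsto (fun y => L * ‖y - z‖) (𝓝 z) (𝓝 (L * ‖z - z‖)) := by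
    refine Tendsto.const_mul _ (Tendsto.norm ?_)
    exact tendsto_id.sub_const z
  rw [sub_self, norm_zero, mul_zero] at h0
  exact squeeze_zero' (Eventually.of_forall fun _ => norm_nonneg _)
    (hL.mono fun y hy => hy.2) h0

/-- The inverses of a family `B + S`, where `S` has weak derivatives. -/
theorem CoeffFamily.opDeriv_inverse {d : Fin N → CompLaw} {m : ℕ} {φ : H → V → (Fin N → ℝ) → ℂ}
    {C : ℝ≥0} {S : Fin N → ℕ → (Fin N → ℝ) → H →L[ℂ] H} (hS : CoeffFamily d ι m φ C S)
    (hd : DenseRange ι) (hm : 1 ≤ m) (j₀ j : Fin N) (B : H →L[ℂ] H) {M : ℝ}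
    (hu : ∀ z ∈ box d, IsUnit (B + S j₀ 0 z))
    (hM : ∀ z ∈ box d, ‖Ring.inverse (B + S j₀ 0 z)‖ ≤ M) :
    OpDeriv (box d) j ι (fun z => Ring.inverse (B + S j₀ 0 z))
      (fun z => -(Ring.inverse (B + S j₀ 0 z) ∘L S j 1 z ∘L Ring.inverse (B + S j₀ 0 z))) := by
  set Q : (Fin N → ℝ) → H →L[ℂ] H := fun z => Ring.inverse (B + S j₀ 0 z) with hQ
  have hS0 : ∀ z ∈ box d, S j₀ 0 z = S j 0 z := by
    intro z hz
    ext h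
    refine inner_ext_denseRange hd fun v => ?_
    rw [hS.repr j₀ 0 (Nat.zero_le _) z hz, hS.repr j 0 (Nat.zero_le _) z hz]
    rfl
  have hSc : ∀ z ∈ box d, ContinuousAt (S j₀ 0) z := fun z hz => hS.continuousAt_norm hd hm j₀ hz
  have hQc : ∀ z ∈ box d, ContinuousAt Q z := by
    intro z hz
    obtain ⟨u, hu'⟩ := hu z hz
    have h1 := NormedRing.inverse_continuousAt u
    rw [hu'] at h1
    exact ContinuousAt.comp (f := fun z => B + S j₀ 0 z) h1 (continuousAt_const.add (hSc z hz))
  -- The left factor `Q` is moved onto the test vector as its adjoint, where it converges in norm.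
  -- The middle factor, a difference quotient of `S`, then need only converge weakly.
  have hadj : ∀ z ∈ box d, ∀ v, ContinuousAt (fun y => (Q y).adjoint (ι v)) z := fun z hz v =>
    ((ContinuousLinearMap.adjoint.continuous.continuousAt).comp (hQc z hz)).clm_apply
      continuousAt_const
  have hbl : ∀ z ∈ box d, ∃ c, ∀ᶠ y in 𝓝 z, ‖S j 1 y‖ ≤ c := by
    intro z hz
    obtain ⟨r, hr, hrb⟩ := Metric.nhds_basis_closedBall.mem_iff.1 ((isOpen_box d).mem_nhds hz)
    obtain ⟨c, hc⟩ := hS.exists_bound (j := j) hm _ (isCompact_closedBall z r) hrb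
    exact ⟨c, by filter_upwards [Metric.closedBall_mem_nhds z hr] with y hy using hc y hy⟩
  refine ⟨fun v h z hz => ?_, fun v h z hz => ?_, fun v h z hz => ?_, fun K hK hKb =>
    ⟨M, fun z hz => hM z (hKb hz)⟩, fun K hK hKb => ?_⟩
  · exact (ContinuousAt.inner (𝕜 := ℂ) continuousAt_const
      ((hQc z hz).clm_apply continuousAt_const)).continuousWithinAt
  · obtain ⟨c, hc⟩ := hbl z hz
    have h1 := tendsto_inner_op hd (hadj z hz v) (T := fun y => S j 1 y) (T₀ := S j 1 z) hc
      (fun v h => (hS.continuousOn hm v h).continuousAt ((isOpen_box d).mem_nhds hz))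
      (h := fun y => Q y h) ((hQc z hz).clm_apply continuousAt_const)
    refine ContinuousAt.continuousWithinAt ?_
    have e : ∀ y, (inner ℂ (ι v) ((-(Q y ∘L S j 1 y ∘L Q y)) h) : ℂ)
        = -inner ℂ ((Q y).adjoint (ι v)) (S j 1 y (Q y h)) := by
      intro y
      rw [ContinuousLinearMap.adjoint_inner_left, ← inner_neg_right]
      rfl
    have h2 := h1.neg
    simp only [← e] at h2
    exact h2
  · set e : Fin N → ℝ := Pi.single j 1 with he
    have hline : Tendsto (fun t : ℝ => z + t • e) (𝓝 0) (𝓝 z) := by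
      have : Continuous fun t : ℝ => z + t • e := by fun_prop
      have h0 := this.tendsto 0
      rwa [zero_smul, add_zero] at h0
    have hline' : Tendsto (fun t : ℝ => z + t • e) (𝓝[≠] 0) (𝓝 z) :=
      hline.mono_left nhdsWithin_le_nhds
    obtain ⟨L, hL⟩ := hS.locally_lipschitz hd hm j₀ hz
    have hLt := hline'.eventually hL
    let T : ℝ → H →L[ℂ] H := fun t => ((t⁻¹ : ℝ) : ℂ) • (S j₀ 0 (z + t • e) - S j₀ 0 z)
    have hTb : ∀ᶠ t in 𝓝[≠] (0 : ℝ), ‖T t‖ ≤ L * ‖e‖ := by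
      filter_upwards [hLt, self_mem_nhdsWithin] with t ht ht0
      have h1 := ht.2
      rw [add_sub_cancel_left, norm_smul] at h1
      rw [norm_smul, Complex.norm_real, norm_inv, inv_mul_le_iff₀ (norm_pos_iff.2 ht0)]
      refine h1.trans (le_of_eq ?_)
      ring
    have hTw : ∀ v h, Tendsto (fun t => (inner ℂ (ι v) (T t h) : ℂ)) (𝓝[≠] 0)
        (𝓝 (inner ℂ (ι v) (S j 1 z h))) := by
      intro v h
      have h1 := hasDerivAt_iff_tendsto_slope_zero.1 ((hS.opDeriv (j := j) (i := 0) hm).deriv v h z hz)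
      refine h1.congr' ?_
      filter_upwards [hLt] with t ht
      simp only [T, zero_add, zero_smul, add_zero]
      rw [smul_apply, sub_apply, inner_smul_right, inner_sub_right, hS0 _ ht.1, hS0 _ hz,
        Complex.real_smul]
    have h1 := (tendsto_inner_op hd (Tendsto.comp (hadj z hz v) hline') hTb hTw
      (h := fun _ => Q z h) tendsto_const_nhds).neg
    refine hasDerivAt_iff_tendsto_slope_zero.2 ?_
    have e1 : (inner ℂ (ι v) ((-(Q z ∘L S j 1 z ∘L Q z)) h) : ℂ)
        = -inner ℂ ((Q z).adjoint (ι v)) (S j 1 z (Q z h)) := by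
      rw [ContinuousLinearMap.adjoint_inner_left, ← inner_neg_right]
      rfl
    rw [e1]
    refine h1.congr' ?_
    filter_upwards [hLt] with t ht
    simp only [zero_add, zero_smul, add_zero, Function.comp_apply]
    -- The resolvent identity for inverses, in the form `Q' - Q = -Q' (S' - S) Q`.
    have e2 : Q (z + t • e) h - Q z h
        = -(Q (z + t • e) ((S j₀ 0 (z + t • e) - S j₀ 0 z) (Q z h))) := by
      have a1 : (B + S j₀ 0 z) (Q z h) = h := by
        rw [← mul_apply_eq_comp, Ring.mul_inverse_cancel _ (hu z hz), one_apply_eq_self]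
      have a2 : Q (z + t • e) ((B + S j₀ 0 (z + t • e)) (Q z h)) = Q z h := by
        rw [← mul_apply_eq_comp, Ring.inverse_mul_cancel _ (hu _ ht.1), one_apply_eq_self]
      have a3 : (S j₀ 0 (z + t • e) - S j₀ 0 z) (Q z h)
          = (B + S j₀ 0 (z + t • e)) (Q z h) - (B + S j₀ 0 z) (Q z h) := by
        rw [add_apply, add_apply, sub_apply]
        abel
      rw [a3, map_sub, a2, a1]
      abel
    rw [← inner_sub_right, e2, inner_neg_right, ContinuousLinearMap.adjoint_inner_left, smul_neg]
    simp only [T]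
    rw [smul_apply, map_smul, inner_smul_right, Complex.real_smul]
  · obtain ⟨c, hc⟩ := hS.exists_bound (j := j) hm K hK hKb
    refine ⟨M * (c * M), fun z hz => ?_⟩
    have h0 : 0 ≤ M := (norm_nonneg _).trans (hM z (hKb hz))
    have h1 : 0 ≤ c := (norm_nonneg _).trans (hc z hz)
    rw [norm_neg]
    refine (ContinuousLinearMap.opNorm_comp_le _ _).trans
      (mul_le_mul (hM z (hKb hz)) ?_ (norm_nonneg _) h0)
    exact (ContinuousLinearMap.opNorm_comp_le _ _).trans
      (mul_le_mul (hc z hz) (hM z (hKb hz)) (norm_nonneg _) h1)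

end InverseFamily

/-! ### Quotients of the form operators -/

section Quotient

open Filter Topology
open scoped NNReal

variable {N : ℕ} {V H : Type*} [NormedAddCommGroup V] [InnerProductSpace ℂ V] [CompleteSpace V]
  [NormedAddCommGroup H] [InnerProductSpace ℂ H] [CompleteSpace H] {ι : V →L[ℂ] H}

/-- A bounded self-adjoint injective operator has dense range. -/
theorem denseRange_of_nonneg_of_injective {B : H →L[ℂ] H} (hB : 0 ≤ B)
    (hi : Function.Injective B) : DenseRange B := by
  have hsym : ∀ x y, inner ℂ (B x) y = inner ℂ x (B y) := fun x y =>
    ((ContinuousLinearMap.nonneg_iff_isPositive B).1 hB).isSymmetric x y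
  have h1 : B.toLinearMap.rangeᗮ = ⊥ := by
    rw [Submodule.eq_bot_iff]
    intro x hx
    refine hi ((ext_inner_left ℂ fun k => ?_).trans (map_zero B).symm)
    rw [inner_zero_right, ← hsym]
    exact (Submodule.mem_orthogonal _ _).1 hx _ ⟨k, rfl⟩
  have h2 := Submodule.topologicalClosure_eq_top_iff.2 h1
  rw [← Submodule.dense_iff_topologicalClosure_eq_top] at h2
  exact h2

/-- The operator `lam B₀ + T`, where `B₀` inverts one form operator and `T` is the product of
another one with `B₀`. -/
theorem IsEllipticForm.surjective_and_bound {K κ : ℝ} {b : V →ₗ[ℂ] V →ₗ⋆[ℂ] ℂ}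
    (hb : IsEllipticForm K κ b) (hκ : 0 < κ) (hι : Function.Injective ι) (hd : DenseRange ι)
    {q : ℝ} (hq0 : 0 ≤ q) (hq1 : q < 1) {lam : ℂ} (hlam : -q * ‖lam‖ ≤ lam.re)
    {G₀ G T : H →L[ℂ] H} {g₀ : H →L[ℂ] V} (hg₀ : G₀ = ι ∘L g₀) (hG₀ : 0 ≤ G₀)
    (hi : Function.Injective G₀) (hG : 0 ≤ G)
    (hsol : ∀ u g, (∀ v, b u v = inner ℂ (ι v) g) → ι u = G g)
    (hran : ∀ u g, (∀ v, b u v = inner ℂ (ι v) g) → ∃ h, G₀ h = ι u)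
    {M : ℝ} (hM : ∀ k, ‖G k‖ ≤ M * ‖G₀ k‖)
    (hT : ∀ h v, inner ℂ (ι v) (T h) = b (g₀ h) v) :
    Function.Surjective (lam • G₀ + T) ∧
      ∀ x, ‖x‖ ≤ M * (1 + (√((1 - q) / 2))⁻¹) * ‖(lam • G₀ + T) x‖ := by
  constructor
  -- Solve the variational problem; its solution lies in the operator domain, hence in the range of
  -- `G₀`, and its preimage solves the factored equation.
  · obtain ⟨S, hS⟩ := hb.exists_solver hκ ι hq0 hq1 hlam
    intro f
    have h1 : ∀ v, b (S f) v = inner ℂ (ι v) (f - lam • ι (S f)) := fun v => by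
      rw [inner_sub_right, inner_smul_right, ← hS f v, add_sub_cancel_left]
    obtain ⟨h, hh⟩ := hran _ _ h1
    refine ⟨h, inner_ext_denseRange hd fun v => ?_⟩
    have h2 : g₀ h = S f := hι (by rw [← hh, hg₀]; rfl)
    rw [add_apply, smul_apply, inner_add_right, inner_smul_right, hT, h2, hh, hS]
  · intro x
    have hx : ∀ v, b (g₀ x) v = inner ℂ (ι v) (T x) := fun v => (hT x v).symm
    have hG₀x : G₀ x = ι (g₀ x) := by rw [hg₀]; rfl
    have h1 := hsol _ _ hx
    rw [← hG₀x] at h1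
    have h2 : ‖lam‖ * ‖ι (g₀ x)‖ ≤ (√((1 - q) / 2))⁻¹ * ‖(lam • G₀ + T) x‖ :=
      hb.norm_solution_le hκ ι hq0 hq1 hlam (by
        rw [add_apply, smul_apply, inner_add_right, inner_smul_right, hT, hG₀x])
    have h3 : ‖T x‖ ≤ (1 + (√((1 - q) / 2))⁻¹) * ‖(lam • G₀ + T) x‖ := by
      have e : T x = (lam • G₀ + T) x - lam • ι (g₀ x) := by
        rw [add_apply, smul_apply, hG₀x, add_sub_cancel_left]
      calc ‖T x‖ ≤ ‖(lam • G₀ + T) x‖ + ‖lam • ι (g₀ x)‖ := by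
            conv_lhs => rw [e]
            exact norm_sub_le _ _
        _ ≤ _ := by rw [norm_smul]; linarith
    have hs₀ : ∀ x y, inner ℂ (G₀ x) y = inner ℂ x (G₀ y) := fun x y =>
      ((ContinuousLinearMap.nonneg_iff_isPositive G₀).1 hG₀).isSymmetric x y
    have hs : ∀ x y, inner ℂ (G x) y = inner ℂ x (G y) := fun x y =>
      ((ContinuousLinearMap.nonneg_iff_isPositive G).1 hG).isSymmetric x y
    -- On the dense range of `G₀`, symmetry and `G₀ x = G (T x)` give `(G₀ k | x) = (k | G (T x)) =
    -- (G k | T x)`. This converts the comparison of the inverses into a lower bound for `T`.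
    have h4 : ∀ y, ‖(inner ℂ y x : ℂ)‖ ≤ M * ‖T x‖ * ‖y‖ := by
      intro y
      refine (denseRange_of_nonneg_of_injective hG₀ hi).induction_on
        (p := fun y => ‖(inner ℂ y x : ℂ)‖ ≤ M * ‖T x‖ * ‖y‖) y ?_ fun k => ?_
      · exact isClosed_le (by fun_prop) (by fun_prop)
      · rw [hs₀, h1, ← hs]
        refine (norm_inner_le_norm _ _).trans ?_
        calc ‖G k‖ * ‖T x‖ ≤ M * ‖G₀ k‖ * ‖T x‖ :=
              mul_le_mul_of_nonneg_right (hM k) (norm_nonneg _)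
          _ = _ := by ring
    by_cases hx0 : x = 0
    · simp [hx0]
    have hM0 : 0 ≤ M := by
      have h6 := hM x
      have h7 : 0 < ‖G₀ x‖ := norm_pos_iff.2 fun h => hx0 (hi (h.trans (map_zero _).symm))
      by_contra h8
      push Not at h8
      exact absurd (h6.trans_lt (mul_neg_of_neg_of_pos h8 h7)) (norm_nonneg _).not_gt
    have h5 := h4 x
    rw [inner_self_eq_norm_sq_to_K] at h5
    have h6 : ‖((‖x‖ : ℂ)) ^ 2‖ = ‖x‖ * ‖x‖ := by simp [pow_two]
    erw [h6] at h5
    have h7 := le_of_mul_le_mul_right h5 (norm_pos_iff.2 hx0)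
    rw [mul_assoc]
    exact h7.trans (mul_le_mul_of_nonneg_left h3 hM0)

/-- The data that turn the resolvents of the form operators into smooth operator families:
`(lam + A_z)⁻¹ = B₀ (lam B₀ + S_z)⁻¹` with `B₀ = ι ∘ g₀` and `S_z = A_z B₀`. -/
structure QuotientFamily (d : Fin N → CompLaw) (μ : Measure (Fin N → ℝ)) (ι : V →L[ℂ] H)
    (a : (Fin N → ℝ) → V →ₗ[ℂ] V →ₗ⋆[ℂ] ℂ) (K κ : ℝ) (q : ℝ) (m : ℕ) (g₀ : H →L[ℂ] V) (C M : ℝ≥0)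
    (S : Fin N → ℕ → (Fin N → ℝ) → H →L[ℂ] H) : Prop where
  law : IsJointLaw d μ
  inj : Function.Injective ι
  dense : DenseRange ι
  elliptic : ∀ᵐ z ∂μ, IsEllipticForm K κ (a z)
  pos : 0 < κ
  continuous : ∀ u v, Continuous fun z => a z u v
  nonneg : 0 ≤ q
  lt_one : q < 1
  coeff : CoeffFamily d ι m (fun h v z => a z (g₀ h) v) C S
  isUnit : ∀ lam : ℂ, -q * ‖lam‖ ≤ lam.re → ∀ j, ∀ z ∈ box d,
    IsUnit (lam • (ι ∘L g₀) + S j 0 z)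
  norm_inverse : ∀ lam : ℂ, -q * ‖lam‖ ≤ lam.re → ∀ j, ∀ z ∈ box d,
    ‖Ring.inverse (lam • (ι ∘L g₀) + S j 0 z)‖ ≤ M

/-- The map `h ↦ A_{z₀}⁻¹ h` sends the norm of `H` to the graph norm, so `normD` in the derivative
bound turns into `‖h‖` and the coefficients become operators on `H`. Invertibility is obtained for
almost every `z` and spread over the box by norm continuity. -/
theorem exists_quotientFamily {d : Fin N → CompLaw} {μ : Measure (Fin N → ℝ)}
    (hμ : IsJointLaw d μ) (hι : Function.Injective ι) (hd : DenseRange ι)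
    {a : (Fin N → ℝ) → V →ₗ[ℂ] V →ₗ⋆[ℂ] ℂ} {K κ : ℝ} (hκ : 0 < κ)
    (hell : ∀ᵐ z ∂μ, IsEllipticForm K κ (a z)) {s : ℝ} (hs : 1 ≤ s) {Ds : Submodule ℂ H}
    (hDs : ∀ᵐ z ∂μ, (fracPow (formOperator ι (a z)) s).domain = Ds)
    (hDsnorm : ∃ c : ℝ, ∀ᵐ z ∂μ, ∀ᵐ z' ∂μ,
      ∀ (u : H) (hu : u ∈ (fracPow (formOperator ι (a z)) s).domain)
        (hu' : u ∈ (fracPow (formOperator ι (a z')) s).domain),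
        graphNorm _ ⟨u, hu⟩ ≤ c * graphNorm _ ⟨u, hu'⟩)
    {D : Submodule ℂ H} {normD : D → ℝ} (hD : ∀ᵐ z ∂μ, (formOperator ι (a z)).domain = D)
    (hD0 : ∀ x, 0 ≤ normD x)
    (hDnorm : ∀ᵐ z ∂μ, ∃ c : ℝ,
      ∀ (u : H) (hu : u ∈ D) (hu' : u ∈ (formOperator ι (a z)).domain),
        normD ⟨u, hu⟩ ≤ c * graphNorm _ ⟨u, hu'⟩)
    {m : ℕ} (hm : 1 ≤ m) (hsmooth : ∀ u v, ContDiff ℝ m fun z => a z u v)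
    (hderiv : ∃ C : ℝ, ∀ᵐ z ∂μ, ∀ (u v : V) (hu : ι u ∈ D) (α : Fin N → ℕ),
      ∑ j, α j ≤ m →
      ‖weight d α z • multiDeriv α (fun y => a y u v) z‖ ≤ C * normD ⟨ι u, hu⟩ * ‖ι v‖)
    {q : ℝ} (hq0 : 0 ≤ q) (hq1 : q < 1) :
    ∃ (g₀ : H →L[ℂ] V) (C M : ℝ≥0) (S : Fin N → ℕ → (Fin N → ℝ) → H →L[ℂ] H),
      QuotientFamily d μ ι a K κ q m g₀ C M S := by
  have := hμ.isProbabilityMeasure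
  obtain ⟨c, hc⟩ := hDsnorm
  obtain ⟨C₁, hC₁⟩ := hderiv
  -- The base point. The constant relating `normD` to the graph norm may vary with `z`, but only its
  -- value here matters.
  obtain ⟨z₀, hb₀, hDs₀, hc₀, hD₀, c₀, hc₀'⟩ :=
    (hell.and (hDs.and (hc.and (hD.and hDnorm)))).exists
  obtain ⟨g₀, hg₀, hB₀, hpos₀, hnorm₀, hinj₀, hdom₀, happ₀⟩ := hb₀.exists_inverse hκ hι hd
  have hmem : ∀ h, ι (g₀ h) ∈ (formOperator ι (a z₀)).domain := fun h => (hdom₀ _).2 ⟨h, rfl⟩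
  have hmem' : ∀ h, ι (g₀ h) ∈ D := fun h => hD₀ ▸ hmem h
  have hgn : ∀ h, normD ⟨ι (g₀ h), hmem' h⟩ ≤ |c₀| * (1 + ‖ι ∘L g₀‖) * ‖h‖ := by
    intro h
    refine (hc₀' _ (hmem' h) (hmem h)).trans ?_
    have h1 : graphNorm (formOperator ι (a z₀)) ⟨ι (g₀ h), hmem h⟩ ≤ (1 + ‖ι ∘L g₀‖) * ‖h‖ := by
      rw [graphNorm, happ₀]
      have h2 : ‖ι (g₀ h)‖ ≤ ‖ι ∘L g₀‖ * ‖h‖ := (ι ∘L g₀).le_opNorm h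
      refine Real.sqrt_le_iff.2 ⟨by positivity, ?_⟩
      nlinarith [norm_nonneg h, norm_nonneg (ι (g₀ h)), norm_nonneg (ι ∘L g₀)]
    calc c₀ * graphNorm (formOperator ι (a z₀)) ⟨ι (g₀ h), hmem h⟩
        ≤ |c₀| * graphNorm (formOperator ι (a z₀)) ⟨ι (g₀ h), hmem h⟩ :=
          mul_le_mul_of_nonneg_right (le_abs_self _) (Real.sqrt_nonneg _)
      _ ≤ |c₀| * ((1 + ‖ι ∘L g₀‖) * ‖h‖) := mul_le_mul_of_nonneg_left h1 (abs_nonneg _)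
      _ = _ := by ring
  let C : ℝ≥0 := ⟨|C₁| * (|c₀| * (1 + ‖ι ∘L g₀‖)), by positivity⟩
  obtain ⟨S, hS⟩ := exists_coeffFamily (C := C) (m := m) (φ := fun h v z => a z (g₀ h) v) hμ hd
    (fun h v => by exact_mod_cast hsmooth (g₀ h) v)
    (fun h h' v => by funext z; simp) (fun c h v => by funext z; simp)
    (fun h v v' => by funext z; simp) (fun c h v => by funext z; simp) (by
      filter_upwards [hC₁, hμ.ae_mem_box] with z hz hzb j i hi h v
      have h1 := hz (g₀ h) v (hmem' h) (Pi.single j i) (by simpa using hi)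
      rw [multiDeriv_single, weight_single j i hzb, norm_smul, Real.norm_of_nonneg
        (pow_nonneg (sqrtRho_nonneg d j z) i)] at h1
      refine h1.trans (mul_le_mul_of_nonneg_right ?_ (norm_nonneg _))
      calc C₁ * normD ⟨ι (g₀ h), hmem' h⟩ ≤ |C₁| * normD ⟨ι (g₀ h), hmem' h⟩ :=
            mul_le_mul_of_nonneg_right (le_abs_self _) (hD0 _)
        _ ≤ |C₁| * (|c₀| * (1 + ‖ι ∘L g₀‖) * ‖h‖) :=
            mul_le_mul_of_nonneg_left (hgn h) (abs_nonneg _)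
        _ = C * ‖h‖ := by
            change _ = |C₁| * (|c₀| * (1 + ‖ι ∘L g₀‖)) * ‖h‖
            ring)
  -- The number `‖ι‖² / κ` bounds the inverses of all the form operators, so this comparison
  -- constant depends neither on the parameter nor on `lam`.
  let Mh : ℝ := (|c| * √(1 + ((‖ι‖ * (‖ι‖ / κ)) ^ s) ^ 2)) ^ (1 / s)
  have hMh : 0 ≤ Mh := by positivity
  let M : ℝ≥0 := ⟨Mh * (1 + (√((1 - q) / 2))⁻¹), by positivity⟩
  have key : ∀ lam : ℂ, -q * ‖lam‖ ≤ lam.re → ∀ j, ∀ z ∈ box d,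
      IsUnit (lam • (ι ∘L g₀) + S j 0 z) ∧ ∀ x, ‖x‖ ≤ M * ‖(lam • (ι ∘L g₀) + S j 0 z) x‖ := by
    intro lam hlam j z hz
    refine isUnit_family hμ (Q := fun z => lam • (ι ∘L g₀) + S j 0 z) (M := M) ?_ M.2 ?_ hz
    · exact fun z hz => (continuousAt_const.add
        (hS.continuousAt_norm hd hm j hz)).continuousWithinAt
    · filter_upwards [hell, hDs, hc₀, hD, hμ.ae_mem_box] with z hb hDsz hcz hDz hzb
      obtain ⟨g, hg, hB, hpos, hnorm, hinj, hdom, happ⟩ := hb.exists_inverse hκ hι hd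
      have hsol : ∀ u k, (∀ v, a z u v = inner ℂ (ι v) k) → u = g k := by
        intro u k huk
        refine hb.eq_of_solves hκ ι le_rfl zero_lt_one (lam := 0) (by simp) fun v => ?_
        rw [huk, hg]
        simp
      refine hb.surjective_and_bound hκ hι hd hq0 hq1 hlam (g₀ := g₀) rfl hpos₀ hinj₀ hpos
        (fun u k h => by rw [hsol u k h]; rfl) (fun u k h => ?_) (M := Mh) (fun k => ?_) ?_
      · have : ι u ∈ (formOperator ι (a z)).domain := (hdom _).2 ⟨k, by rw [hsol u k h]⟩
        rw [hDz, ← hD₀] at this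
        exact (hdom₀ _).1 this
      · exact norm_inverse_le_of_graphNorm_le hB₀ hB hpos₀ hpos hinj₀ hinj hnorm hs
          (hDs₀.trans hDsz.symm) hcz k
      · intro h v
        exact hS.repr j 0 (Nat.zero_le _) z hzb h v
  exact ⟨g₀, C, M, S, hμ, hι, hd, hell, hκ, fun u v => (hsmooth u v).continuous, hq0, hq1, hS,
    fun lam hlam j z hz => (key lam hlam j z hz).1, fun lam hlam j z hz =>
      norm_inverse_le_of_bound (key lam hlam j z hz).1 M.2 (key lam hlam j z hz).2⟩

end Quotient

/-! ### The multiplication operator and its resolvent -/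

section MultOperator

open Filter Topology
open scoped NNReal

variable {N : ℕ} {V H : Type*} [NormedAddCommGroup V] [InnerProductSpace ℂ V] [CompleteSpace V]
  [NormedAddCommGroup H] [InnerProductSpace ℂ H] [CompleteSpace H] {ι : V →L[ℂ] H}

/-- A bounded measurable operator family acts on `L₂` by multiplication. -/
theorem exists_multLp {X : Type*} [MeasurableSpace X] {ν : Measure X} {w : Set H} [Countable w]
    (b : HilbertBasis w ℂ H) {T : X → H →L[ℂ] H}
    (hm : ∀ h, AEStronglyMeasurable (fun z => T z h) ν) {M : ℝ}
    (hM : ∀ᵐ z ∂ν, ‖T z‖ ≤ M) :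
    ∃ L : Lp H 2 ν →L[ℂ] Lp H 2 ν, (∀ f : Lp H 2 ν, L f =ᵐ[ν] fun z => T z (f z)) ∧
      ∀ f, ‖L f‖ ≤ M * ‖f‖ := by
  have hb : ∀ f : Lp H 2 ν, ∀ᵐ z ∂ν, ‖T z (f z)‖ ≤ M * ‖f z‖ := fun f => by
    filter_upwards [hM] with z hz
    exact (T z).le_of_opNorm_le hz _
  have hL : ∀ f : Lp H 2 ν, MemLp (fun z => T z (f z)) 2 ν := fun f =>
    (Lp.memLp f).of_le_mul (aestronglyMeasurable_apply b hm (Lp.aestronglyMeasurable f)) (hb f)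
  let L₀ : Lp H 2 ν →ₗ[ℂ] Lp H 2 ν :=
    { toFun := fun f => (hL f).toLp
      map_add' := fun f g => by
        refine Lp.ext ?_
        filter_upwards [(hL (f + g)).coeFn_toLp, (hL f).coeFn_toLp, (hL g).coeFn_toLp,
          Lp.coeFn_add f g, Lp.coeFn_add ((hL f).toLp) ((hL g).toLp)] with z h1 h2 h3 h4 h5
        rw [h1, h5, Pi.add_apply, h2, h3, h4, Pi.add_apply, map_add]
      map_smul' := fun c f => by
        refine Lp.ext ?_
        filter_upwards [(hL (c • f)).coeFn_toLp, (hL f).coeFn_toLp, Lp.coeFn_smul c f,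
          Lp.coeFn_smul c ((hL f).toLp)] with z h1 h2 h3 h4
        rw [h1, RingHom.id_apply, h4, Pi.smul_apply, h2, h3, Pi.smul_apply, map_smul] }
  have hbd : ∀ f, ‖L₀ f‖ ≤ M * ‖f‖ := fun f => by
    refine Lp.norm_le_mul_norm_of_ae_le_mul ?_
    filter_upwards [(hL f).coeFn_toLp, hb f] with z h1 h2
    change ‖((hL f).toLp : X → H) z‖ ≤ _
    rwa [h1]
  exact ⟨L₀.mkContinuous M hbd, fun f => (hL f).coeFn_toLp, hbd⟩

theorem multGraph_singleValued {X : Type*} [MeasurableSpace X] (ν : Measure X)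
    (A : X → H →ₗ.[ℂ] H) (p : Lp H 2 ν × Lp H 2 ν) (hp : p ∈ multGraph ν A) (h0 : p.1 = 0) :
    p.2 = 0 := by
  have hp' : ∀ᵐ z ∂ν, (p.1 z, p.2 z) ∈ (A z).graph := hp
  rw [h0] at hp'
  refine Lp.ext ?_
  filter_upwards [hp', Lp.coeFn_zero H 2 ν] with z h1 h2
  rw [h2] at h1 ⊢
  exact (A z).graph_fst_eq_zero_snd h1 rfl

theorem isShiftInverse_multOperator {X : Type*} [MeasurableSpace X] {ν : Measure X}
    {A : X → H →ₗ.[ℂ] H} {lam : ℂ} {W : X → H →L[ℂ] H}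
    (hW : ∀ᵐ z ∂ν, IsShiftInverse (A z) lam (W z)) {R : Lp H 2 ν →L[ℂ] Lp H 2 ν}
    (hR : ∀ f : Lp H 2 ν, R f =ᵐ[ν] fun z => W z (f z)) :
    IsShiftInverse (multOperator ν A) lam R := by
  unfold multOperator
  refine isShiftInverse_of_graph (g := multGraph ν A) ?_ (fun f => ?_) ?_
  · exact fun p hp h0 => multGraph_singleValued ν A p hp h0
  · change ∀ᵐ z ∂ν, (R f z, (f - lam • R f : Lp H 2 ν) z) ∈ (A z).graph
    filter_upwards [hW, hR f, Lp.coeFn_sub f (lam • R f), Lp.coeFn_smul lam (R f)]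
      with z hz h1 h2 h3
    rw [h2, Pi.sub_apply, h3, Pi.smul_apply, h1]
    obtain ⟨h4, h5⟩ := hz.1 (f z)
    have h6 := (A z).mem_graph ⟨_, h4⟩
    rwa [← eq_sub_of_add_eq' h5]
  · rintro ⟨x, y⟩ hx
    have hx' : ∀ᵐ z ∂ν, (x z, y z) ∈ (A z).graph := hx
    refine Lp.ext ?_
    filter_upwards [hW, hx', hR (lam • x + y), Lp.coeFn_add (lam • x) y, Lp.coeFn_smul lam x]
      with z hz h1 h2 h3 h4
    obtain ⟨u, hu, hu'⟩ := (LinearPMap.mem_graph_iff _).1 h1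
    dsimp only at hu hu'
    rw [h2, h3, Pi.add_apply, h4, Pi.smul_apply, ← hu, ← hu']
    exact hz.2 u

namespace QuotientFamily

variable {d : Fin N → CompLaw} {μ : Measure (Fin N → ℝ)}
  {a : (Fin N → ℝ) → V →ₗ[ℂ] V →ₗ⋆[ℂ] ℂ} {K κ q : ℝ} {m : ℕ} {g₀ : H →L[ℂ] V} {C M : ℝ≥0}
  {S : Fin N → ℕ → (Fin N → ℝ) → H →L[ℂ] H}

theorem inner_apply (hQ : QuotientFamily d μ ι a K κ q m g₀ C M S) (j : Fin N) {z : Fin N → ℝ}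
    (hz : z ∈ box d) (h : H) (v : V) : inner ℂ (ι v) (S j 0 z h) = a z (g₀ h) v :=
  hQ.coeff.repr j 0 (Nat.zero_le _) z hz h v

theorem opDeriv_inverse (hQ : QuotientFamily d μ ι a K κ q m g₀ C M S) (hm : 1 ≤ m)
    (j₀ j : Fin N) {lam : ℂ} (hlam : -q * ‖lam‖ ≤ lam.re) :
    OpDeriv (box d) j ι (fun z => Ring.inverse (lam • (ι ∘L g₀) + S j₀ 0 z))
      (fun z => -(Ring.inverse (lam • (ι ∘L g₀) + S j₀ 0 z) ∘L S j 1 z ∘L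
        Ring.inverse (lam • (ι ∘L g₀) + S j₀ 0 z))) :=
  hQ.coeff.opDeriv_inverse hQ.dense hm j₀ j _ (hQ.isUnit lam hlam j₀)
    (hQ.norm_inverse lam hlam j₀)

variable [TopologicalSpace.SeparableSpace H]

theorem exists_coeffLp (hQ : QuotientFamily d μ ι a K κ q m g₀ C M S) (j₀ : Fin N) :
    ∃ T : Lp H 2 μ →L[ℂ] Lp H 2 μ, (∀ f : Lp H 2 μ, T f =ᵐ[μ] fun z => S j₀ 0 z (f z)) ∧
      ∀ f, ‖T f‖ ≤ C * ‖f‖ := by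
  obtain ⟨w, hw, ⟨b⟩⟩ := exists_countable_hilbertBasis H
  have := hw.to_subtype
  refine exists_multLp b (fun h => ?_) ?_
  · exact (aestronglyMeasurable_op b hQ.dense (isOpen_box d)
      (fun v h => hQ.coeff.continuousOn (Nat.zero_le _) v h) h).mono_ac hQ.law.absolutelyContinuous
  · filter_upwards [hQ.law.ae_mem_box] with z hz
    simpa using hQ.coeff.bound j₀ 0 (Nat.zero_le _) z hz

theorem exists_inverseLp (hQ : QuotientFamily d μ ι a K κ q m g₀ C M S) (hm : 1 ≤ m)
    (j₀ : Fin N) {lam : ℂ} (hlam : -q * ‖lam‖ ≤ lam.re) :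
    ∃ Y : Lp H 2 μ →L[ℂ] Lp H 2 μ,
      ∀ f : Lp H 2 μ, Y f =ᵐ[μ] fun z => Ring.inverse (lam • (ι ∘L g₀) + S j₀ 0 z) (f z) := by
  obtain ⟨w, hw, ⟨b⟩⟩ := exists_countable_hilbertBasis H
  have := hw.to_subtype
  refine (exists_multLp (ν := μ) b
    (T := fun z => Ring.inverse (lam • (ι ∘L g₀) + S j₀ 0 z)) (M := M) (fun h => ?_) ?_).imp
    fun Y hY => hY.1
  · exact (aestronglyMeasurable_op b hQ.dense (isOpen_box d)
      (hQ.opDeriv_inverse hm j₀ j₀ hlam).cont h).mono_ac hQ.law.absolutelyContinuous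
  · filter_upwards [hQ.law.ae_mem_box] with z hz
    exact hQ.norm_inverse lam hlam j₀ z hz

theorem apply_inverse (hQ : QuotientFamily d μ ι a K κ q m g₀ C M S) (j₀ : Fin N) {lam : ℂ}
    (hlam : -q * ‖lam‖ ≤ lam.re) {z : Fin N → ℝ} (hz : z ∈ box d) (f : H) :
    lam • ι (g₀ (Ring.inverse (lam • (ι ∘L g₀) + S j₀ 0 z) f)) +
      S j₀ 0 z (Ring.inverse (lam • (ι ∘L g₀) + S j₀ 0 z) f) = f := by
  change (lam • (ι ∘L g₀) + S j₀ 0 z) (Ring.inverse (lam • (ι ∘L g₀) + S j₀ 0 z) f) = f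
  rw [← mul_apply_eq_comp, Ring.mul_inverse_cancel _ (hQ.isUnit lam hlam j₀ z hz),
    one_apply_eq_self]

theorem isShiftInverse_multOperator (hQ : QuotientFamily d μ ι a K κ q m g₀ C M S)
    (j₀ : Fin N) {lam : ℂ} (hlam : -q * ‖lam‖ ≤ lam.re) {Y : Lp H 2 μ →L[ℂ] Lp H 2 μ}
    (hY : ∀ f : Lp H 2 μ, Y f =ᵐ[μ] fun z => Ring.inverse (lam • (ι ∘L g₀) + S j₀ 0 z) (f z)) :
    IsShiftInverse (multOperator μ fun z => formOperator ι (a z)) lam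
      ((ι ∘L g₀).compLpL 2 μ ∘L Y) := by
  refine RandomEvolution.isShiftInverse_multOperator
    (W := fun z => ι ∘L (g₀ ∘L Ring.inverse (lam • (ι ∘L g₀) + S j₀ 0 z))) ?_ fun f => ?_
  · filter_upwards [hQ.elliptic, hQ.law.ae_mem_box] with z hb hz
    refine hb.isShiftInverse hQ.pos hQ.inj hQ.dense hQ.nonneg hQ.lt_one hlam fun f v => ?_
    rw [ContinuousLinearMap.comp_apply, ← hQ.inner_apply j₀ hz, ← inner_smul_right,
      ← inner_add_right, hQ.apply_inverse j₀ hlam hz]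
  · filter_upwards [hY f, (ι ∘L g₀).coeFn_compLpL (p := 2) (μ := μ) (Y f)] with z h1 h2
    rw [ContinuousLinearMap.comp_apply, h2, h1]
    rfl

/-- The functions `(lam B₀ + S)⁻¹ f` inherit the Sobolev regularity of `f`. -/
theorem weightedReg_inverse (hQ : QuotientFamily d μ ι a K κ q m g₀ C M S) (hm : 1 ≤ m)
    (j₀ : Fin N) {lam : ℂ} (hlam : -q * ‖lam‖ ≤ lam.re) {f : (Fin N → ℝ) → H} {B : ℝ≥0∞}
    (j : Fin N) (hf : WeightedReg d μ j m 0 f B) :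
    WeightedReg d μ j m 0 (fun z => Ring.inverse (lam • (ι ∘L g₀) + S j₀ 0 z) (f z))
      (invConst M C m * B) := by
  obtain ⟨w, hw, ⟨b⟩⟩ := exists_countable_hilbertBasis H
  have := hw.to_subtype
  exact WeightedReg.inverse (F := fun k => S j k) hQ.law b hQ.dense (fun k hk => hQ.coeff.opDeriv hk)
    (fun k hk v h => hQ.coeff.continuousOn hk v h) (fun k hk => hQ.coeff.bound j k hk)
    (hQ.norm_inverse lam hlam j₀) (hQ.opDeriv_inverse hm j₀ j hlam) le_rfl hf

end QuotientFamily

end MultOperator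

/-! ### The spaces of polynomials -/

section ChaosSpace

open Filter Topology
open scoped NNReal

variable {N : ℕ} {W : Type*} [NormedAddCommGroup W] [InnerProductSpace ℂ W]

section Tensor

variable {X : Type*} [MeasurableSpace X] {ν : Measure X}

/-- The operator `v ↦ φ ⊗ v`. -/
def tensorOp (W : Type*) [NormedAddCommGroup W] [InnerProductSpace ℂ W] (φ : Lp ℝ 2 ν) :
    W →L[ℂ] Lp W 2 ν :=
  LinearMap.mkContinuous
    { toFun := fun v => tensorLp (Lp.memLp φ) v
      map_add' := fun v w => Lp.ext (by
        filter_upwards [coeFn_tensorLp (Lp.memLp φ) (v + w), coeFn_tensorLp (Lp.memLp φ) v,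
          coeFn_tensorLp (Lp.memLp φ) w, Lp.coeFn_add (tensorLp (Lp.memLp φ) v)
            (tensorLp (Lp.memLp φ) w)] with z h1 h2 h3 h4
        rw [h1, h4, Pi.add_apply, h2, h3, smul_add])
      map_smul' := fun c v => Lp.ext (by
        filter_upwards [coeFn_tensorLp (Lp.memLp φ) (c • v), coeFn_tensorLp (Lp.memLp φ) v,
          Lp.coeFn_smul c (tensorLp (Lp.memLp φ) v)] with z h1 h2 h4
        rw [h1, RingHom.id_apply, h4, Pi.smul_apply, h2, smul_comm]) } ‖φ‖ fun v => by
      have h : ‖tensorLp (Lp.memLp φ) v‖ ≤ ‖v‖ * ‖φ‖ := by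
        refine Lp.norm_le_mul_norm_of_ae_le_mul ?_
        filter_upwards [coeFn_tensorLp (Lp.memLp φ) v] with z h1
        rw [h1, norm_smul, mul_comm]
      rw [mul_comm]
      exact h

theorem coeFn_tensorOp (φ : Lp ℝ 2 ν) (v : W) : tensorOp W φ v =ᵐ[ν] fun z => φ z • v :=
  coeFn_tensorLp (Lp.memLp φ) v

theorem tensorOp_add (φ ψ : Lp ℝ 2 ν) : tensorOp W (φ + ψ) = tensorOp W φ + tensorOp W ψ := by
  ext1 v
  refine Lp.ext ?_
  rw [add_apply]
  filter_upwards [coeFn_tensorOp (φ + ψ) v, coeFn_tensorOp φ v, coeFn_tensorOp ψ v,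
    Lp.coeFn_add φ ψ, Lp.coeFn_add (tensorOp W φ v) (tensorOp W ψ v)] with z h1 h2 h3 h4 h5
  rw [h1, h5, Pi.add_apply, h2, h3, h4, Pi.add_apply, add_smul]

theorem tensorOp_smul (t : ℝ) (φ : Lp ℝ 2 ν) : tensorOp W (t • φ) = (t : ℂ) • tensorOp W φ := by
  ext1 v
  refine Lp.ext ?_
  rw [smul_apply]
  filter_upwards [coeFn_tensorOp (t • φ) v, coeFn_tensorOp φ v,
    Lp.coeFn_smul t φ, Lp.coeFn_smul (t : ℂ) (tensorOp W φ v)] with z h1 h2 h4 h5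
  rw [h1, h5, Pi.smul_apply, h2, h4, Pi.smul_apply, smul_eq_mul, mul_smul, Complex.coe_smul]

theorem tensorOp_zero : tensorOp W (0 : Lp ℝ 2 ν) = 0 := by
  have := tensorOp_smul (W := W) 0 (0 : Lp ℝ 2 ν)
  rwa [zero_smul, Complex.ofReal_zero, zero_smul] at this

variable [CompleteSpace W]

theorem inner_tensorOp (φ : Lp ℝ 2 ν) (v : W) (f : Lp W 2 ν) :
    inner ℂ (tensorOp W φ v) f = inner ℂ v (∫ z, φ z • f z ∂ν) :=
  inner_tensorLp (Lp.memLp φ) v f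

theorem adjoint_tensorOp_apply (φ ψ : Lp ℝ 2 ν) (v : W) :
    ContinuousLinearMap.adjoint (tensorOp W φ) (tensorOp W ψ v) = (inner ℝ ψ φ : ℝ) • v := by
  refine ext_inner_left ℂ fun u => ?_
  rw [ContinuousLinearMap.adjoint_inner_right, inner_tensorOp]
  congr 1
  refine (integral_smul_tensorLp (Lp.memLp ψ) v).trans ?_
  rw [L2.inner_def]
  simp

/-- The tensor product of a finite-dimensional space of functions with a Hilbert space is
closed. -/
theorem isClosed_of_tensorOp (F : Submodule ℝ (Lp ℝ 2 ν)) [FiniteDimensional ℝ F]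
    (P : Submodule ℂ (Lp W 2 ν)) (h1 : ∀ φ ∈ F, ∀ v, tensorOp W φ v ∈ P)
    (h2 : P ≤ Submodule.span ℂ {x | ∃ φ ∈ F, ∃ v, tensorOp W φ v = x}) :
    IsClosed (P : Set (Lp W 2 ν)) := by
  let e := stdOrthonormalBasis ℝ F
  -- For an orthonormal basis of `F` this is the projection onto the tensor product of `F` with `W`.
  -- The space `P` is its fixed point set, hence closed.
  let Φ : Lp W 2 ν →L[ℂ] Lp W 2 ν := ∑ i, tensorOp W (e i : Lp ℝ 2 ν) ∘L
    ContinuousLinearMap.adjoint (tensorOp W (e i : Lp ℝ 2 ν))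
  have hΦ : ∀ x, Φ x ∈ P := fun x => by
    rw [sum_apply]
    exact Submodule.sum_mem _ fun i _ => h1 _ (e i).2 _
  have hid : ∀ x ∈ P, Φ x = x := by
    intro x hxP
    have hx := h2 hxP
    clear hxP
    induction hx using Submodule.span_induction with
    | mem x hx =>
      obtain ⟨φ, hφ, v, rfl⟩ := hx
      rw [sum_apply]
      have e1 : φ = ∑ i, (inner ℝ (e i : Lp ℝ 2 ν) φ : ℝ) • (e i : Lp ℝ 2 ν) := by
        have := congrArg Subtype.val (e.sum_repr' ⟨φ, hφ⟩)
        simpa using this.symm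
      have e2 : tensorOp W φ v
          = ∑ i, ((inner ℝ (e i : Lp ℝ 2 ν) φ : ℝ) : ℂ) • tensorOp W (e i : Lp ℝ 2 ν) v := by
        have e3 : ∀ s : Finset (Fin (Module.finrank ℝ F)), ∀ t : Fin (Module.finrank ℝ F) → ℝ,
            tensorOp W (∑ i ∈ s, t i • (e i : Lp ℝ 2 ν)) v
              = ∑ i ∈ s, (t i : ℂ) • tensorOp W (e i : Lp ℝ 2 ν) v := by
          intro s t
          classical
          induction s using Finset.induction_on with
          | empty => simp [tensorOp_zero]
          | insert i s hi ih =>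
            rw [Finset.sum_insert hi, Finset.sum_insert hi, tensorOp_add, tensorOp_smul, add_apply,
              smul_apply, ih]
        rw [← e3, ← e1]
      rw [e2]
      refine Finset.sum_congr rfl fun i _ => ?_
      rw [← e2, ContinuousLinearMap.comp_apply, adjoint_tensorOp_apply, ← Complex.coe_smul,
        map_smul, real_inner_comm]
    | zero => exact map_zero _
    | add x y _ _ hx hy => rw [map_add, hx, hy]
    | smul c x _ hx => rw [map_smul, hx]
  have : (P : Set (Lp W 2 ν)) = {x | Φ x = x} := by
    ext x
    exact ⟨hid x, fun h => by rw [← show Φ x = x from h]; exact hΦ x⟩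
  rw [this]
  exact isClosed_eq Φ.continuous continuous_id

end Tensor

variable {d : Fin N → CompLaw} {μ : Measure (Fin N → ℝ)}

theorem memLp_polyEval (hμ : IsJointLaw d μ) (n : ℕ) (c : (Fin N → ℕ) → W) :
    MemLp (polyEval n c) 2 μ := by
  refine memLp_finsetSum _ fun α _ => ?_
  simp only [Complex.coe_smul]
  exact memLp_smul_const ((PolyGrowth.monomial α).memLp_two hμ) (c α)

/-- The monomials in `L₂(μ)`. -/
def monomialLp (hμ : IsJointLaw d μ) (α : Fin N → ℕ) : Lp ℝ 2 μ :=
  ((PolyGrowth.monomial α).memLp_two hμ).toLp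

theorem coeFn_monomialLp (hμ : IsJointLaw d μ) (α : Fin N → ℕ) :
    monomialLp hμ α =ᵐ[μ] fun z => ∏ j, z j ^ α j :=
  ((PolyGrowth.monomial α).memLp_two hμ).coeFn_toLp

theorem tensorOp_monomialLp_mem (hμ : IsJointLaw d μ) {n : ℕ} {α : Fin N → ℕ}
    (hα : α ∈ multiIdx N n) (v : W) : tensorOp W (monomialLp hμ α) v ∈ chaosSpace W μ n := by
  classical
  refine ⟨Pi.single α v, ?_⟩
  filter_upwards [coeFn_tensorOp (monomialLp hμ α) v, coeFn_monomialLp hμ α] with z h1 h2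
  rw [h1, h2, polyEval, Finset.sum_eq_single α]
  · rw [Pi.single_eq_same, Complex.coe_smul]
  · intro β _ hβ
    rw [Pi.single_eq_of_ne hβ, smul_zero]
  · exact fun h => (h hα).elim

theorem eq_sum_tensorOp (hμ : IsJointLaw d μ) {n : ℕ} {x : Lp W 2 μ} {c : (Fin N → ℕ) → W}
    (hx : x =ᵐ[μ] polyEval n c) : x = ∑ α ∈ multiIdx N n, tensorOp W (monomialLp hμ α) (c α) := by
  refine Lp.ext (hx.trans ?_)
  have h1 : ∀ᵐ z ∂μ, ∀ α, tensorOp W (monomialLp hμ α) (c α) z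
      = (∏ j, z j ^ α j : ℝ) • c α := by
    rw [ae_all_iff]
    intro α
    filter_upwards [coeFn_tensorOp (monomialLp hμ α) (c α), coeFn_monomialLp hμ α] with z h1 h2
    rw [h1, h2]
  filter_upwards [h1, Lp.coeFn_finsetSum (multiIdx N n)
    (fun α => tensorOp W (monomialLp hμ α) (c α))] with z h1 h2
  rw [h2, Finset.sum_apply, polyEval]
  exact Finset.sum_congr rfl fun α _ => by rw [h1, Complex.coe_smul]

/-- For values in `V`, closedness makes the Galerkin space complete, as Lax–Milgram requires; for
values in `H`, it ensures that the projection takes polynomial values. -/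
theorem isClosed_chaosSpace [CompleteSpace W] (hμ : IsJointLaw d μ) (n : ℕ) :
    IsClosed (chaosSpace W μ n : Set (Lp W 2 μ)) := by
  let F : Submodule ℝ (Lp ℝ 2 μ) := Submodule.span ℝ (monomialLp hμ '' (multiIdx N n : Set _))
  have hF : FiniteDimensional ℝ F :=
    FiniteDimensional.span_of_finite ℝ ((multiIdx N n).finite_toSet.image _)
  refine isClosed_of_tensorOp F _ (fun φ hφ v => ?_) ?_
  · induction hφ using Submodule.span_induction with
    | mem φ hφ =>
      obtain ⟨α, hα, rfl⟩ := hφ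
      exact tensorOp_monomialLp_mem hμ hα v
    | zero => rw [tensorOp_zero]; exact Submodule.zero_mem _
    | add φ ψ _ _ h1 h2 => rw [tensorOp_add]; exact Submodule.add_mem _ h1 h2
    | smul t φ _ h => rw [tensorOp_smul]; exact Submodule.smul_mem _ _ h
  · rintro x ⟨c, hc⟩
    rw [eq_sum_tensorOp hμ hc]
    exact Submodule.sum_mem _ fun α hα => Submodule.subset_span
      ⟨_, Submodule.subset_span ⟨α, hα, rfl⟩, _, rfl⟩

theorem compLpL_mem_chaosSpace {E : Type*} [NormedAddCommGroup E] [InnerProductSpace ℂ E]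
    (T : W →L[ℂ] E) {n : ℕ} {x : Lp W 2 μ} (hx : x ∈ chaosSpace W μ n) :
    T.compLpL 2 μ x ∈ chaosSpace E μ n := by
  obtain ⟨c, hc⟩ := hx
  refine ⟨fun α => T (c α), ?_⟩
  filter_upwards [hc, T.coeFn_compLpL (p := 2) (μ := μ) x] with z h1 h2
  rw [h2, h1, polyEval, map_sum, polyEval]
  exact Finset.sum_congr rfl fun α _ => map_smul _ _ _

/-- A polynomial which is orthogonal to the polynomials with values in a dense subspace
vanishes. -/
theorem eq_zero_of_inner_chaosSpace [CompleteSpace W] (hμ : IsJointLaw d μ) {E : Type*}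
    [NormedAddCommGroup E] [InnerProductSpace ℂ E] {ι : E →L[ℂ] W} (hd : DenseRange ι) {n : ℕ}
    {x : Lp W 2 μ} (hx : x ∈ chaosSpace W μ n)
    (h : ∀ y ∈ chaosSpace E μ n, inner ℂ (ι.compLpL 2 μ y) x = 0) : x = 0 := by
  have h1 : ∀ α ∈ multiIdx N n, ∫ z, monomialLp hμ α z • x z ∂μ = 0 := by
    intro α hα
    refine hd.eq_zero_of_inner_right ℂ fun v => ?_
    rw [← inner_tensorOp, ← h _ (tensorOp_monomialLp_mem hμ hα v)]
    congr 1
    refine Lp.ext ?_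
    filter_upwards [coeFn_tensorOp (monomialLp hμ α) v, coeFn_tensorOp (monomialLp hμ α) (ι v),
      ι.coeFn_compLpL (p := 2) (μ := μ) (tensorOp E (monomialLp hμ α) v)] with z h1 h2 h3
    rw [h2, h3, h1, ← Complex.coe_smul, ← Complex.coe_smul, map_smul]
  obtain ⟨c, hc⟩ := hx
  have h2 : inner ℂ x x = (0 : ℂ) := by
    conv_lhs =>
      arg 2
      rw [eq_sum_tensorOp hμ hc]
    rw [sum_inner]
    exact Finset.sum_eq_zero fun α hα => by rw [inner_tensorOp, h1 α hα, inner_zero_right]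
  exact inner_self_eq_zero.1 h2

end ChaosSpace

/-! ### The polynomial chaos operator and its resolvent -/

section ChaosOperator

open Filter Topology
open scoped NNReal

variable {N : ℕ} {V H : Type*} [NormedAddCommGroup V] [InnerProductSpace ℂ V] [CompleteSpace V]
  [NormedAddCommGroup H] [InnerProductSpace ℂ H] [CompleteSpace H] {ι : V →L[ℂ] H}

/-- Cauchy's inequality for two elements of `L₂`. -/
theorem integral_norm_mul_norm_le {X E F : Type*} [MeasurableSpace X] {ν : Measure X}
    [NormedAddCommGroup E] [NormedAddCommGroup F] (f : Lp E 2 ν) (g : Lp F 2 ν) :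
    Integrable (fun z => ‖f z‖ * ‖g z‖) ν ∧ ∫ z, ‖f z‖ * ‖g z‖ ∂ν ≤ ‖f‖ * ‖g‖ := by
  have hf := (Lp.memLp f).norm
  have hg := (Lp.memLp g).norm
  have h1 : ‖hf.toLp‖ = ‖f‖ := by rw [Lp.norm_toLp, eLpNorm_norm, Lp.norm_def]
  have h2 : ‖hg.toLp‖ = ‖g‖ := by rw [Lp.norm_toLp, eLpNorm_norm, Lp.norm_def]
  have h3 : ∫ z, ‖f z‖ * ‖g z‖ ∂ν = inner ℝ hf.toLp hg.toLp := by
    rw [L2.inner_def]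
    refine integral_congr_ae ?_
    filter_upwards [hf.coeFn_toLp, hg.coeFn_toLp] with z e1 e2
    rw [e1, e2]
    simp [mul_comm]
  refine ⟨hf.integrable_mul hg, ?_⟩
  rw [h3, ← h1, ← h2]
  exact real_inner_le_norm _ _

namespace QuotientFamily

variable {d : Fin N → CompLaw} {μ : Measure (Fin N → ℝ)}
  {a : (Fin N → ℝ) → V →ₗ[ℂ] V →ₗ⋆[ℂ] ℂ} {K κ q : ℝ} {m : ℕ} {g₀ : H →L[ℂ] V} {C M : ℝ≥0}
  {S : Fin N → ℕ → (Fin N → ℝ) → H →L[ℂ] H}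

/-- On polynomials the form is a finite sum of continuous functions of `z`, which settles
measurability; the uniform bound and Cauchy–Schwarz give integrability. -/
theorem integrable_form (hQ : QuotientFamily d μ ι a K κ q m g₀ C M S) {n : ℕ} {w v : Lp V 2 μ}
    (hw : w ∈ chaosSpace V μ n) (hv : v ∈ chaosSpace V μ n) :
    Integrable (fun z => a z (w z) (v z)) μ := by
  obtain ⟨c, hc⟩ := hw
  obtain ⟨e, he⟩ := hv
  have hcont : Continuous fun z => a z (polyEval n c z) (polyEval n e z) := by
    simp only [polyEval, map_sum, LinearMap.sum_apply, map_smul, LinearMap.smul_apply,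
      LinearMap.map_smulₛₗ]
    have h1 : ∀ α : Fin N → ℕ, Continuous fun z : Fin N → ℝ => ((∏ j, z j ^ α j : ℝ) : ℂ) :=
      fun α => Complex.continuous_ofReal.comp (by fun_prop)
    exact continuous_finsetSum _ fun β _ => (Complex.continuous_conj.comp (h1 β)).smul
      (continuous_finsetSum _ fun α _ => (h1 α).smul (hQ.continuous (c α) (e β)))
  refine Integrable.mono' ((integral_norm_mul_norm_le w v).1.const_mul K) ?_ ?_
  · refine hcont.aestronglyMeasurable.congr ?_
    filter_upwards [hc, he] with z h1 h2
    rw [h1, h2]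
  · filter_upwards [hQ.elliptic] with z hz
    rw [← mul_assoc]
    exact hz.bdd _ _

/-- The form `(w, v) ↦ ∫ a_z(w(z), v(z)) dμ(z)` on the polynomials. -/
theorem exists_chaosForm (hQ : QuotientFamily d μ ι a K κ q m g₀ C M S) (n : ℕ) :
    ∃ b : chaosSpace V μ n →ₗ[ℂ] chaosSpace V μ n →ₗ⋆[ℂ] ℂ,
      (∀ w v, b w v = ∫ z, a z ((w : Lp V 2 μ) z) ((v : Lp V 2 μ) z) ∂μ) ∧
        IsEllipticForm K κ b := by
  have hi : ∀ w v : chaosSpace V μ n,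
      Integrable (fun z => a z ((w : Lp V 2 μ) z) ((v : Lp V 2 μ) z)) μ :=
    fun w v => hQ.integrable_form w.2 v.2
  let b : chaosSpace V μ n →ₗ[ℂ] chaosSpace V μ n →ₗ⋆[ℂ] ℂ :=
    LinearMap.mk₂'ₛₗ (RingHom.id ℂ) (starRingEnd ℂ)
      (fun w v => ∫ z, a z ((w : Lp V 2 μ) z) ((v : Lp V 2 μ) z) ∂μ)
      (fun w w' v => by
        rw [← integral_add (hi _ _) (hi _ _)]
        refine integral_congr_ae ?_
        filter_upwards [Lp.coeFn_add (w : Lp V 2 μ) w'] with z h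
        rw [Submodule.coe_add, h, Pi.add_apply, map_add, LinearMap.add_apply])
      (fun c w v => by
        rw [← integral_smul]
        refine integral_congr_ae ?_
        filter_upwards [Lp.coeFn_smul c (w : Lp V 2 μ)] with z h
        rw [Submodule.coe_smul, h, Pi.smul_apply, map_smul, LinearMap.smul_apply]
        rfl)
      (fun w v v' => by
        rw [← integral_add (hi _ _) (hi _ _)]
        refine integral_congr_ae ?_
        filter_upwards [Lp.coeFn_add (v : Lp V 2 μ) v'] with z h
        rw [Submodule.coe_add, h, Pi.add_apply, map_add])
      (fun c w v => by
        rw [← integral_smul]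
        refine integral_congr_ae ?_
        filter_upwards [Lp.coeFn_smul c (v : Lp V 2 μ)] with z h
        rw [Submodule.coe_smul, h, Pi.smul_apply, LinearMap.map_smulₛₗ])
  have hK : ∀ w v : chaosSpace V μ n, ‖b w v‖ ≤ ∫ z, K * (‖(w : Lp V 2 μ) z‖ *
      ‖(v : Lp V 2 μ) z‖) ∂μ := by
    intro w v
    refine norm_integral_le_of_norm_le ((integral_norm_mul_norm_le _ _).1.const_mul K) ?_
    filter_upwards [hQ.elliptic] with z hz
    rw [← mul_assoc]
    exact hz.bdd _ _
  -- No sign of `K` is part of the elliptic structure; a negative `K` is possible only if `V` is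
  -- trivial.
  have hKn : 0 ≤ K ∨ ∀ᵐ z ∂μ, ∀ v : V, v = 0 := by
    by_cases h : 0 ≤ K
    · exact Or.inl h
    · right
      filter_upwards [hQ.elliptic] with z hz v
      by_contra hv
      have h1 := (norm_nonneg _).trans (hz.bdd v v)
      have h2 : 0 < ‖v‖ := norm_pos_iff.2 hv
      rw [mul_assoc] at h1
      exact h (nonneg_of_mul_nonneg_left h1 (by positivity))
  refine ⟨b, fun w v => rfl, ⟨fun w v => ?_, fun w => ?_, fun w v => ?_⟩⟩
  · refine (hK w v).trans ?_
    rw [integral_const_mul, mul_assoc]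
    rcases hKn with h | h
    · exact mul_le_mul_of_nonneg_left (integral_norm_mul_norm_le _ _).2 h
    · have h0 : ∀ w : chaosSpace V μ n, ‖w‖ = 0 := fun w => by
        have : (w : Lp V 2 μ) = 0 := Lp.ext (by
          filter_upwards [h] with z hz
          rw [hz ((w : Lp V 2 μ) z), hz ((0 : Lp V 2 μ) z)])
        rw [Submodule.coe_norm, this, norm_zero]
      rw [h0 w, zero_mul, mul_zero]
      refine le_of_eq (mul_eq_zero_of_right _ (integral_eq_zero_of_ae ?_))
      filter_upwards [h] with z hz
      rw [hz ((w : Lp V 2 μ) z)]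
      simp
  · have h1 : ‖w‖ ^ 2 = ∫ z, ‖(w : Lp V 2 μ) z‖ * ‖(w : Lp V 2 μ) z‖ ∂μ := by
      have h2 : ((‖w‖ ^ 2 : ℝ) : ℂ) = ∫ z, ((‖(w : Lp V 2 μ) z‖ * ‖(w : Lp V 2 μ) z‖ : ℝ) : ℂ) ∂μ := by
        have h3 := inner_self_eq_norm_sq_to_K (𝕜 := ℂ) (w : Lp V 2 μ)
        rw [L2.inner_def] at h3
        rw [Submodule.coe_norm, Complex.ofReal_pow]
        refine h3.symm.trans (integral_congr_ae (Eventually.of_forall fun z => ?_))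
        simp only [inner_self_eq_norm_sq_to_K]
        push_cast
        rw [pow_two]
        rfl
      rw [integral_complex_ofReal] at h2
      exact_mod_cast h2
    have h4 : (b w w).re = ∫ z, (a z ((w : Lp V 2 μ) z) ((w : Lp V 2 μ) z)).re ∂μ :=
      (integral_re (hi w w)).symm
    rw [h1, h4, ← integral_const_mul]
    refine integral_mono_ae ((integral_norm_mul_norm_le _ _).1.const_mul κ) (hi w w).re ?_
    filter_upwards [hQ.elliptic] with z hz
    have := hz.coer ((w : Lp V 2 μ) z)
    rwa [pow_two] at this
  · change ∫ z, a z ((w : Lp V 2 μ) z) ((v : Lp V 2 μ) z) ∂μ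
      = conj (∫ z, a z ((v : Lp V 2 μ) z) ((w : Lp V 2 μ) z) ∂μ)
    rw [← integral_conj]
    refine integral_congr_ae ?_
    filter_upwards [hQ.elliptic] with z hz
    exact hz.symm _ _

end QuotientFamily

theorem chaosProj_eq_self {μ : Measure (Fin N → ℝ)} {n : ℕ} {x : Lp H 2 μ}
    (hx : x ∈ chaosSpace H μ n) : chaosProj μ n x = x :=
  Submodule.starProjection_eq_self_iff.2 (Submodule.le_topologicalClosure _ hx)

theorem chaosProj_mem {d : Fin N → CompLaw} {μ : Measure (Fin N → ℝ)} (hμ : IsJointLaw d μ)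
    (n : ℕ) (x : Lp H 2 μ) : chaosProj μ n x ∈ chaosSpace H μ n := by
  have h := Submodule.starProjection_apply_mem (chaosSpace H μ n).topologicalClosure x
  exact (isClosed_chaosSpace hμ n).submodule_topologicalClosure_eq.le h

theorem inner_chaosProj {μ : Measure (Fin N → ℝ)} {n : ℕ} {y : Lp H 2 μ}
    (hy : y ∈ chaosSpace H μ n) (x : Lp H 2 μ) :
    inner ℂ y (chaosProj μ n x) = inner ℂ y x := by
  rw [chaosProj, ← Submodule.inner_starProjection_left_eq_right]
  congr 1
  exact chaosProj_eq_self hy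

namespace QuotientFamily

variable {d : Fin N → CompLaw} {μ : Measure (Fin N → ℝ)}
  {a : (Fin N → ℝ) → V →ₗ[ℂ] V →ₗ⋆[ℂ] ℂ} {K κ q : ℝ} {m : ℕ} {g₀ : H →L[ℂ] V} {C M : ℝ≥0}
  {S : Fin N → ℕ → (Fin N → ℝ) → H →L[ℂ] H}

theorem chaosGraph_singleValued (hQ : QuotientFamily d μ ι a K κ q m g₀ C M S) (n : ℕ)
    (p : Lp H 2 μ × Lp H 2 μ) (hp : p ∈ chaosGraph μ ι a n) (h0 : p.1 = 0) : p.2 = 0 := by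
  obtain ⟨h1, c, hc, hc'⟩ := hp
  have hc0 : ∀ᵐ z ∂μ, polyEval n c z = 0 := by
    rw [h0, map_zero] at hc
    filter_upwards [hc, Lp.coeFn_zero H 2 μ] with z e1 e2
    rw [e2] at e1
    exact hQ.inj (by rw [← e1, map_zero]; rfl)
  refine eq_zero_of_inner_chaosSpace hQ.law hQ.dense h1 fun y hy => ?_
  obtain ⟨e, he⟩ := hy
  rw [← (hc' e (ι.compLpL 2 μ y) ?_).2]
  · refine integral_eq_zero_of_ae ?_
    filter_upwards [hc0] with z hz
    rw [hz, map_zero]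
    rfl
  · filter_upwards [he, ι.coeFn_compLpL (p := 2) (μ := μ) y] with z e1 e2
    rw [e2, e1]

/-- The resolvent of the polynomial chaos operator is given by the solutions of the variational
equations on the polynomials. -/
theorem isShiftInverse_chaosOperator (hQ : QuotientFamily d μ ι a K κ q m g₀ C M S) (n : ℕ)
    {b : chaosSpace V μ n →ₗ[ℂ] chaosSpace V μ n →ₗ⋆[ℂ] ℂ}
    (hb : ∀ w v, b w v = ∫ z, a z ((w : Lp V 2 μ) z) ((v : Lp V 2 μ) z) ∂μ)
    (hbe : IsEllipticForm K κ b) {lam : ℂ} (hlam : -q * ‖lam‖ ≤ lam.re) (hlam0 : lam ≠ 0)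
    {j : chaosSpace V μ n →L[ℂ] Lp H 2 μ} (hj : ∀ w, j w = ι.compLpL 2 μ (w : Lp V 2 μ))
    {T : Lp H 2 μ →L[ℂ] chaosSpace V μ n}
    (hT : ∀ f v, lam * inner ℂ (j v) (j (T f)) + b (T f) v = inner ℂ (j v) f) :
    IsShiftInverse (chaosOperator μ ι a n) lam
      (j ∘L T + lam⁻¹ • (ContinuousLinearMap.id ℂ (Lp H 2 μ) - chaosProj μ n)) := by
  have hjm : ∀ w, j w ∈ chaosSpace H μ n := fun w => by
    rw [hj]
    exact compLpL_mem_chaosSpace ι w.2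
  have hjc : ∀ (w : chaosSpace V μ n) (c : (Fin N → ℕ) → V), w =ᵐ[μ] polyEval n c →
      j w =ᵐ[μ] fun z => ι (polyEval n c z) := fun w c hw => by
    rw [hj]
    filter_upwards [hw, ι.coeFn_compLpL (p := 2) (μ := μ) (w : Lp V 2 μ)] with z h1 h2
    rw [h2, h1]
  have hex : ∀ c : (Fin N → ℕ) → V, ∃ w : chaosSpace V μ n, (w : Lp V 2 μ) =ᵐ[μ] polyEval n c :=
    fun c => ⟨⟨(memLp_polyEval hQ.law n c).toLp, c, (memLp_polyEval hQ.law n c).coeFn_toLp⟩,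
      (memLp_polyEval hQ.law n c).coeFn_toLp⟩
  have hbc : ∀ (w v : chaosSpace V μ n) (c e : (Fin N → ℕ) → V), w =ᵐ[μ] polyEval n c →
      v =ᵐ[μ] polyEval n e →
      Integrable (fun z => a z (polyEval n c z) (polyEval n e z)) μ ∧
        ∫ z, a z (polyEval n c z) (polyEval n e z) ∂μ = b w v := by
    intro w v c e hw hv
    have h1 : (fun z => a z ((w : Lp V 2 μ) z) ((v : Lp V 2 μ) z)) =ᵐ[μ]
        fun z => a z (polyEval n c z) (polyEval n e z) := by
      filter_upwards [hw, hv] with z h1 h2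
      rw [h1, h2]
    exact ⟨(hQ.integrable_form w.2 v.2).congr h1, by rw [hb, integral_congr_ae h1]⟩
  have hR : ∀ f : Lp H 2 μ, (j ∘L T + lam⁻¹ • (ContinuousLinearMap.id ℂ (Lp H 2 μ) - chaosProj μ n) :
      Lp H 2 μ →L[ℂ] Lp H 2 μ) f
      = j (T f) + lam⁻¹ • (f - chaosProj μ n f) := fun f => rfl
  unfold chaosOperator
  refine isShiftInverse_of_graph (g := chaosGraph μ ι a n) ?_ (fun f => ?_) ?_
  · exact fun p hp h0 => hQ.chaosGraph_singleValued n p hp h0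
  · rw [hR]
    -- The operator is zero on the orthogonal complement of the polynomials, where the resolvent is
    -- multiplication by `lam⁻¹`; this component cancels.
    have e1 : f - lam • (j (T f) + lam⁻¹ • (f - chaosProj μ n f))
        = chaosProj μ n f - lam • j (T f) := by
      rw [smul_add, smul_smul, mul_inv_cancel₀ hlam0, one_smul]
      abel
    rw [e1]
    obtain ⟨c, hc⟩ := (T f).2
    refine ⟨Submodule.sub_mem _ (chaosProj_mem hQ.law n f) (Submodule.smul_mem _ _ (hjm _)), c,
      ?_, fun e v hv => ?_⟩
    · dsimp only
      rw [map_add, map_smul, map_sub, chaosProj_eq_self (chaosProj_mem hQ.law n f), sub_self,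
        smul_zero, add_zero, chaosProj_eq_self (hjm _)]
      exact hjc _ c hc
    · obtain ⟨w, hw⟩ := hex e
      have hwv : v = j w := Lp.ext (hv.trans (hjc w e hw).symm)
      obtain ⟨h1, h2⟩ := hbc (T f) w c e hc hw
      refine ⟨h1, h2.trans ?_⟩
      rw [hwv, inner_sub_right, inner_smul_right, inner_chaosProj (hjm w), ← hT f w,
        add_sub_cancel_left]
  · rintro ⟨x, y⟩ ⟨hy, c, hc, hc'⟩
    dsimp only at hy hc hc' ⊢
    obtain ⟨w, hw⟩ := hex c
    have hwx : chaosProj μ n x = j w := Lp.ext (hc.trans (hjc w c hw).symm)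
    have h1 : T (lam • x + y) = w := by
      refine hbe.eq_of_solves hQ.pos j hQ.nonneg hQ.lt_one hlam fun v => ?_
      obtain ⟨e, he⟩ := v.2
      rw [hT, ← hwx, inner_chaosProj (hjm v), inner_add_right, inner_smul_right,
        ← (hc' e (j v) (hjc v e he)).2, (hbc w v c e hw he).2]
    rw [hR, h1, ← hwx, map_add, map_smul, chaosProj_eq_self hy, add_sub_add_right_eq_sub,
      ← smul_sub, smul_smul, inv_mul_cancel₀ hlam0, one_smul, add_sub_cancel]

end QuotientFamily

end ChaosOperator

/-! ### The error estimate -/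

section ErrorEstimate

open Filter Topology
open scoped NNReal

variable {N : ℕ} {V H : Type*} [NormedAddCommGroup V] [InnerProductSpace ℂ V] [CompleteSpace V]
  [NormedAddCommGroup H] [InnerProductSpace ℂ H] [CompleteSpace H] {ι : V →L[ℂ] H}

namespace QuotientFamily

variable {d : Fin N → CompLaw} {μ : Measure (Fin N → ℝ)}
  {a : (Fin N → ℝ) → V →ₗ[ℂ] V →ₗ⋆[ℂ] ℂ} {K κ q : ℝ} {m : ℕ} {g₀ : H →L[ℂ] V} {C M : ℝ≥0}
  {S : Fin N → ℕ → (Fin N → ℝ) → H →L[ℂ] H}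

/-- The Galerkin solution differs from the exact solution `B₀ y` by at most the distance of `y`
to the polynomials. -/
theorem norm_galerkin_sub_le (hQ : QuotientFamily d μ ι a K κ q m g₀ C M S) (j₀ : Fin N) {n : ℕ}
    {b : chaosSpace V μ n →ₗ[ℂ] chaosSpace V μ n →ₗ⋆[ℂ] ℂ}
    (hb : ∀ w v, b w v = ∫ z, a z ((w : Lp V 2 μ) z) ((v : Lp V 2 μ) z) ∂μ)
    (hbe : IsEllipticForm K κ b) {lam : ℂ} (hlam : -q * ‖lam‖ ≤ lam.re) {r : ℝ} (hr : 0 < r)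
    (hlamr : r ≤ ‖lam‖)
    {j : chaosSpace V μ n →L[ℂ] Lp H 2 μ} (hj : ∀ w, j w = ι.compLpL 2 μ (w : Lp V 2 μ))
    {T : Lp H 2 μ →L[ℂ] Lp H 2 μ} (hT : ∀ f : Lp H 2 μ, T f =ᵐ[μ] fun z => S j₀ 0 z (f z))
    (hTC : ∀ f, ‖T f‖ ≤ C * ‖f‖) {u : chaosSpace V μ n} {f y : Lp H 2 μ}
    (hu : ∀ v, lam * inner ℂ (j v) (j u) + b u v = inner ℂ (j v) f)
    (hy : lam • (ι ∘L g₀).compLpL 2 μ y + T y = f) {x : Lp H 2 μ} (hx : x ∈ chaosSpace H μ n) :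
    ‖j u - (ι ∘L g₀).compLpL 2 μ y‖
      ≤ ((√((1 - q) / 2))⁻¹ * (‖ι ∘L g₀‖ + C / r) + ‖ι ∘L g₀‖) * ‖y - x‖ := by
  set B : Lp H 2 μ →L[ℂ] Lp H 2 μ := (ι ∘L g₀).compLpL 2 μ with hBdef
  have hBn : ∀ f, ‖B f‖ ≤ ‖ι ∘L g₀‖ * ‖f‖ := fun f =>
    B.le_of_opNorm_le (ContinuousLinearMap.norm_compLpL_le _) f
  -- Since `g₀` does not depend on `z`, it maps `H`-valued polynomials to `V`-valued ones without
  -- raising the degree.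
  let w : chaosSpace V μ n := ⟨g₀.compLpL 2 μ x, compLpL_mem_chaosSpace g₀ hx⟩
  have hwz : (w : Lp V 2 μ) =ᵐ[μ] fun z => g₀ (x z) := g₀.coeFn_compLpL x
  have hjw : j w = B x := by
    rw [hj, hBdef]
    refine Lp.ext ?_
    filter_upwards [hwz, ι.coeFn_compLpL (p := 2) (μ := μ) (w : Lp V 2 μ),
      (ι ∘L g₀).coeFn_compLpL (p := 2) (μ := μ) x] with z h1 h2 h3
    rw [h2, h1, h3]
    rfl
  have hbw : ∀ v, b w v = inner ℂ (j v) (T x) := by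
    intro v
    rw [hb, L2.inner_def, hj]
    refine integral_congr_ae ?_
    filter_upwards [hwz, hT x, ι.coeFn_compLpL (p := 2) (μ := μ) (v : Lp V 2 μ),
      hQ.law.ae_mem_box] with z h1 h2 h3 hz
    rw [h1, h2, h3, hQ.inner_apply j₀ hz]
  -- The difference of the Galerkin solution and the competitor solves the discrete equation whose
  -- right side is the residual at `y - x`.
  have he : ∀ v, lam * inner ℂ (j v) (j (u - w)) + b (u - w) v
      = inner ℂ (j v) (lam • B (y - x) + T (y - x)) := by
    intro v
    have e1 : lam • B (y - x) + T (y - x) = f - lam • B x - T x := by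
      rw [map_sub, map_sub, smul_sub, ← hy]
      abel
    rw [e1, map_sub, map_sub, LinearMap.sub_apply, inner_sub_right, inner_sub_right,
      inner_sub_right, inner_smul_right, ← hu v, hbw, hjw]
    ring
  have h1 := hbe.norm_solution_le hQ.pos j hQ.nonneg hQ.lt_one hlam (he (u - w))
  have hlam0 : 0 < ‖lam‖ := hr.trans_le hlamr
  have h2 : ‖lam • B (y - x) + T (y - x)‖ ≤ ‖lam‖ * ((‖ι ∘L g₀‖ + C / r) * ‖y - x‖) := by
    refine (norm_add_le _ _).trans ?_
    -- The part of the residual without a factor `lam` is absorbed by `|lam| ≥ r`, so that the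
    -- discrete resolvent bound cancels `|lam|` completely.
    have h3 : (C : ℝ) ≤ ‖lam‖ * (C / r) := by
      rw [mul_div_assoc', le_div_iff₀ hr, mul_comm]
      exact mul_le_mul_of_nonneg_right hlamr C.2
    calc ‖lam • B (y - x)‖ + ‖T (y - x)‖
        ≤ ‖lam‖ * (‖ι ∘L g₀‖ * ‖y - x‖) + ‖lam‖ * (C / r) * ‖y - x‖ := by
          refine add_le_add ?_ ((hTC _).trans (mul_le_mul_of_nonneg_right h3 (norm_nonneg _)))
          rw [norm_smul]
          exact mul_le_mul_of_nonneg_left (hBn _) (norm_nonneg _)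
      _ = _ := by ring
  have h4 : ‖j (u - w)‖ ≤ (√((1 - q) / 2))⁻¹ * (‖ι ∘L g₀‖ + C / r) * ‖y - x‖ := by
    refine le_of_mul_le_mul_left (h1.trans ?_) hlam0
    refine (mul_le_mul_of_nonneg_left h2 (by positivity)).trans (le_of_eq ?_)
    ring
  have e2 : j u - B y = j (u - w) - B (y - x) := by
    rw [map_sub, map_sub, hjw]
    abel
  rw [e2, add_mul]
  exact (norm_sub_le _ _).trans (add_le_add h4 (hBn _))

variable [TopologicalSpace.SeparableSpace H]

/-- Convergence of the resolvents of the polynomial chaos operators. -/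
theorem exists_resolvent_error {l : ℕ} (hl : 1 ≤ l)
    (hQ : QuotientFamily d μ ι a K κ q (2 * l) g₀ C M S) (j₀ : Fin N) {r : ℝ} (hr : 0 < r) :
    ∃ c : ℝ, 0 ≤ c ∧ ∀ lam : ℂ, -q * ‖lam‖ ≤ lam.re → r ≤ ‖lam‖ → ∀ n : ℕ, 1 ≤ n →
      (∃ R, IsShiftInverse (chaosOperator μ ι a n) lam R) ∧
      (∃ R, IsShiftInverse (multOperator μ fun z => formOperator ι (a z)) lam R) ∧
      ∀ f : Lp H 2 μ, MemSobolev d μ (2 * l) f →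
        ‖shiftInverse (chaosOperator μ ι a n) lam (chaosProj μ n f) -
          shiftInverse (multOperator μ fun z => formOperator ι (a z)) lam f‖
          ≤ c * (n : ℝ) ^ (-(l : ℤ)) * sobolevNorm d μ (2 * l) f := by
  have hm : 1 ≤ 2 * l := by omega
  obtain ⟨c₁, hc₁, happ⟩ := exists_chaos_approx (H := H) hQ.law j₀ l
  let c₂ : ℝ := (√((1 - q) / 2))⁻¹ * (‖ι ∘L g₀‖ + C / r) + ‖ι ∘L g₀‖
  have hc₂ : 0 ≤ c₂ := by positivity
  refine ⟨c₂ * (c₁ * invConst M C (2 * l)), by positivity, fun lam hlam hlamr n hn => ?_⟩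
  have hlam0 : lam ≠ 0 := norm_pos_iff.1 (hr.trans_le hlamr)
  obtain ⟨Y, hY⟩ := hQ.exists_inverseLp hm j₀ hlam
  obtain ⟨T, hT, hTC⟩ := hQ.exists_coeffLp j₀
  obtain ⟨b, hb, hbe⟩ := hQ.exists_chaosForm n
  have : CompleteSpace (chaosSpace V μ n) := (isClosed_chaosSpace hQ.law n).completeSpace_coe
  let j : chaosSpace V μ n →L[ℂ] Lp H 2 μ := ι.compLpL 2 μ ∘L (chaosSpace V μ n).subtypeL
  have hj : ∀ w, j w = ι.compLpL 2 μ (w : Lp V 2 μ) := fun w => rfl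
  obtain ⟨G, hG⟩ := hbe.exists_solver hQ.pos j hQ.nonneg hQ.lt_one hlam
  have hR := hQ.isShiftInverse_chaosOperator n hb hbe hlam hlam0 hj hG
  have hR' := hQ.isShiftInverse_multOperator j₀ hlam hY
  refine ⟨⟨_, hR⟩, ⟨_, hR'⟩, fun f hf => ?_⟩
  rw [hR.shiftInverse_eq, hR'.shiftInverse_eq]
  have e1 : (j ∘L G + lam⁻¹ • (ContinuousLinearMap.id ℂ (Lp H 2 μ) - chaosProj μ n) :
      Lp H 2 μ →L[ℂ] Lp H 2 μ) (chaosProj μ n f) = j (G (chaosProj μ n f)) := by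
    change j (G (chaosProj μ n f)) + lam⁻¹ • (chaosProj μ n f - chaosProj μ n (chaosProj μ n f)) = _
    rw [chaosProj_eq_self (chaosProj_mem hQ.law n f), sub_self, smul_zero, add_zero]
  rw [e1, ContinuousLinearMap.comp_apply]
  obtain ⟨g, hfg, hg⟩ := exists_weightedReg_of_memSobolev hQ.law hf
  obtain ⟨x, hx, hxy⟩ := happ (Y f) _ _
    (ENNReal.mul_ne_top ENNReal.coe_ne_top ENNReal.ofReal_ne_top)
    (show Y f =ᵐ[μ] fun z => Ring.inverse (lam • (ι ∘L g₀) + S j₀ 0 z) (g z) by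
      filter_upwards [hY f, hfg] with z h1 h2
      rw [h1, h2])
    (fun j => hQ.weightedReg_inverse hm j₀ hlam j (hg j)) n hn
  have hy : lam • (ι ∘L g₀).compLpL 2 μ (Y f) + T (Y f) = f := by
    refine Lp.ext ?_
    filter_upwards [hY f, hT (Y f), (ι ∘L g₀).coeFn_compLpL (p := 2) (μ := μ) (Y f),
      Lp.coeFn_add (lam • (ι ∘L g₀).compLpL 2 μ (Y f)) (T (Y f)),
      Lp.coeFn_smul lam ((ι ∘L g₀).compLpL 2 μ (Y f)), hQ.law.ae_mem_box] with z h1 h2 h3 h4 h5 hz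
    rw [h4, Pi.add_apply, h5, Pi.smul_apply, h3, h2, h1]
    exact hQ.apply_inverse j₀ hlam hz (f z)
  -- The projection of `f` may be replaced by `f`, because the equation is tested with polynomials
  -- only.
  have hu : ∀ v, lam * inner ℂ (j v) (j (G (chaosProj μ n f))) + b (G (chaosProj μ n f)) v
      = inner ℂ (j v) f := fun v => by
    rw [hG]
    exact inner_chaosProj (compLpL_mem_chaosSpace ι v.2) f
  refine (hQ.norm_galerkin_sub_le j₀ hb hbe hlam hr hlamr hj hT hTC hu hy hx).trans ?_
  refine (mul_le_mul_of_nonneg_left hxy hc₂).trans (le_of_eq ?_)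
  rw [ENNReal.toReal_mul, ENNReal.coe_toReal, ENNReal.toReal_ofReal
    (show 0 ≤ sobolevNorm d μ (2 * l) f from Real.sqrt_nonneg _)]
  ring

end QuotientFamily

/-- On the rays the real part is exactly `cos η` times the modulus, and on the arc the cosine is
larger. The contour lies in the sector with `q = -cos η`. -/
theorem sector_of_mem_contour {η r : ℝ} (hr : 0 < r) (hη : η ∈ Ioo (Real.pi / 2) Real.pi)
    {lam : ℂ} (h : lam ∈ contour η r) : r ≤ ‖lam‖ ∧ -(-Real.cos η) * ‖lam‖ ≤ lam.re := by
  have hexp : ∀ t : ℝ, ‖Complex.exp ((t : ℂ) * Complex.I)‖ = 1 := Complex.norm_exp_ofReal_mul_I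
  have hre : ∀ s t : ℝ, ((s : ℂ) * Complex.exp ((t : ℂ) * Complex.I)).re = s * Real.cos t := by
    intro s t
    rw [Complex.re_ofReal_mul, Complex.exp_ofReal_mul_I_re]
  rw [neg_neg]
  obtain (⟨s, hs, rfl⟩ | ⟨φ, hφ, rfl⟩) | ⟨s, hs, rfl⟩ := h
  · have e : -(s : ℂ) * Complex.exp (-(η : ℂ) * Complex.I)
        = ((-s : ℝ) : ℂ) * Complex.exp (((-η : ℝ) : ℂ) * Complex.I) := by push_cast; rfl
    have hs' : r < -s := lt_neg.1 hs
    dsimp only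
    rw [e, norm_mul, hexp, hre, Complex.norm_real, mul_one, Real.norm_of_nonneg (hr.trans hs').le,
      Real.cos_neg, mul_comm]
    exact ⟨hs'.le, le_rfl⟩
  · dsimp only
    rw [norm_mul, hexp, hre, Complex.norm_real, mul_one, Real.norm_of_nonneg hr.le, mul_comm]
    refine ⟨le_rfl, mul_le_mul_of_nonneg_left ?_ hr.le⟩
    rw [← Real.cos_abs φ]
    exact Real.cos_le_cos_of_nonneg_of_le_pi (abs_nonneg _) hη.2.le (abs_lt.2 hφ).le
  · have hs' : r < s := hs
    dsimp only
    rw [norm_mul, hexp, hre, Complex.norm_real, mul_one, Real.norm_of_nonneg (hr.trans hs').le,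
      mul_comm]
    exact ⟨hs'.le, le_rfl⟩

end ErrorEstimate

end RandomEvolution

end

/-! ### The convergence theorem for the random vector -/

theorem mainTheorem6
    -- the random vector `Z` with independent components
    {Ω : Type*} [MeasurableSpace Ω] (P : Measure Ω) [IsProbabilityMeasure P]
    {N : ℕ} (hN : 1 ≤ N) (Z : Ω → Fin N → ℝ) (hZ : Measurable Z)
    (hindep : iIndepFun (fun (j : Fin N) (x : Ω) => Z x j) P)
    (d : Fin N → CompLaw) (hd : ∀ j, (d j).Admissible)
    (hlaw : ∀ j, P.map (fun x => Z x j) = (d j).measure)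
    -- the spaces `V ↪ H`
    {V H : Type*} [NormedAddCommGroup V] [InnerProductSpace ℂ V] [CompleteSpace V]
    [TopologicalSpace.SeparableSpace V]
    [NormedAddCommGroup H] [InnerProductSpace ℂ H] [CompleteSpace H]
    [TopologicalSpace.SeparableSpace H]
    (ι : V →L[ℂ] H) (hι : Function.Injective ι) (hιd : DenseRange ι)
    -- the forms: measurable, a.s. uniformly bounded, uniformly coercive and symmetric
    (a : (Fin N → ℝ) → V →ₗ[ℂ] V →ₗ⋆[ℂ] ℂ) (ha : ∀ u, Measurable fun z => a z u u)
    (K κ : ℝ) (hK : 0 < K) (hκ : 0 < κ)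
    (hbdd : ∀ᵐ z ∂(P.map Z), ∀ u v, ‖a z u v‖ ≤ K * ‖u‖ * ‖v‖)
    (hcoer : ∀ᵐ z ∂(P.map Z), ∀ u, κ * ‖u‖ ^ 2 ≤ (a z u u).re)
    (hsymm : ∀ᵐ z ∂(P.map Z), ∀ u v, a z u v = conj (a z v u))
    -- for some `s ≥ 1`, the domains of `A_z ^ s` agree a.s., with equivalent graph norms
    (s : ℝ) (hs : 1 ≤ s) (Ds : Submodule ℂ H)
    (hDs : ∀ᵐ z ∂(P.map Z),
      (fracPow (formOperator ι (a z)) s).domain = Ds)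
    (hDsnorm : ∃ c : ℝ, ∀ᵐ z ∂(P.map Z), ∀ᵐ z' ∂(P.map Z),
      ∀ (u : H) (hu : u ∈ (fracPow (formOperator ι (a z)) s).domain)
        (hu' : u ∈ (fracPow (formOperator ι (a z')) s).domain),
        graphNorm _ ⟨u, hu⟩ ≤ c * graphNorm _ ⟨u, hu'⟩)
    -- `D` is the common domain of the `A_z`, with a norm equivalent to their graph norms
    (D : Submodule ℂ H) (normD : Seminorm ℂ D)
    (hD : ∀ᵐ z ∂(P.map Z), (formOperator ι (a z)).domain = D)
    (hDnorm : ∀ᵐ z ∂(P.map Z), ∃ c : ℝ,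
      ∀ (u : H) (hu : u ∈ D) (hu' : u ∈ (formOperator ι (a z)).domain),
        normD ⟨u, hu⟩ ≤ c * graphNorm _ ⟨u, hu'⟩ ∧
        graphNorm _ ⟨u, hu'⟩ ≤ c * normD ⟨u, hu⟩)
    -- smoothness of order `2ℓ` in `z` and the weighted derivative bounds
    (l : ℕ) (hl : 1 ≤ l)
    (hsmooth : ∀ u v, ContDiff ℝ (2 * l : ℕ) fun z => a z u v)
    (hderiv : ∃ C : ℝ, ∀ᵐ z ∂(P.map Z), ∀ (u v : V) (hu : ι u ∈ D) (α : Fin N → ℕ),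
      ∑ j, α j ≤ 2 * l →
      ‖weight d α z • multiDeriv α (fun y => a y u v) z‖
        ≤ C * normD ⟨ι u, hu⟩ * ‖ι v‖)
    -- the contour
    (r : ℝ) (hr : 0 < r) (η : ℝ) (hη : η ∈ Ioo (Real.pi / 2) Real.pi) :
    ∃ C : ℝ, 0 ≤ C ∧ ∀ lam ∈ contour η r, ∀ n : ℕ, 1 ≤ n →
      (∃ R, IsShiftInverse
        (chaosOperator (P.map Z) ι a n) lam R) ∧
      (∃ R, IsShiftInverse
        (multOperator (P.map Z)
          fun z => formOperator ι (a z)) lam R) ∧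
      ∀ f : Lp H 2 (P.map Z), MemSobolev d (P.map Z) (2 * l) f →
        ‖shiftInverse (chaosOperator (P.map Z) ι a n) lam
            (chaosProj (P.map Z) n f) -
          shiftInverse (multOperator (P.map Z)
            fun z => formOperator ι (a z)) lam f‖
          ≤ C * (n : ℝ) ^ (-(l : ℤ)) * sobolevNorm d (P.map Z) (2 * l) f := by
  have hμ := isJointLaw_map P Z hZ hindep hd hlaw
  have hcos : Real.cos η < 0 := Real.cos_neg_of_pi_div_two_lt_of_lt hη.1
    (hη.2.trans (by linarith [Real.pi_pos]))
  have hcos' : -1 < Real.cos η := by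
    rw [← Real.cos_pi]
    exact Real.cos_lt_cos_of_nonneg_of_le_pi (by linarith [hη.1, Real.pi_pos]) le_rfl hη.2
  have hell : ∀ᵐ z ∂(P.map Z), IsEllipticForm K κ (a z) := by
    filter_upwards [hbdd, hcoer, hsymm] with z h1 h2 h3
    exact ⟨h1, h2, h3⟩
  -- The choice `q = -cos η` lies strictly between `0` and `1` because `η` is strictly between `π /
  -- 2` and `π`.
  obtain ⟨g₀, C, M, S, hQ⟩ := exists_quotientFamily (q := -Real.cos η) (m := 2 * l) hμ hι hιd hκ
    hell hs hDs hDsnorm (normD := normD) hD (fun x => apply_nonneg normD x)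
    (by
      filter_upwards [hDnorm] with z hz
      obtain ⟨c, hc⟩ := hz
      exact ⟨c, fun u hu hu' => (hc u hu hu').1⟩)
    (by omega) hsmooth hderiv (by linarith) (by linarith)
  obtain ⟨c, hc, h⟩ := hQ.exists_resolvent_error hl ⟨0, hN⟩ hr
  refine ⟨c, hc, fun lam hlam n hn => ?_⟩
  obtain ⟨h1, h2⟩ := sector_of_mem_contour hr hη hlam
  exact h lam h2 h1 n hn
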